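/- **Setting.** A (3-)colex is a finite cell complex whose graph has at every vertex exactly one edge of each of four colours, whose faces and cells are the connected components of the subgraphs formed by the edges of two, respectively three, colours, and whose cells are polyhedra (each has a boundary homeomorphic to the 2-sphere); the colour of a cell is the colour missing in its edges. A *tetrahedral colex* is obtained from a closed colex by removing one vertex together with all edges, faces and cells that contain it, in such a way that the result is homeomorphic to a 3-ball. The trace of the removed $\kappa$-coloured cell is the $\kappa$-facet, so there are four facets, one of each colour. Let $\Phi_{\mathrm{all}}$ be the set of faces of a tetrahedral colex, and let $\phi+\phi'$ denote symmetric difference. A set of faces is a *syndrome* if, for some set $Q$ of vertices, it consists of the faces that have an odd number of vertices in $Q$; $\mathcal C$ is the set of syndromes. Let $C_i$ be a set of cells (for instance a member of a chain $C_1\subset\dots\subset C_n$ of sets of cells, $C_n$ being the set of all cells). Let $\Phi_i$ be the set of faces of the cells in $C_i$, $\overline{\Phi_i}=\Phi_{\mathrm{all}}\setminus\Phi_i$, and $$\mathcal C_i=\{\phi\subseteq\Phi_i \mid \exists\,\phi'\subseteq\overline{\Phi_i}:\ \phi+\phi'\in\mathcal C\}.$$ The *closure condition* with constant $k_{\mathrm{close}}$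 says that for every $\phi\in\mathcal C_i$ there is $\phi'\subseteq\overline{\Phi_i}$ with $|\phi'|\le k_{\mathrm{close}}|\phi|$ and $\phi+\phi'\in\mathcal C$. The dual graph has a vertex per cell and an edge per face, joining the two cells that the face is part of; an edge dual to a face on a facet has a single endpoint and is said to be connected to that facet. Let $\Gamma_i$ and $\overline{\Gamma_i}$ be its subgraphs formed by the edges dual to faces in $\Phi_i$ and in $\overline{\Phi_i}$, with the endpoints of these edges as vertices. In $\Gamma_i$, let $d(v,v')$ be the graph distance ($\infty$ if there is no path), $d_\kappa(v)$ the least number of edges of a path from $v$ to the $\kappa$-facet, counting the last edge, which is connected to the facet ($\infty$ if there is none), and $d(v)$ the sum of the two smallest of the four values $d_\kappa(v)$. Let $\overline d(v,v')$, $\overline d_\kappa(v)$, $\overline d(v)$ be the analogous quantities for $\overline{\Gamma_i}$. **Lemma.** Let $k\ge 0$ be real and let $k_{\mathrm{face}}$ be a natural number such that every cell of the tetrahedral colex has at most $k_{\mathrm{face}}$ faces. Suppose that - for every cell $c\notin C_i$, the set of points of $c$ that also belong to some element of $C_i$ is empty or simply connected, and - for any colour $\kappa$ and any $v,v'$ that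 are vertices of both $\Gamma_i$ and $\overline{\Gamma_i}$, $$\overline d(v,v')\le k\,d(v,v'),\qquad \min\bigl(\overline d_\kappa(v),\overline d(v)\bigr)\le k\,d_\kappa(v)$$ (with the convention $0\cdot\infty=0$). Then the closure condition holds with $k_{\mathrm{close}}=4k(k_{\mathrm{face}}-1)$. -/

import Mathlib

open scoped ENNReal NNReal symmDiff

/-- A closed 3-colex presented by its coloured graph: vertices `V`, and at every vertex exactly one
edge of each of the four colours (`nbr κ v` is the other end of the `κ`-edge at `v`).
One vertex `out` is marked: the colex with boundary that we study is what is left after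
removing `out` together with all edges, faces and cells that contain it. -/
structure ColexGraph (V : Type*) where
  nbr : Fin 4 → V → V
  nbr_nbr : ∀ κ v, nbr κ (nbr κ v) = v
  nbr_ne : ∀ κ v, nbr κ v ≠ v
  out : V

namespace ColexGraph

variable {V : Type*} (G : ColexGraph V)

/-- The set of vertices reachable from `v` along edges with colours in `s`. -/
def component (s : Finset (Fin 4)) (v : V) : Set V :=
  {w | Relation.ReflTransGen (fun x y => ∃ κ ∈ s, G.nbr κ x = y) v w}

/-- The elements (vertices, edges, faces, cells) of the colex: connected components of the
subgraphs formed by the edges with colours in a set `s` of at most three colours, those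
containing `out` being removed. The dimension of the element is the cardinality of `s`.
They are ordered by incidence: `(s, A) ≤ (t, B)` iff `s ⊆ t` and `A ⊆ B`. -/
abbrev Elem : Type _ :=
  {p : Finset (Fin 4) × Set V //
    p.1.card ≤ 3 ∧ (∃ v, p.2 = G.component p.1 v) ∧ G.out ∉ p.2}

/-- Faces (2-dimensional elements). Their edges have two alternating colours. -/
abbrev Face : Type _ := {e : G.Elem // e.1.1.card = 2}

/-- Cells (3-dimensional elements). The colour of a cell is the one missing in its edges. -/
abbrev Cell : Type _ := {e : G.Elem // e.1.1.card = 3}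

/-- The set of vertices of a face. -/
def verts (f : G.Face) : Set V := f.1.1.2

/-- The face `f` is part of the cell `c`. -/
def IsFaceOf (f : G.Face) (c : G.Cell) : Prop := f.1 ≤ c.1

/-- The face `f` belongs to the facet of colour `κ`. The `κ`-facet is the trace of the
removed `κ`-cell, the one that contains `out`. -/
def OnFacet (κ : Fin 4) (f : G.Face) : Prop :=
  f.1.1.1 ⊆ {κ}ᶜ ∧ G.verts f ⊆ G.component {κ}ᶜ G.out

end ColexGraph

/-- The geometric realization (inside `α → ℝ`, through barycentric coordinates) of the order
complex of a subset `S` of a finite partially ordered set. For the poset of elements of a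
regular cell complex it is the barycentric subdivision of that complex. -/
def realization {α : Type*} [PartialOrder α] (S : Set α) : Set (α → ℝ) :=
  {w | (∀ a, 0 ≤ w a) ∧ ∑ᶠ a, w a = 1 ∧ Function.support w ⊆ S ∧
    IsChain (· ≤ ·) (Function.support w)}

/-- A tetrahedral colex: finite, every cell is a polyhedron (its boundary is a topological
2-sphere), and the whole colex, whose boundary is made of the four facets left by the removal
of `out`, is a topological 3-ball. -/
structure TetrahedralColex (V : Type*) extends ColexGraph V where
  finite : Finite V
  cell_boundary : ∀ c : toColexGraph.Cell,
    Nonempty (realization (Set.Iio c.1) ≃ₜ Metric.sphere (0 : EuclideanSpace ℝ (Fin 3)) 1)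
  ball : Nonempty (realization (Set.univ : Set toColexGraph.Elem) ≃ₜ
    Metric.closedBall (0 : EuclideanSpace ℝ (Fin 3)) 1)

namespace TetrahedralColex

variable {V : Type*} (T : TetrahedralColex V)

abbrev Face : Type _ := T.toColexGraph.Face

abbrev Cell : Type _ := T.toColexGraph.Cell

/-- The set of points of a (closed) cell. -/
def points (c : T.Cell) : Set (T.toColexGraph.Elem → ℝ) := realization (Set.Iic c.1)

/-- The code `𝒞` of `X`-error syndromes. There is a qubit per vertex and a `Z`-type generator per
face, so the syndrome of an `X` error with support `Q` is the set of faces that share an odd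
number of vertices with `Q`. -/
def syndromes : Set (Set T.Face) :=
  {φ | ∃ Q : Set V, T.out ∉ Q ∧ φ = {f | Odd (T.verts f ∩ Q).ncard}}

/-- The set `Φ_C` of faces of the cells in `C`. -/
def facesOf (C : Set T.Cell) : Set T.Face := {f | ∃ c ∈ C, T.IsFaceOf f c}

/-- The code of the restrictions to `Φ` that can be completed outside `Φ` to a syndrome. -/
def partialCode (Φ : Set T.Face) : Set (Set T.Face) :=
  {φ | φ ⊆ Φ ∧ ∃ φ' ⊆ Φᶜ, φ ∆ φ' ∈ T.syndromes}

/-- The closure condition for the layer that is determined by the set of cells `C`. -/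
def ClosureCondition (C : Set T.Cell) (kclose : ℝ) : Prop :=
  ∀ φ ∈ T.partialCode (T.facesOf C), ∃ φ' ⊆ (T.facesOf C)ᶜ,
    (φ'.ncard : ℝ) ≤ kclose * φ.ncard ∧ φ ∆ φ' ∈ T.syndromes

/-- The subgraph of the dual graph with the edges dual to the faces in `Φ`, up to the multiplicity
of edges. (Edges dual to a face on a facet have a single endpoint and enter `facetDist` only.) -/
def dualGraph (Φ : Set T.Face) : SimpleGraph T.Cell where
  Adj c c' := c ≠ c' ∧ ∃ f ∈ Φ, T.IsFaceOf f c ∧ T.IsFaceOf f c'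
  symm := ⟨fun _ _ h => ⟨h.1.symm, h.2.imp fun _ hf => ⟨hf.1, hf.2.2, hf.2.1⟩⟩⟩
  loopless := ⟨fun _ h => h.1 rfl⟩

/-- The vertices of that subgraph: the endpoints of its edges. -/
def dualVertices (Φ : Set T.Face) : Set T.Cell := {c | ∃ f ∈ Φ, T.IsFaceOf f c}

/-- `d(v, v')` in the dual graph with edge set `Φ`; infinite if there is no path. -/
noncomputable def dist (Φ : Set T.Face) (v v' : T.Cell) : ℕ∞ := (T.dualGraph Φ).edist v v'

/-- `d_κ(v)`: the least number of edges of a path from `v` to the `κ`-facet in the dual graph with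
edge set `Φ`. The last edge of the path is the one connected to the facet. -/
noncomputable def facetDist (Φ : Set T.Face) (κ : Fin 4) (v : T.Cell) : ℕ∞ :=
  ⨅ (u : T.Cell) (_ : ∃ f ∈ Φ, T.IsFaceOf f u ∧ T.OnFacet κ f), T.dist Φ v u + 1

/-- `d(v)`: the sum of the two smallest of the four values `d_κ(v)`. -/
noncomputable def twoFacetDist (Φ : Set T.Face) (v : T.Cell) : ℕ∞ :=
  ⨅ (κ : Fin 4) (l : Fin 4) (_ : κ ≠ l), T.facetDist Φ κ v + T.facetDist Φ l v

end TetrahedralColex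

/-! Everything is linear algebra over `ZMod 2`. By duality (`exists_symmDiff_mem_syndromes`), `φ`
can be completed to a syndrome by faces of a set `M` as soon as `φ` is orthogonal to every `τ` that
vanishes on `M` and is orthogonal to the syndromes of single vertices. So it suffices to find a
small `M`, outside the layer, with this property.

Such `τ` come from cells (`exists_potential`). A `κ`-cell carries a row, an even function on the
colours other than `κ`, and the face between a `κ`-cell and an `l`-cell gets the `l`-entry of the
first row plus the `κ`-entry of the second; the removed cells carry the row zero. At each vertex
rows exist, and the choice is ambiguous by an element of the cycle space of the complete graph on
the colours. The obstruction to a global choice is a class in the first cohomology with coefficients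
in that space, which vanishes because the colex is a ball and the cells have spheres as boundaries.

If `τ` is zero on a face, the rows on its two sides are the rows of a unique `z` in the cycle space.
Inside a cell this `z` passes from a face to one that shares a vertex with it if `τ` vanishes on at
most two further faces. By the simple connectivity hypothesis and a form of Alexander duality
(`eq_empty_or_forall_mem_of_acyclic`), the faces of a cell outside the layer are connected in this
way, so a cell is crossed in at most `kface - 1` moves. Hence `n` joined dual edges outside the
layer impose one common `z` at the cost of `2 * n * (kface - 1)` faces in `M`
(`OpenTree.exists_agrees`). Reaching the `κ`-facet gives `z κ = 0`, and reaching two facets gives `z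
= 0`; this is why the hypothesis may use the minimum.

For a connected component of the dual graph of `φ`, take a closed walk that visits all its cells, of
length at most twice the number of faces. Replacing the stretches between boundary cells by paths
outside the layer costs a factor `k` and makes the rows of all boundary cells equal to those of one
`z` (`exists_agrees_on_component`). Adding `z` to the potential does not change `τ` on the component
and makes these rows zero. In every other cell `φ` restricts to a syndrome, which is orthogonal to
all rows. So `τ` and the component are orthogonal, and the sizes add up to `k * 2 * 2 * (kface - 1)`
per face of `φ`. -/

section

open Topology

universe u

/-! ### First Čech cohomology of simply connected spaces and of the 2-sphere. -/

/-- Every Čech cocycle with constant values in `G` on an open cover of `X` is trivial. -/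
def CechTrivial (X : Type*) [TopologicalSpace X] (G : Type*) [AddCommGroup G] : Prop :=
  ∀ (ι : Type u) (U : ι → Set X) (c : ι → ι → G), (∀ i, IsOpen (U i)) → (∀ x, ∃ i, x ∈ U i) →
    (∀ i j k x, x ∈ U i → x ∈ U j → x ∈ U k → c i k = c i j + c j k) →
    ∃ s : ι → X → G, (∀ i, ∀ x ∈ U i, ∀ᶠ y in 𝓝 x, s i y = s i x) ∧
      ∀ i j x, x ∈ U i → x ∈ U j → s j x = s i x + c i j

/-- The cocycle glues the products `U i × G` to a bundle with discrete fibre, that is, a covering.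
Simple connectivity lifts the identity to a global section, and `s i` is this section read in the
chart `i`. -/
theorem cechTrivial_of_simplyConnected (X : Type*) [TopologicalSpace X] [SimplyConnectedSpace X]
    [LocallyPathConnectedSpace X] (G : Type*) [AddCommGroup G] : CechTrivial.{u} X G := by
  intro ι U c hU hcov hc
  let _ : TopologicalSpace G := ⊥
  have : DiscreteTopology G := ⟨rfl⟩
  choose idx hidx using hcov
  have hself : ∀ i x, x ∈ U i → c i i = 0 := fun i x hx => by
    have := hc i i i x hx hx hx
    simpa using this
  let Z : FiberBundleCore ι X G :=
    { baseSet := U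
      isOpen_baseSet := hU
      indexAt := idx
      mem_baseSet_at := hidx
      coordChange := fun i j _ v => v + c i j
      coordChange_self := fun i x hx v => by simp [hself i x hx]
      continuousOn_coordChange := fun i j =>
        ((continuous_of_discreteTopology (f := fun v : G => v + c i j)).comp
          continuous_snd).continuousOn
      coordChange_comp := fun i j k x hx v => by
        rw [hc i j k x hx.1.1 hx.1.2 hx.2, add_assoc] }
  have cov : IsCoveringMap Z.proj := FiberBundle.isCoveringMap
  obtain ⟨x₀⟩ : Nonempty X := inferInstance
  obtain ⟨F, ⟨-, hF⟩, -⟩ := cov.existsUnique_continuousMap_lifts (ContinuousMap.id X) x₀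
    (⟨x₀, (0 : G)⟩ : Z.TotalSpace) rfl
  have hF' : ∀ x, (F x).proj = x := fun x => congrFun hF x
  refine ⟨fun i x => (Z.localTriv i (F x)).2, fun i x hx => ?_, fun i j x hi hj => ?_⟩
  · have h1 : ContinuousAt (Z.localTriv i) (F x) :=
      (Z.localTriv i).continuousAt (by rw [Z.mem_localTriv_source, ← Z.baseSet_at, hF']; exact hx)
    have h2 : ContinuousAt (fun y => (Z.localTriv i (F y)).2) x :=
      (ContinuousAt.comp (g := Z.localTriv i) (f := F) h1 F.continuous.continuousAt).snd
    exact h2 (by simp : {_} ∈ 𝓝 _)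
  · simp only [FiberBundleCore.localTriv_apply, hF']
    exact (congrArg (fun g : G => (show G from (F x).snd) + g) (hc (idx x) i j x (hidx x) hi hj)).trans
      (add_assoc (G := G) _ _ _).symm

theorem CechTrivial.homeomorph {X Y : Type*} [TopologicalSpace X] [TopologicalSpace Y]
    {G : Type*} [AddCommGroup G] (hX : CechTrivial.{u} X G) (e : X ≃ₜ Y) : CechTrivial.{u} Y G := by
  intro ι U c hU hcov hc
  obtain ⟨s, hs, hs'⟩ := hX ι (fun i => e ⁻¹' U i) c (fun i => (hU i).preimage e.continuous)
    (fun x => hcov (e x)) (fun i j k x => hc i j k (e x))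
  refine ⟨fun i y => s i (e.symm y), fun i y hy => ?_, fun i j y hi hj => ?_⟩
  · exact e.symm.continuous.continuousAt.eventually (hs i (e.symm y) (by simpa using hy))
  · exact hs' i j _ (by simpa using hi) (by simpa using hj)

/-- A function that is locally constant at the points of a preconnected set is constant on it. -/
theorem IsPreconnected.eq_of_eventually_eq {X G : Type*} [TopologicalSpace X] {A : Set X}
    (hA : IsPreconnected A) {f : X → G} (hf : ∀ x ∈ A, ∀ᶠ y in 𝓝 x, f y = f x) {x y : X}
    (hx : x ∈ A) (hy : y ∈ A) : f x = f y := by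
  let _ : TopologicalSpace G := ⊥
  have : DiscreteTopology G := ⟨rfl⟩
  refine hA.constant (f := f) (fun z hz => ContinuousAt.continuousWithinAt ?_) hx hy
  exact (continuousAt_const (y := f z)).congr ((hf z hz).mono fun w hw => hw.symm)

/-- Mayer–Vietoris: on `A ∩ B` the two primitives differ by a locally constant function that does
not depend on the index, hence by a constant `d`. Shifting the primitive on `B` by `d` makes them
glue. -/
theorem CechTrivial.union {X : Type*} [TopologicalSpace X] {G : Type*} [AddCommGroup G]
    {A B : Set X} (hA : IsOpen A) (hB : IsOpen B) (hAB : ∀ x, x ∈ A ∨ x ∈ B)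
    (hconn : IsPreconnected (A ∩ B)) (tA : CechTrivial.{u} A G) (tB : CechTrivial.{u} B G) :
    CechTrivial.{u} X G := by
  classical
  intro ι U c hU hcov hc
  have key : ∀ D : Set X, IsOpen D → CechTrivial.{u} D G →
      ∃ s : ι → X → G, (∀ i, ∀ x ∈ U i, x ∈ D → ∀ᶠ y in 𝓝 x, s i y = s i x) ∧
        ∀ i j x, x ∈ D → x ∈ U i → x ∈ U j → s j x = s i x + c i j := by
    intro D hD tD
    obtain ⟨s, hs, hs'⟩ := tD ι (fun i => Subtype.val ⁻¹' U i) c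
      (fun i => (hU i).preimage continuous_subtype_val) (fun x => hcov x)
      (fun i j k x => hc i j k x)
    refine ⟨fun i x => if h : x ∈ D then s i ⟨x, h⟩ else 0, fun i x hx hxD => ?_,
      fun i j x hxD hi hj => ?_⟩
    · have := hs i ⟨x, hxD⟩ hx
      rw [nhds_subtype_eq_comap, Filter.eventually_comap] at this
      filter_upwards [this, hD.mem_nhds hxD] with y hy hyD
      simp only [hyD, hxD, dif_pos]
      exact hy ⟨y, hyD⟩ rfl
    · simp only [hxD, dif_pos]
      exact hs' i j ⟨x, hxD⟩ hi hj
  obtain ⟨s, hs, hs'⟩ := key A hA tA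
  obtain ⟨t, ht, ht'⟩ := key B hB tB
  choose idx hidx using hcov
  have hdiff : ∀ i j x, x ∈ A ∩ B → x ∈ U i → x ∈ U j → s i x - t i x = s j x - t j x := by
    intro i j x hx hi hj
    rw [hs' i j x hx.1 hi hj, ht' i j x hx.2 hi hj]; abel
  have hloc : ∀ x ∈ A ∩ B, ∀ᶠ y in 𝓝 x, s (idx y) y - t (idx y) y = s (idx x) x - t (idx x) x := by
    intro x hx
    filter_upwards [hs (idx x) x (hidx x) hx.1, ht (idx x) x (hidx x) hx.2,
      (hU (idx x)).mem_nhds (hidx x), (hA.inter hB).mem_nhds hx] with y h1 h2 h3 h4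
    rw [hdiff (idx y) (idx x) y h4 (hidx y) h3, h1, h2]
  obtain ⟨d, hd⟩ : ∃ d : G, ∀ x ∈ A ∩ B, ∀ i, x ∈ U i → s i x = t i x + d := by
    rcases (A ∩ B).eq_empty_or_nonempty with h | ⟨x₀, hx₀⟩
    · exact ⟨0, fun x hx => by simp [h] at hx⟩
    · refine ⟨s (idx x₀) x₀ - t (idx x₀) x₀, fun x hx i hi => ?_⟩
      have h1 := hconn.eq_of_eventually_eq (f := fun y => s (idx y) y - t (idx y) y) hloc hx hx₀
      rw [← h1, hdiff (idx x) i x hx (hidx x) hi]; abel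
  refine ⟨fun i x => if x ∈ A then s i x else t i x + d, fun i x hx => ?_, fun i j x hi hj => ?_⟩
  · by_cases hxA : x ∈ A
    · filter_upwards [hs i x hx hxA, hA.mem_nhds hxA] with y h1 h2
      simp [h1, h2, hxA]
    · have hxB := (hAB x).resolve_left hxA
      filter_upwards [ht i x hx hxB, hB.mem_nhds hxB, (hU i).mem_nhds hx] with y h1 h2 h3
      by_cases hyA : y ∈ A
      · simp [hyA, hxA, hd y ⟨hyA, h2⟩ i h3, h1]
      · simp [hyA, hxA, h1]
  · by_cases hxA : x ∈ A
    · simp [hxA, hs' i j x hxA hi hj]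
    · simp only [hxA, if_false, ht' i j x ((hAB x).resolve_left hxA) hi hj]; abel

-- The sphere is covered by two punctured spheres. Each is a plane by stereographic projection, and
-- their intersection is a punctured plane, which is connected.
open Metric in
theorem cechTrivial_sphere (G : Type*) [AddCommGroup G] :
    CechTrivial.{u} (sphere (0 : EuclideanSpace ℝ (Fin 3)) 1) G := by
  let e : EuclideanSpace ℝ (Fin 3) := EuclideanSpace.single 0 1
  have he : ‖e‖ = 1 := by simp [e]
  let N : sphere (0 : EuclideanSpace ℝ (Fin 3)) 1 := ⟨e, by simp [he]⟩
  have hpt : ∀ v : sphere (0 : EuclideanSpace ℝ (Fin 3)) 1,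
      CechTrivial.{u} ({v}ᶜ : Set (sphere (0 : EuclideanSpace ℝ (Fin 3)) 1)) G := by
    intro v
    have hv : ‖(v : EuclideanSpace ℝ (Fin 3))‖ = 1 := norm_eq_of_mem_sphere v
    have h1 := (cechTrivial_of_simplyConnected.{u} (ℝ ∙ (v : EuclideanSpace ℝ (Fin 3)))ᗮ G).homeomorph
      (isOpenEmbedding_stereographic_symm hv).isEmbedding.toHomeomorph
    exact h1.homeomorph (Homeomorph.setCongr (range_stereographic_symm hv))
  refine CechTrivial.union (A := {N}ᶜ) (B := {-N}ᶜ) isOpen_compl_singleton isOpen_compl_singleton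
    (fun x => ?_) ?_ (hpt N) (hpt (-N))
  · by_contra h
    simp only [Set.mem_compl_iff, Set.mem_singleton_iff, not_or, not_not] at h
    have : N = -N := h.1.symm.trans h.2
    exact ne_neg_of_mem_unit_sphere ℝ N this
  · have hrank : 1 < Module.rank ℝ (ℝ ∙ e)ᗮ := by
      have : Module.finrank ℝ (ℝ ∙ e)ᗮ = 2 := by
        have : Fact (Module.finrank ℝ (EuclideanSpace ℝ (Fin 3)) = 2 + 1) := ⟨by simp⟩
        exact Submodule.finrank_orthogonal_span_singleton (by rintro h; simp [h] at he)
      rw [← Module.finrank_eq_rank, this]; norm_num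
    have hc := (isConnected_compl_singleton_of_one_lt_rank hrank (0 : (ℝ ∙ e)ᗮ)).isPreconnected
    have h2 := hc.image (stereographic he).symm (isOpenEmbedding_stereographic_symm he).continuous.continuousOn
    convert h2 using 1
    ext x
    simp only [Set.mem_inter_iff, Set.mem_compl_iff, Set.mem_singleton_iff, Set.mem_image]
    have h0 : stereographic he (-N) = 0 := stereographic_apply_neg N
    constructor
    · rintro ⟨hx, hx'⟩
      have hxs : x ∈ (stereographic he).source := by rw [stereographic_source]; exact hx
      refine ⟨stereographic he x, fun h => hx' ?_, (stereographic he).left_inv hxs⟩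
      refine (stereographic he).injOn hxs ?_ (h.trans h0.symm)
      rw [stereographic_source]
      exact fun h => ne_neg_of_mem_unit_sphere ℝ N h.symm
    · rintro ⟨y, hy, rfl⟩
      have hyt : y ∈ (stereographic he).target := by simp
      refine ⟨fun h => ?_, fun h => hy ?_⟩
      · have := (stereographic he).map_target hyt
        rw [h, stereographic_source] at this
        exact this rfl
      · rw [← (stereographic he).right_inv hyt, h, h0]

/-! ### From the topology of a realization to cocycles on the order relation. -/

theorem isPathConnected_of_lineMap_mem {α : Type*} {X : Set (α → ℝ)} {v : X} {A : Set X} (hv : v ∈ A)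
    (h : ∀ w ∈ A, ∀ t ∈ Set.Icc (0 : ℝ) 1,
      ∃ hX : AffineMap.lineMap (v : α → ℝ) (w : α → ℝ) t ∈ X, (⟨_, hX⟩ : X) ∈ A) :
    IsPathConnected A := by
  refine ⟨v, hv, fun {w} hw => ?_⟩
  refine ⟨⟨⟨fun t => ⟨AffineMap.lineMap (v : α → ℝ) (w : α → ℝ) (t : ℝ), (h w hw t t.2).1⟩, ?_⟩, ?_, ?_⟩,
    fun t => (h w hw t t.2).2⟩
  · refine Continuous.subtype_mk ?_ _
    exact AffineMap.lineMap_continuous.comp continuous_subtype_val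
  · ext a; simp
  · ext a; simp

section Realization

variable {α : Type u} [PartialOrder α]

/-- Every `G`-valued cocycle on the order relation of `S` is a coboundary. -/
def OrderAcyclic (S : Set α) (G : Type*) [AddCommGroup G] : Prop :=
  ∀ h : α → α → G, (∀ x ∈ S, ∀ y ∈ S, ∀ z ∈ S, x ≤ y → y ≤ z → h x z = h x y + h y z) →
    ∃ g : α → G, ∀ x ∈ S, ∀ y ∈ S, x ≤ y → h x y = g y - g x

theorem lineMap_mem_realization [Finite α] {S : Set α} {v w : α → ℝ} (hv : v ∈ realization S)
    (hw : w ∈ realization S) (hsupp : Function.support v ⊆ Function.support w) {t : ℝ} (ht : t ∈ Set.Icc (0 : ℝ) 1) :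
    AffineMap.lineMap v w t ∈ realization S := by
  have := Fintype.ofFinite α
  have hle : Function.support (AffineMap.lineMap v w t : α → ℝ) ⊆ Function.support w := by
    intro a ha hwa
    have hva : v a = 0 := by
      by_contra h
      exact hsupp h hwa
    exact ha (by simp [AffineMap.lineMap_apply, hva, show w a = 0 from hwa])
  refine ⟨fun a => ?_, ?_, hle.trans hw.2.2.1, hw.2.2.2.mono hle⟩
  · have h1 := hv.1 a
    have h2 := hw.1 a
    have : (AffineMap.lineMap v w t : α → ℝ) a = (1 - t) * v a + t * w a := by
      simp [AffineMap.lineMap_apply]; ring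
    rw [this]
    have := ht.1
    have := ht.2
    have : 0 ≤ 1 - t := by linarith
    positivity
  · have h1 := hv.2.1
    have h2 := hw.2.1
    rw [finsum_eq_sum_of_fintype] at h1 h2 ⊢
    have : ∀ a, (AffineMap.lineMap v w t : α → ℝ) a = (1 - t) * v a + t * w a := fun a => by
      simp [AffineMap.lineMap_apply]; ring
    simp only [this, Finset.sum_add_distrib, ← Finset.mul_sum, h1, h2]
    ring

/-- Near `v` every point has a support that contains the support of `v`. The segment from `v` to
such a point stays in the realization, so the small balls, cut down to these points, are
star-shaped. -/
theorem locallyPathConnectedSpace_realization [Finite α] (S : Set α) :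
    LocallyPathConnectedSpace (realization S) := by
  have := Fintype.ofFinite α
  have hb : ∀ v : realization S, (𝓝 v).HasBasis (fun ε : ℝ => 0 < ε) fun ε =>
      {w : realization S | dist w v < ε} ∩ {w | Function.support v.1 ⊆ Function.support w.1} := by
    intro v
    have hmem : {w : realization S | Function.support v.1 ⊆ Function.support w.1} ∈ 𝓝 v := by
      have : {w : realization S | Function.support v.1 ⊆ Function.support w.1} =
          ⋂ a ∈ Function.support v.1, {w : realization S | w.1 a ≠ 0} := by
        ext w; simp [Set.subset_def]
      rw [this]
      refine (Filter.biInter_mem (Set.toFinite _)).2 fun a ha => ?_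
      have hc : Continuous fun w : realization S => w.1 a :=
        (continuous_apply a).comp continuous_subtype_val
      exact (isOpen_ne.preimage hc).mem_nhds ha
    constructor
    intro t
    constructor
    · intro ht
      obtain ⟨ε, hε, hs⟩ := Metric.mem_nhds_iff.1 ht
      exact ⟨ε, hε, fun w hw => hs hw.1⟩
    · rintro ⟨ε, hε, hs⟩
      exact Filter.mem_of_superset (Filter.inter_mem (Metric.ball_mem_nhds v hε) hmem) hs
  refine LocallyPathConnectedSpace.of_bases hb fun v ε hε => ?_
  refine isPathConnected_of_lineMap_mem (v := v) ⟨by simpa using hε, Set.Subset.rfl⟩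
    fun w hw t ht => ?_
  refine ⟨lineMap_mem_realization v.2 w.2 hw.2 ht, ?_, ?_⟩
  · have h1 : dist (w : α → ℝ) v < ε := hw.1
    change dist (AffineMap.lineMap (v : α → ℝ) (w : α → ℝ) t) (v : α → ℝ) < ε
    rw [dist_lineMap_left, Real.norm_of_nonneg ht.1, dist_comm]
    exact (mul_le_of_le_one_left dist_nonneg ht.2).trans_lt h1
  · intro a ha
    have hwa : w.1 a ≠ 0 := hw.2 ha
    have h1 : 0 < v.1 a := lt_of_le_of_ne (v.2.1 a) (Ne.symm ha)
    have h2 : 0 < w.1 a := lt_of_le_of_ne (w.2.1 a) (Ne.symm hwa)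
    have h3 : (AffineMap.lineMap (v : α → ℝ) (w : α → ℝ) t : α → ℝ) a = (1 - t) * v.1 a + t * w.1 a := by
      simp [AffineMap.lineMap_apply]; ring
    change (AffineMap.lineMap (v : α → ℝ) (w : α → ℝ) t : α → ℝ) a ≠ 0
    rw [h3]
    have := ht.1
    rcases ht.2.eq_or_lt with rfl | h4
    · simpa using hwa
    · have : 0 < (1 - t) * v.1 a := mul_pos (by linarith) h1
      positivity

theorem single_mem_realization [Finite α] [DecidableEq α] {S : Set α} {x : α} (hx : x ∈ S) :
    Pi.single x (1 : ℝ) ∈ realization S := by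
  have := Fintype.ofFinite α
  have hs : Function.support (Pi.single x (1 : ℝ) : α → ℝ) ⊆ {x} := by
    intro a ha
    by_contra h
    exact ha (by simp [Pi.single_eq_of_ne h])
  refine ⟨fun a => ?_, ?_, hs.trans (by simpa using hx), (Set.subsingleton_singleton.anti hs).isChain⟩
  · by_cases h : a = x
    · subst h; simp
    · simp [Pi.single_eq_of_ne h]
  · rw [finsum_eq_sum_of_fintype]; simp

theorem isPreconnected_star [Finite α] (S : Set α) (x : α) :
    IsPreconnected {w : realization S | 0 < w.1 x} := by
  classical
  have := Fintype.ofFinite α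
  rcases Set.eq_empty_or_nonempty {w : realization S | 0 < w.1 x} with h | ⟨w₀, hw₀⟩
  · rw [h]; exact isPreconnected_empty
  have hx : x ∈ S := w₀.2.2.2.1 (ne_of_gt hw₀)
  refine (isPathConnected_of_lineMap_mem (v := ⟨Pi.single x 1, single_mem_realization hx⟩)
    (by simp) fun w hw t ht => ?_).isConnected.isPreconnected
  refine ⟨lineMap_mem_realization (single_mem_realization hx) w.2 ?_ ht, ?_⟩
  · intro a ha
    by_cases h : a = x
    · subst h; exact ne_of_gt hw
    · exact absurd (by simp [Pi.single_eq_of_ne h]) ha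
  · have h3 : (AffineMap.lineMap (Pi.single x (1 : ℝ) : α → ℝ) (w : α → ℝ) t : α → ℝ) x =
        (1 - t) + t * w.1 x := by
      simp [AffineMap.lineMap_apply]; ring
    change 0 < (AffineMap.lineMap (Pi.single x (1 : ℝ) : α → ℝ) (w : α → ℝ) t : α → ℝ) x
    rw [h3]
    have h2 : 0 < w.1 x := hw
    have h5 := ht.1
    rcases ht.2.eq_or_lt with rfl | h4
    · simpa using h2
    · have : 0 ≤ t * w.1 x := by positivity
      linarith

/-- The realization is covered by the open stars of its vertices, which meet only for comparable
elements. An order cocycle is therefore a Čech cocycle of this cover; as stars are connected, the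
primitive is constant on each of them and gives a number per element. -/
theorem orderAcyclic_of_cechTrivial [Finite α] {S : Set α} {G : Type*} [AddCommGroup G]
    (hS : CechTrivial.{u} (realization S) G) : OrderAcyclic S G := by
  classical
  have := Fintype.ofFinite α
  intro h hh
  have hself : ∀ x ∈ S, h x x = 0 := fun x hx => by
    have := hh x hx x hx x hx le_rfl le_rfl
    simpa using this
  -- Čech indices are unordered, so the cocycle is extended antisymmetrically to comparable pairs.
  let c : α → α → G := fun x y => if x ≤ y then h x y else - h y x
  have hsym : ∀ x ∈ S, ∀ y ∈ S, x ≤ y ∨ y ≤ x → c y x = - c x y := by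
    intro x hx y hy hxy
    by_cases h1 : x ≤ y <;> by_cases h2 : y ≤ x
    · obtain rfl := le_antisymm h1 h2
      simp [c, hself x hx]
    · simp [c, h1, h2]
    · simp [c, h1, h2]
    · exact absurd hxy (by simp [h1, h2])
  have hle : ∀ x y, x ≤ y → c x y = h x y := fun x y hxy => by simp [c, hxy]
  have hc : ∀ i ∈ S, ∀ j ∈ S, ∀ k ∈ S, (i ≤ j ∨ j ≤ i) → (j ≤ k ∨ k ≤ j) → (i ≤ k ∨ k ≤ i) →
      c i k = c i j + c j k := by
    have base : ∀ i ∈ S, ∀ j ∈ S, ∀ k ∈ S, i ≤ j → j ≤ k → c i k = c i j + c j k := by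
      intro i hi j hj k hk hij hjk
      rw [hle _ _ hij, hle _ _ hjk, hle _ _ (hij.trans hjk), hh i hi j hj k hk hij hjk]
    intro i hi j hj k hk hij hjk hik
    have e1 := hsym i hi j hj hij
    have e2 := hsym j hj k hk hjk
    have e3 := hsym i hi k hk hik
    rcases hij with a | a <;> rcases hjk with b | b <;> rcases hik with d | d
    · exact base i hi j hj k hk a b
    · exact base i hi j hj k hk a b
    · have := base i hi k hk j hj d b
      rw [this, e2]; abel
    · have := base k hk i hi j hj d a
      rw [e2, e3] at this
      have h4 := congrArg (fun x => - x) this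
      simp only [neg_neg, neg_add_rev] at h4
      rw [h4]; abel
    · have := base j hj i hi k hk a d
      rw [this, e1]; abel
    · have := base j hj k hk i hi b d
      rw [e1, e3] at this
      have h4 := congrArg (fun x => - x) this
      simp only [neg_neg, neg_add_rev] at h4
      rw [h4]; abel
    · have := base k hk j hj i hi b a
      rw [e1, e2, e3] at this
      have h4 := congrArg (fun x => - x) this
      simp only [neg_neg, neg_add_rev] at h4
      exact h4
    · have := base k hk j hj i hi b a
      rw [e1, e2, e3] at this
      have h4 := congrArg (fun x => - x) this
      simp only [neg_neg, neg_add_rev] at h4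
      exact h4
  have hcomp : ∀ (w : realization S) i j, 0 < w.1 i → 0 < w.1 j → i ≤ j ∨ j ≤ i := by
    intro w i j hi hj
    by_cases hij : i = j
    · exact Or.inl hij.le
    · exact w.2.2.2.2 (ne_of_gt hi) (ne_of_gt hj) hij
  obtain ⟨s, hs, hs'⟩ := hS α (fun x => {w | 0 < w.1 x}) c
    (fun x => isOpen_lt continuous_const ((continuous_apply x).comp continuous_subtype_val))
    (fun w => by
      by_contra hne
      push Not at hne
      have h0 : ∀ a, w.1 a = 0 := fun a => le_antisymm (by simpa using hne a) (w.2.1 a)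
      have := w.2.2.1
      simp [h0] at this)
    (fun i j k w hi hj hk => hc i (w.2.2.2.1 (ne_of_gt hi)) j (w.2.2.2.1 (ne_of_gt hj)) k
      (w.2.2.2.1 (ne_of_gt hk)) (hcomp w i j hi hj) (hcomp w j k hj hk) (hcomp w i k hi hk))
  let p : ∀ x, x ∈ S → realization S := fun x hx => ⟨Pi.single x 1, single_mem_realization hx⟩
  refine ⟨fun x => if hx : x ∈ S then s x (p x hx) else 0, fun x hx y hy hxy => ?_⟩
  simp only [hx, hy, dif_pos]
  rcases eq_or_ne x y with rfl | hne
  · simp [hself x hx]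
  -- The midpoint of the edge from `x` to `y` lies in both stars and serves to compare the two
  -- constants.
  obtain ⟨m, hmx, hmy⟩ : ∃ m : realization S, 0 < m.1 x ∧ 0 < m.1 y := by
    refine ⟨⟨fun a => if a = x then 1 / 2 else if a = y then 1 / 2 else 0, fun a => ?_, ?_, ?_, ?_⟩,
      ?_, ?_⟩
    · dsimp only; split_ifs <;> norm_num
    · rw [finsum_eq_sum_of_fintype,
        ← Finset.sum_subset (Finset.subset_univ {x, y}) (fun a _ ha => ?_),
        Finset.sum_pair hne]
      · simp [hne.symm]; norm_num
      · simp only [Finset.mem_insert, Finset.mem_singleton, not_or] at ha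
        simp [ha.1, ha.2]
    · intro a ha
      by_contra haS
      refine ha ?_
      simp [show a ≠ x from fun h => haS (h ▸ hx), show a ≠ y from fun h => haS (h ▸ hy)]
    · have hs : ∀ a ∈ Function.support fun a => if a = x then (1 : ℝ) / 2 else if a = y then 1 / 2 else 0,
          a = x ∨ a = y := by
        intro a ha
        by_contra hn
        push Not at hn
        exact ha (by simp [hn.1, hn.2])
      intro a ha b hb hab
      rcases hs a ha with rfl | rfl <;> rcases hs b hb with rfl | rfl
      · exact absurd rfl hab
      · exact Or.inl hxy
      · exact Or.inr hxy
      · exact absurd rfl hab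
    · simp
    · simp [hne.symm]
  have h1 := (isPreconnected_star S x).eq_of_eventually_eq (fun w hw => hs x w hw)
    (show p x hx ∈ _ by simp [p]) hmx
  have h2 := (isPreconnected_star S y).eq_of_eventually_eq (fun w hw => hs y w hw)
    (show p y hy ∈ _ by simp [p]) hmy
  rw [h1, h2, hs' x y m hmx hmy, hle x y hxy]; abel

theorem orderAcyclic_of_simplyConnected [Finite α] {S : Set α} (hS : IsSimplyConnected (realization S))
    (G : Type*) [AddCommGroup G] : OrderAcyclic S G := by
  have := hS.simplyConnectedSpace
  have := locallyPathConnectedSpace_realization S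
  exact orderAcyclic_of_cechTrivial (cechTrivial_of_simplyConnected _ G)

theorem orderAcyclic_of_homeomorph_ball [Finite α] {S : Set α}
    (hS : Nonempty (realization S ≃ₜ Metric.closedBall (0 : EuclideanSpace ℝ (Fin 3)) 1))
    (G : Type*) [AddCommGroup G] : OrderAcyclic S G := by
  obtain ⟨e⟩ := hS
  have : ContractibleSpace (Metric.closedBall (0 : EuclideanSpace ℝ (Fin 3)) 1) :=
    (convex_closedBall _ _).contractibleSpace ⟨0, by simp⟩
  refine orderAcyclic_of_simplyConnected ?_ G
  exact e.toHomotopyEquiv.simplyConnectedSpace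

theorem orderAcyclic_of_homeomorph_sphere [Finite α] {S : Set α}
    (hS : Nonempty (realization S ≃ₜ Metric.sphere (0 : EuclideanSpace ℝ (Fin 3)) 1))
    (G : Type*) [AddCommGroup G] : OrderAcyclic S G := by
  obtain ⟨e⟩ := hS
  exact orderAcyclic_of_cechTrivial ((cechTrivial_sphere G).homeomorph e.symm)

end Realization

end

/-! ### Rows and cycles of the complete graph on the four colours. -/

/-- The functions on the three edges at the vertex `κ` of the complete graph on the four colours
that have an even sum. -/
def IsRow (κ : Fin 4) (a : Fin 4 → ZMod 2) : Prop := a κ = 0 ∧ ∑ l, a l = 0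

/-- The cycle space modulo 2 of the complete graph on the four colours. -/
def cycleSpace : AddSubgroup (Fin 4 → Fin 4 → ZMod 2) where
  carrier := {z | (∀ κ l, z κ l = z l κ) ∧ ∀ κ, IsRow κ (z κ)}
  zero_mem' := by simp [IsRow]
  add_mem' := by
    rintro x y ⟨hx, hx'⟩ ⟨hy, hy'⟩
    refine ⟨fun κ l => by simp [hx κ l, hy κ l], fun κ => ⟨?_, ?_⟩⟩
    · simp [(hx' κ).1, (hy' κ).1]
    · simp [Finset.sum_add_distrib, (hx' κ).2, (hy' κ).2]
  neg_mem' := by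
    rintro x ⟨hx, hx'⟩
    refine ⟨fun κ l => by simp [hx κ l], fun κ => ⟨?_, ?_⟩⟩
    · simp [(hx' κ).1]
    · simp [(hx' κ).2]

theorem IsRow.add {κ : Fin 4} {a b : Fin 4 → ZMod 2} (ha : IsRow κ a) (hb : IsRow κ b) :
    IsRow κ (a + b) :=
  ⟨by simp [ha.1, hb.1], by simp [Finset.sum_add_distrib, ha.2, hb.2]⟩

theorem IsRow.sub {κ : Fin 4} {a b : Fin 4 → ZMod 2} (ha : IsRow κ a) (hb : IsRow κ b) :
    IsRow κ (a - b) :=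
  ⟨by simp [ha.1, hb.1], by simp [ha.2, hb.2]⟩

theorem isRow_of_mem_cycleSpace {z : Fin 4 → Fin 4 → ZMod 2} (hz : z ∈ cycleSpace) (κ : Fin 4) :
    IsRow κ (z κ) := hz.2 κ

theorem ZMod.eq_of_add_eq_zero_two {a b : ZMod 2} (h : a + b = 0) : a = b := by
  revert a b; decide

theorem IsRow.eq_zero {κ l m : Fin 4} (h₁ : κ ≠ l) (h₂ : κ ≠ m) (h₃ : l ≠ m) {a : Fin 4 → ZMod 2}
    (ha : IsRow m a) (hκ : a κ = 0) (hl : a l = 0) : a = 0 := by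
  obtain ⟨h0, hs⟩ := ha
  rw [Fin.sum_univ_four] at hs
  funext i
  fin_cases κ <;> fin_cases l <;> first | exact absurd rfl h₁ | skip
  all_goals (fin_cases m <;> first | exact absurd rfl h₂ | exact absurd rfl h₃ | skip)
  all_goals (simp only [Fin.zero_eta, Fin.mk_one, Fin.reduceFinMk] at *
             fin_cases i <;> simp_all)

/-- Two rows of an element of the cycle space determine any other row. -/
theorem row_eq_of_row_eq {z : Fin 4 → Fin 4 → ZMod 2} (hz : z ∈ cycleSpace) {κ l m : Fin 4}
    (h₁ : κ ≠ l) (h₂ : κ ≠ m) (h₃ : l ≠ m) {a : Fin 4 → ZMod 2} (ha : IsRow m a)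
    (hκ : a κ = z κ m) (hl : a l = z l m) : z m = a := by
  have := (ha.sub (hz.2 m)).eq_zero h₁ h₂ h₃ (by simp [hκ, hz.1 m κ]) (by simp [hl, hz.1 m l])
  exact (sub_eq_zero.1 this).symm

theorem cycleSpace_eq_zero {z : Fin 4 → Fin 4 → ZMod 2} (hz : z ∈ cycleSpace) {κ l : Fin 4}
    (h : κ ≠ l) (hκ : z κ = 0) (hl : z l = 0) : z = 0 := by
  funext m
  by_cases h₂ : κ = m
  · rw [← h₂, hκ]; rfl
  by_cases h₃ : l = m
  · rw [← h₃, hl]; rfl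
  exact row_eq_of_row_eq hz h h₂ h₃ (a := 0) (by simp [IsRow]) (by simp [hκ]) (by simp [hl])

theorem exists_mem_cycleSpace_of_rows {κ l : Fin 4} (h : κ ≠ l) {a b : Fin 4 → ZMod 2}
    (ha : IsRow κ a) (hb : IsRow l b) (hab : a l = b κ) :
    ∃ z ∈ cycleSpace, z κ = a ∧ z l = b := by
  -- For the two remaining colours `i`, `j`, evenness of row `i` forces `a i + b i` on the edge
  -- between them; it equals `a j + b j` because `a l = b κ`.
  refine ⟨fun i j => if i = κ then a j else if i = l then b j else if j = κ then a i else
    if j = l then b i else if i = j then 0 else a i + b i, ⟨?_, ?_⟩, by simp, by simp [h.symm]⟩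
  · obtain ⟨ha0, ha⟩ := ha
    obtain ⟨hb0, hb⟩ := hb
    rw [Fin.sum_univ_four] at ha hb
    fin_cases κ <;> fin_cases l <;> first | exact absurd rfl h | skip
    all_goals
      simp only [Fin.zero_eta, Fin.mk_one, Fin.reduceFinMk] at *
      intro i j
      fin_cases i <;> fin_cases j <;> simp <;> grind
  · obtain ⟨ha0, ha⟩ := ha
    obtain ⟨hb0, hb⟩ := hb
    rw [Fin.sum_univ_four] at ha hb
    fin_cases κ <;> fin_cases l <;> first | exact absurd rfl h | skip
    all_goals
      simp only [Fin.zero_eta, Fin.mk_one, Fin.reduceFinMk] at *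
      intro i
      fin_cases i <;> simp [IsRow, Fin.sum_univ_four] <;> grind

theorem exists_mem_cycleSpace_of_row {κ : Fin 4} {a : Fin 4 → ZMod 2} (ha : IsRow κ a) :
    ∃ z ∈ cycleSpace, z κ = a := by
  obtain ⟨l, hl⟩ : ∃ l : Fin 4, κ ≠ l := ⟨κ + 1, by clear ha; revert κ; decide⟩
  obtain ⟨m, hm⟩ : ∃ m : Fin 4, κ ≠ m ∧ l ≠ m := by clear ha; revert κ l; decide
  obtain ⟨z, hz, h, -⟩ := exists_mem_cycleSpace_of_rows (b := Pi.single κ (a l) + Pi.single m (a l))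
    hl ha (by simp [IsRow, Finset.sum_add_distrib, hl.symm, hm.2]; exact CharTwo.add_self_eq_zero _)
    (by simp [hm.1])
  exact ⟨z, hz, h⟩

/-- The rows are filled in one after the other, starting from a zero row; `t` and evenness leave a
solution at every stage. Evenness of the last row is the hypothesis on the total sum. -/
theorem exists_rows_of_sum_eq_zero {t : Fin 4 → Fin 4 → ZMod 2} (ht : ∀ κ l, t κ l = t l κ)
    (h : t 0 1 + t 0 2 + t 0 3 + t 1 2 + t 1 3 + t 2 3 = 0) :
    ∃ s : Fin 4 → Fin 4 → ZMod 2, (∀ κ, IsRow κ (s κ)) ∧ ∀ κ l, κ ≠ l → s κ l + s l κ = t κ l := by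
  refine ⟨![![0, 0, 0, 0], ![t 0 1, 0, t 0 1, 0], ![t 0 2, t 1 2 + t 0 1, 0, t 0 2 + t 1 2 + t 0 1],
    ![t 0 3, t 1 3, t 2 3 + (t 0 2 + t 1 2 + t 0 1), 0]], fun κ => ?_, fun κ l hκl => ?_⟩
  · fin_cases κ <;> simp [IsRow, Fin.sum_univ_four] <;> grind
  · have h10 := ht 1 0
    have h20 := ht 2 0
    have h30 := ht 3 0
    have h21 := ht 2 1
    have h31 := ht 3 1
    have h32 := ht 3 2
    fin_cases κ <;> fin_cases l <;> first | exact absurd rfl hκl | simp <;> grind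

/-! ### Components of the coloured graph and incidence of elements. -/

namespace ColexGraph

variable {V : Type*} (G : ColexGraph V)

theorem mem_component_self (s : Finset (Fin 4)) (v : V) : v ∈ G.component s v :=
  Relation.ReflTransGen.refl

theorem nbr_mem_component {s : Finset (Fin 4)} {κ : Fin 4} (hκ : κ ∈ s) (v : V) :
    G.nbr κ v ∈ G.component s v := Relation.ReflTransGen.single ⟨κ, hκ, rfl⟩

theorem eq_of_mem_component {X : Type*} {s : Finset (Fin 4)} {F : V → X}
    (hF : ∀ κ ∈ s, ∀ v, F (G.nbr κ v) = F v) {v w : V} (h : w ∈ G.component s v) : F w = F v := by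
  induction h with
  | refl => rfl
  | tail _ h ih =>
    obtain ⟨κ, hκ, rfl⟩ := h
    rw [hF κ hκ, ih]

theorem component_nbr {s : Finset (Fin 4)} {κ : Fin 4} (hκ : κ ∈ s) (v : V) :
    G.component s (G.nbr κ v) = G.component s v := by
  ext w
  refine ⟨fun h => Relation.ReflTransGen.head ⟨κ, hκ, rfl⟩ h, fun h => ?_⟩
  exact Relation.ReflTransGen.head ⟨κ, hκ, G.nbr_nbr κ v⟩ h

theorem component_eq {s : Finset (Fin 4)} {v w : V} (h : w ∈ G.component s v) :
    G.component s w = G.component s v :=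
  G.eq_of_mem_component (F := G.component s) (fun _ hκ v => G.component_nbr hκ v) h

theorem mem_component_comm {s : Finset (Fin 4)} {v w : V} :
    w ∈ G.component s v ↔ v ∈ G.component s w :=
  ⟨fun h => by rw [G.component_eq h]; exact G.mem_component_self s v,
    fun h => by rw [G.component_eq h]; exact G.mem_component_self s w⟩

theorem component_mono {s t : Finset (Fin 4)} (h : s ⊆ t) (v : V) :
    G.component s v ⊆ G.component t v := fun _ hw =>
  Relation.ReflTransGen.mono (fun _ _ ⟨κ, hκ, e⟩ => ⟨κ, h hκ, e⟩) _ _ hw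

theorem component_empty (v : V) : G.component ∅ v = {v} := by
  ext w
  refine ⟨fun h => ?_, fun h => h ▸ G.mem_component_self ∅ v⟩
  exact G.eq_of_mem_component (F := id) (by simp) h

theorem component_singleton (κ : Fin 4) (v : V) : G.component {κ} v = {v, G.nbr κ v} := by
  ext w
  constructor
  · intro h
    induction h with
    | refl => simp
    | tail _ h ih =>
      obtain ⟨l, hl, rfl⟩ := h
      obtain rfl := Finset.mem_singleton.1 hl
      rcases ih with rfl | rfl
      · simp
      · simp [G.nbr_nbr]
  · rintro (rfl | rfl)
    · exact G.mem_component_self _ _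
    · exact G.nbr_mem_component (by simp) _

/-- A function that is constant along the edges with two given colours away from `out` takes the
same value at the two neighbours of `out`. -/
theorem eq_nbr_out [Finite V] {X : Type*} {F : V → X} {a b : Fin 4}
    (ha : ∀ v, v ≠ G.out → G.nbr a v ≠ G.out → F (G.nbr a v) = F v)
    (hb : ∀ v, v ≠ G.out → G.nbr b v ≠ G.out → F (G.nbr b v) = F v) :
    F (G.nbr a G.out) = F (G.nbr b G.out) := by
  classical
  have := Fintype.ofFinite V
  by_contra hne
  have hinv : ∀ (c : Fin 4) (P : Finset V), (∀ v ∈ P, G.nbr c v ∈ P) → (∑ _v ∈ P, (1 : ZMod 2)) = 0 :=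
    fun c P hP => Finset.sum_involution (fun v _ => G.nbr c v) (fun _ _ => by decide)
      (fun v _ _ => G.nbr_ne c v) hP (fun v _ => G.nbr_nbr c v)
  -- If the values differ, `P` is closed under `b`-edges and `P` together with `out` is closed under
  -- `a`-edges. Both sets are perfectly matched, so both have even size, which is absurd.
  let P : Finset V := Finset.univ.filter fun v => v ≠ G.out ∧ F v = F (G.nbr a G.out)
  have hP : ∀ v, v ∈ P ↔ v ≠ G.out ∧ F v = F (G.nbr a G.out) := fun v => by simp [P]
  have h1 := hinv b P fun v hv => by
    rw [hP] at hv ⊢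
    have hvb : G.nbr b v ≠ G.out := fun h => hne <| by
      rw [← h, G.nbr_nbr, h, hv.2]
    exact ⟨hvb, by rw [hb v hv.1 hvb, hv.2]⟩
  have h2 := hinv a (insert G.out P) fun v hv => by
    rw [Finset.mem_insert, hP] at hv ⊢
    by_cases hva : G.nbr a v = G.out
    · exact Or.inl hva
    · refine Or.inr ⟨hva, ?_⟩
      rcases hv with rfl | hv
      · rfl
      · rw [ha v hv.1 hva, hv.2]
  rw [Finset.sum_insert (by simp [P]), h1] at h2
  exact absurd h2 (by decide)

variable {G}

theorem Elem.eq_component (x : G.Elem) {v : V} (hv : v ∈ x.1.2) :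
    x.1.2 = G.component x.1.1 v := by
  obtain ⟨w, hw⟩ := x.2.2.1
  rw [hw] at hv ⊢
  exact (G.component_eq hv).symm

theorem Elem.nonempty (x : G.Elem) : x.1.2.Nonempty := by
  obtain ⟨w, hw⟩ := x.2.2.1
  exact ⟨w, hw ▸ G.mem_component_self _ _⟩

theorem Elem.eq_of_le_of_card {x y : G.Elem} (h : x ≤ y) (hc : y.1.1.card ≤ x.1.1.card) : x = y := by
  have h1 : x.1.1 = y.1.1 := Finset.eq_of_subset_of_card_le h.1 hc
  obtain ⟨v, hv⟩ := x.nonempty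
  refine Subtype.ext (Prod.ext h1 ?_)
  rw [x.eq_component hv, y.eq_component (h.2 hv), h1]

theorem Elem.ext_of_mem {x y : G.Elem} (h : x.1.1 = y.1.1) {v : V} (hx : v ∈ x.1.2) (hy : v ∈ y.1.2) :
    x = y := by
  refine Subtype.ext (Prod.ext h ?_)
  rw [x.eq_component hx, y.eq_component hy, h]

theorem Elem.le_iff_of_mem {x y : G.Elem} {v : V} (hx : v ∈ x.1.2) (hy : v ∈ y.1.2) :
    x ≤ y ↔ x.1.1 ⊆ y.1.1 := by
  refine ⟨fun h => h.1, fun h => ⟨h, ?_⟩⟩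
  rw [x.eq_component hx, y.eq_component hy]
  exact G.component_mono h v

variable (G)

/-- The element with colours `s` that contains `v`. -/
def elem (s : Finset (Fin 4)) (v : V) (hs : s.card ≤ 3) (hv : G.out ∉ G.component s v) : G.Elem :=
  ⟨(s, G.component s v), hs, ⟨v, rfl⟩, hv⟩

open Classical in
/-- The value at the face with colours `s` through `v` of a function on the faces, zero if that
face contains `out`. -/
noncomputable def faceValue (τ : G.Face → ZMod 2) (s : Finset (Fin 4)) (v : V) : ZMod 2 :=
  if h : s.card = 2 ∧ G.out ∉ G.component s v then
    τ ⟨G.elem s v (by omega) h.2, h.1⟩ else 0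

variable {G}

theorem faceValue_of_mem (τ : G.Face → ZMod 2) (f : G.Face) {v : V} (hv : v ∈ G.verts f) :
    G.faceValue τ f.1.1.1 v = τ f := by
  have h1 := f.1.eq_component hv
  have h2 : G.out ∉ G.component f.1.1.1 v := h1 ▸ f.1.2.2.2
  rw [faceValue, dif_pos ⟨f.2, h2⟩]
  congr 1
  exact Subtype.ext (Subtype.ext (Prod.ext rfl h1.symm))

theorem faceValue_congr (τ : G.Face → ZMod 2) {s : Finset (Fin 4)} {v w : V}
    (h : w ∈ G.component s v) : G.faceValue τ s w = G.faceValue τ s v := by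
  have h1 := G.component_eq h
  by_cases h2 : s.card = 2 ∧ G.out ∉ G.component s v
  · rw [faceValue, faceValue, dif_pos h2, dif_pos (h1 ▸ h2)]
    congr 1
    exact Subtype.ext (Subtype.ext (Prod.ext rfl h1))
  · rw [faceValue, faceValue, dif_neg h2, dif_neg (h1 ▸ h2)]

theorem faceValue_eq_zero (τ : G.Face → ZMod 2) {s : Finset (Fin 4)} {v : V}
    (h : G.out ∈ G.component s v) : G.faceValue τ s v = 0 := by
  rw [faceValue, dif_neg fun h2 => h2.2 h]

/-- A family of rows, one for every cell of the closed colex, that vanishes on the cells that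
contain `out`. -/
structure IsPotential (G : ColexGraph V) (α : Fin 4 → V → Fin 4 → ZMod 2) : Prop where
  isRow : ∀ κ v, IsRow κ (α κ v)
  nbr : ∀ κ l v, l ≠ κ → α κ (G.nbr l v) = α κ v
  out : ∀ κ, α κ G.out = 0

end ColexGraph

/-! ### The dual code: functions orthogonal to the syndromes are coboundaries of potentials. -/

namespace ColexGraph

variable {V : Type*} {G : ColexGraph V}

theorem exists_ne_notMem {s : Finset (Fin 4)} (hs : s.card ≤ 2) :
    ∃ κ l : Fin 4, κ ≠ l ∧ κ ∉ s ∧ l ∉ s := by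
  revert s; decide

/-- `z` turns the rows `b` into the rows `a`, for the colours outside `s`. -/
def Transports (s : Finset (Fin 4)) (a b z : Fin 4 → Fin 4 → ZMod 2) : Prop :=
  z ∈ cycleSpace ∧ ∀ κ ∉ s, z κ = a κ - b κ

/-- At least two colours lie outside `s`, and two rows determine a cycle. For a cell only one colour
would be left, which confines the cocycle of transports to the 2-skeleton. -/
theorem Transports.unique {s : Finset (Fin 4)} (hs : s.card ≤ 2) {a b z z' : Fin 4 → Fin 4 → ZMod 2}
    (h : Transports s a b z) (h' : Transports s a b z') : z = z' := by
  obtain ⟨κ, l, hne, hκ, hl⟩ := exists_ne_notMem hs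
  refine sub_eq_zero.1 (cycleSpace_eq_zero (cycleSpace.sub_mem h.1 h'.1) hne ?_ ?_)
  · simp [h.2 κ hκ, h'.2 κ hκ]
  · simp [h.2 l hl, h'.2 l hl]

theorem Transports.mono {s t : Finset (Fin 4)} (hst : s ⊆ t) {a b z : Fin 4 → Fin 4 → ZMod 2}
    (h : Transports s a b z) : Transports t a b z :=
  ⟨h.1, fun κ hκ => h.2 κ fun hs => hκ (hst hs)⟩

theorem Transports.add {s : Finset (Fin 4)} {a b c z z' : Fin 4 → Fin 4 → ZMod 2}
    (h : Transports s a b z) (h' : Transports s b c z') : Transports s a c (z + z') :=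
  ⟨cycleSpace.add_mem h.1 h'.1, fun κ hκ => by simp [h.2 κ hκ, h'.2 κ hκ]⟩

theorem exists_transports {s : Finset (Fin 4)} (hs : s.card ≤ 2) {a b : Fin 4 → Fin 4 → ZMod 2}
    (ha : ∀ κ, IsRow κ (a κ)) (hb : ∀ κ, IsRow κ (b κ))
    (hab : ∀ κ l, κ ∉ s → l ∉ s → κ ≠ l → a κ l + a l κ = b κ l + b l κ) :
    ∃ z, Transports s a b z := by
  obtain ⟨κ, l, hne, hκ, hl⟩ := exists_ne_notMem hs
  have hsym : ∀ i j, i ∉ s → j ∉ s → i ≠ j → a i j - b i j = a j i - b j i := by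
    intro i j hi hj hij
    have := hab i j hi hj hij
    grind
  obtain ⟨z, hz, hzκ, hzl⟩ := exists_mem_cycleSpace_of_rows hne ((ha κ).sub (hb κ))
    ((ha l).sub (hb l)) (hsym κ l hκ hl hne)
  refine ⟨z, hz, fun m hm => ?_⟩
  by_cases h₂ : κ = m
  · rw [← h₂, hzκ]
  by_cases h₃ : l = m
  · rw [← h₃, hzl]
  refine row_eq_of_row_eq hz hne h₂ h₃ ((ha m).sub (hb m)) ?_ ?_
  · rw [hzκ]; exact hsym m κ hm hκ (Ne.symm h₂)
  · rw [hzl]; exact hsym m l hm hl (Ne.symm h₃)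

theorem Elem.card_lt_of_lt {x y : G.Elem} (h : x < y) : x.1.1.card < y.1.1.card := by
  by_contra hc
  exact h.ne (Elem.eq_of_le_of_card h.le (not_lt.1 hc))

/-- Vanishing of the first cohomology of the 2-skeleton. -/
theorem exists_primitive_two_skeleton {A : Type*} [AddCommGroup A]
    (hcell : ∀ c : G.Cell, OrderAcyclic (Set.Iio c.1) A)
    (hall : OrderAcyclic (Set.univ : Set G.Elem) A) (h : G.Elem → G.Elem → A)
    (hh : ∀ x y w : G.Elem, w.1.1.card ≤ 2 → x ≤ y → y ≤ w → h x w = h x y + h y w) :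
    ∃ g : G.Elem → A, ∀ x y : G.Elem, y.1.1.card ≤ 2 → x ≤ y → h x y = g y - g x := by
  classical
  have h1 : ∀ c : G.Cell, ∃ g : G.Elem → A, ∀ x y, x ≤ y → y < c.1 → h x y = g y - g x := by
    intro c
    obtain ⟨g, hg⟩ := hcell c h fun x hx y hy w hw hxy hyw =>
      hh x y w (by have := Elem.card_lt_of_lt (Set.mem_Iio.1 hw); have := c.2; omega) hxy hyw
    exact ⟨g, fun x y hxy hy => hg x (hxy.trans_lt hy) y hy hxy⟩
  choose γ hγ using h1
  -- On the boundary of each cell `h` has a primitive `γ`. Setting the value from `x` to the cell to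
  -- `-γ x` extends the cocycle to the whole colex.
  let k : G.Elem → G.Elem → A := fun x y =>
    if hy : y.1.1.card = 3 then if x.1.1.card ≤ 2 then - γ ⟨y, hy⟩ x else 0 else h x y
  have hle : ∀ x y : G.Elem, x ≤ y → x.1.1.card ≤ y.1.1.card := fun x y hxy =>
    Finset.card_le_card hxy.1
  obtain ⟨g, hg⟩ := hall k fun x _ y _ w _ hxy hyw => by
    have c1 := hle x y hxy
    have c2 := hle y w hyw
    have c3 := w.2.1
    by_cases hw : w.1.1.card = 3
    · by_cases hy : y.1.1.card = 3
      · obtain rfl := Elem.eq_of_le_of_card hyw (by omega)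
        simp [k, hw]
      · have hylt : y < w := lt_of_le_of_ne hyw fun e => hy (e ▸ hw)
        have := hγ ⟨w, hw⟩ x y hxy hylt
        have hx2 : x.1.1.card ≤ 2 := by omega
        have hy2 : y.1.1.card ≤ 2 := by omega
        simp only [k, hw, hy, hx2, hy2, dif_pos, dif_neg, if_true, not_false_eq_true, this]
        abel
    · have hy : y.1.1.card ≠ 3 := by omega
      simp only [k, hw, hy, dif_neg, not_false_eq_true]
      exact hh x y w (by omega) hxy hyw
  refine ⟨g, fun x y hy hxy => ?_⟩
  rw [← hg x trivial y trivial hxy]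
  simp only [k, show y.1.1.card ≠ 3 by omega, dif_neg, not_false_eq_true]

theorem sum_powersetCard_two {A : Type*} [AddCommMonoid A] (F : Finset (Fin 4) → A) :
    ∑ s ∈ Finset.powersetCard 2 Finset.univ, F s =
      F {0, 1}ᶜ + F {0, 2}ᶜ + F {0, 3}ᶜ + F {1, 2}ᶜ + F {1, 3}ᶜ + F {2, 3}ᶜ := by
  have : (Finset.powersetCard 2 (Finset.univ : Finset (Fin 4))) =
      {{0, 1}ᶜ, {0, 2}ᶜ, {0, 3}ᶜ, {1, 2}ᶜ, {1, 3}ᶜ, {2, 3}ᶜ} := by decide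
  rw [this, Finset.sum_insert (by decide), Finset.sum_insert (by decide),
    Finset.sum_insert (by decide), Finset.sum_insert (by decide), Finset.sum_insert (by decide),
    Finset.sum_singleton]
  simp only [add_assoc]

theorem card_compl_pair {κ l : Fin 4} (h : κ ≠ l) : ({κ, l}ᶜ : Finset (Fin 4)).card = 2 := by
  revert κ l; decide

/-- A function on the faces that is orthogonal to the syndromes of the single vertices is the
coboundary of a potential. -/
theorem exists_potential [Finite V]
    (hcell : ∀ c : G.Cell, OrderAcyclic (Set.Iio c.1) cycleSpace)
    (hall : OrderAcyclic (Set.univ : Set G.Elem) cycleSpace) (τ : G.Face → ZMod 2)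
    (hτ : ∀ v, v ≠ G.out → ∑ s ∈ Finset.powersetCard 2 Finset.univ, G.faceValue τ s v = 0) :
    ∃ α, G.IsPotential α ∧
      ∀ κ l, κ ≠ l → ∀ v, G.faceValue τ {κ, l}ᶜ v = α κ v l + α l v κ := by
  classical
  have h1 : ∀ v, ∃ s : Fin 4 → Fin 4 → ZMod 2, v ≠ G.out → (∀ κ, IsRow κ (s κ)) ∧
      ∀ κ l, κ ≠ l → s κ l + s l κ = G.faceValue τ {κ, l}ᶜ v := by
    intro v
    by_cases hv : v = G.out
    · exact ⟨0, fun h => absurd hv h⟩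
    · have h2 := hτ v hv
      rw [sum_powersetCard_two] at h2
      obtain ⟨s, hs⟩ := exists_rows_of_sum_eq_zero (t := fun κ l => G.faceValue τ {κ, l}ᶜ v)
        (fun κ l => by rw [Finset.pair_comm]) h2
      exact ⟨s, fun _ => hs⟩
  choose s hs using h1
  choose r hr using fun x : G.Elem => x.nonempty
  have hout : ∀ (x : G.Elem) v, v ∈ x.1.2 → v ≠ G.out := fun x v hv e => x.2.2.2 (e ▸ hv)
  have htr : ∀ (y : G.Elem) v w, y.1.1.card ≤ 2 → v ∈ y.1.2 → w ∈ y.1.2 →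
      ∃ z, Transports y.1.1 (s v) (s w) z := by
    intro y v w hy hv hw
    have hv' := hs v (hout y v hv)
    have hw' := hs w (hout y w hw)
    refine exists_transports hy hv'.1 hw'.1 fun κ l hκ hl hne => ?_
    rw [hv'.2 κ l hne, hw'.2 κ l hne]
    refine (faceValue_congr τ ?_).symm
    refine G.component_mono (s := y.1.1) (fun i hi => ?_) v (y.eq_component hv ▸ hw)
    simp only [Finset.mem_compl, Finset.mem_insert, Finset.mem_singleton, not_or]
    exact ⟨fun e => hκ (e ▸ hi), fun e => hl (e ▸ hi)⟩
  -- The rows chosen at two vertices of an element differ by a transport; by uniqueness these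
  -- differences form a cocycle on the 2-skeleton.
  let h : G.Elem → G.Elem → cycleSpace := fun x y =>
    if H : ∃ z, Transports y.1.1 (s (r x)) (s (r y)) z then ⟨H.choose, H.choose_spec.1⟩ else 0
  have hspec : ∀ x y : G.Elem, y.1.1.card ≤ 2 → x ≤ y →
      Transports y.1.1 (s (r x)) (s (r y)) (h x y).1 := by
    intro x y hy hxy
    have H := htr y (r x) (r y) hy (hxy.2 (hr x)) (hr y)
    simp only [h, H, dif_pos]
    exact H.choose_spec
  obtain ⟨g, hg⟩ := exists_primitive_two_skeleton hcell hall h fun x y w hw hxy hyw =>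
    Subtype.ext <| (hspec x w hw (hxy.trans hyw)).unique hw <|
      ((hspec x y ((Finset.card_le_card hyw.1).trans hw) hxy).mono hyw.1).add (hspec y w hw hyw)
  have hvert : ∀ v, v ≠ G.out → G.out ∉ G.component ∅ v := fun v hv => by
    rw [component_empty]; exact fun e => hv e.symm
  let vx : ∀ v, v ≠ G.out → G.Elem := fun v hv => G.elem ∅ v (by simp) (hvert v hv)
  have hrvx : ∀ v hv, r (vx v hv) = v := fun v hv => by
    have h2 : r (vx v hv) ∈ G.component ∅ v := hr (vx v hv)
    rwa [component_empty] at h2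
  -- Correcting the local rows by the primitive `g` makes them constant along edges. Their
  -- coboundary stays `τ`, because elements of the cycle space are symmetric.
  let β : Fin 4 → V → Fin 4 → ZMod 2 := fun κ v =>
    if hv : v ≠ G.out then s v κ + (g (vx v hv)).1 κ else 0
  have hβ : ∀ κ v (hv : v ≠ G.out), β κ v = s v κ + (g (vx v hv)).1 κ := fun κ v hv => by
    simp only [β, dif_pos hv]
  have hβrow : ∀ κ v, IsRow κ (β κ v) := fun κ v => by
    by_cases hv : v ≠ G.out
    · rw [hβ κ v hv]
      exact ((hs v hv).1 κ).add (isRow_of_mem_cycleSpace (g (vx v hv)).2 κ)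
    · simp [β, not_not.1 hv, IsRow]
  have hβnbr : ∀ κ l v, l ≠ κ → v ≠ G.out → G.nbr l v ≠ G.out → β κ (G.nbr l v) = β κ v := by
    intro κ l v hl hv hn
    have he : G.out ∉ G.component {l} v := by
      rw [component_singleton]
      rintro (e | e)
      · exact hv e.symm
      · exact hn e.symm
    let e := G.elem {l} v (by simp) he
    have h3 : ∀ w (hw : w ≠ G.out), w ∈ G.component {l} v →
        s w κ - s (r e) κ = (g e).1 κ - (g (vx w hw)).1 κ := by
      intro w hw hwe
      have hle : vx w hw ≤ e :=
        (Elem.le_iff_of_mem (v := w) (G.mem_component_self ∅ w) hwe).2 (by simp [vx, elem])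
      have h4 := (hspec (vx w hw) e (by simp [e, elem]) hle).2 κ (by simpa [e, elem] using hl.symm)
      rw [hg _ _ (by simp [e, elem]) hle, hrvx w hw] at h4
      rw [← h4]; rfl
    have h5 := h3 v hv (G.mem_component_self _ _)
    have h6 := h3 _ hn (G.nbr_mem_component (by simp) v)
    rw [hβ κ v hv, hβ κ _ hn]
    have h7 : s (G.nbr l v) κ - s v κ = (g (vx v hv)).1 κ - (g (vx _ hn)).1 κ := by
      rw [← sub_sub_sub_cancel_right _ _ (s (r e) κ), h5, h6]; abel
    rw [← sub_eq_zero] at h7 ⊢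
    rw [← h7]; abel
  have hβτ : ∀ κ l, κ ≠ l → ∀ v, v ≠ G.out → G.faceValue τ {κ, l}ᶜ v = β κ v l + β l v κ := by
    intro κ l hne v hv
    rw [← (hs v hv).2 κ l hne, hβ κ v hv, hβ l v hv]
    simp only [Pi.add_apply]
    rw [(g (vx v hv)).2.1 l κ]
    grind
  -- The common row around `out` of each removed cell. These four rows form a cycle because
  -- `faceValue` is zero on the removed faces, so they can be subtracted without changing the
  -- coboundary.
  let o : Fin 4 → Fin 4 → ZMod 2 := fun κ => β κ (G.nbr (κ + 1) G.out)
  have hnout : ∀ a, G.nbr a G.out ≠ G.out := fun a => G.nbr_ne a _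
  have hsucc : ∀ κ : Fin 4, κ + 1 ≠ κ := by decide
  have ho : ∀ κ a, a ≠ κ → β κ (G.nbr a G.out) = o κ := fun κ a ha =>
    G.eq_nbr_out (F := β κ) (fun v hv hn => hβnbr κ a v ha hv hn)
      (fun v hv hn => hβnbr κ (κ + 1) v (hsucc κ) hv hn)
  have hoz : o ∈ cycleSpace := by
    refine ⟨fun κ l => ?_, fun κ => hβrow _ _⟩
    rcases eq_or_ne κ l with rfl | hne
    · rfl
    obtain ⟨a, haκ, hal⟩ : ∃ a, a ≠ κ ∧ a ≠ l := by clear hne; revert κ l; decide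
    refine ZMod.eq_of_add_eq_zero_two ?_
    rw [← ho κ a haκ, ← ho l a hal, ← hβτ κ l hne _ (hnout a)]
    refine faceValue_eq_zero τ (G.mem_component_comm.1 (G.nbr_mem_component ?_ _))
    simp [haκ, hal]
  let α : Fin 4 → V → Fin 4 → ZMod 2 := fun κ v => if v = G.out then 0 else β κ v - o κ
  have hα : ∀ κ v, v ≠ G.out → α κ v = β κ v - o κ := fun κ v hv => by simp [α, hv]
  have hαout : ∀ κ, α κ G.out = 0 := fun κ => by simp [α]
  refine ⟨α, ⟨fun κ v => ?_, fun κ l v hl => ?_, hαout⟩, fun κ l hne v => ?_⟩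
  · by_cases hv : v = G.out
    · simp [hv, hαout, IsRow]
    · rw [hα κ v hv]; exact (hβrow κ v).sub (hoz.2 κ)
  · by_cases hv : v = G.out
    · rw [hv, hαout, hα κ _ (hnout l), ho κ l hl, sub_self]
    · by_cases hn : G.nbr l v = G.out
      · have hv' : v = G.nbr l G.out := by rw [← hn, G.nbr_nbr]
        rw [hn, hαout, hα κ v hv, hv', ho κ l hl, sub_self]
      · rw [hα κ v hv, hα κ _ hn, hβnbr κ l v hl hv hn]
  · by_cases hv : v = G.out
    · rw [hv, hαout, hαout, faceValue_eq_zero τ (G.mem_component_self _ _)]; simp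
    · rw [hα κ v hv, hα l v hv, hβτ κ l hne v hv]
      simp only [Pi.sub_apply]
      rw [hoz.1 l κ]
      grind

end ColexGraph

/-! ### Linear duality, and completion to a syndrome. -/

/-- The Fredholm alternative over a field, outside a set `M` of coordinates. -/
theorem exists_eq_sum_mul_of_forall_dual {K I F : Type*} [Field K] [Fintype I] [Fintype F]
    (x : I → F → K) (M : Set F) (y : F → K)
    (H : ∀ τ : F → K, (∀ i, ∑ f, τ f * x i f = 0) → (∀ f ∈ M, τ f = 0) → ∑ f, τ f * y f = 0) :
    ∃ c : I → K, ∀ f ∉ M, y f = ∑ i, c i * x i f := by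
  classical
  let W₁ : Submodule K (F → K) := Submodule.span K (Set.range x)
  let W₂ : Submodule K (F → K) :=
    { carrier := {w | ∀ f ∉ M, w f = 0}
      zero_mem' := fun _ _ => rfl
      add_mem' := fun ha hb f hf => by simp [ha f hf, hb f hf]
      smul_mem' := fun c a ha f hf => by simp [ha f hf] }
  have hy : y ∈ W₁ ⊔ W₂ := by
    by_contra hn
    obtain ⟨ψ, hψ, hle⟩ := Submodule.exists_le_ker_of_notMem hn
    have hψsum : ∀ w : F → K, ψ w = ∑ f, ψ (Pi.single f 1) * w f := by
      intro w
      conv_lhs => rw [pi_eq_sum_univ' w]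
      simp [mul_comm]
    refine hψ ?_
    rw [hψsum]
    refine H _ (fun i => ?_) fun f hf => ?_
    · rw [← hψsum]
      exact hle (Submodule.mem_sup_left (Submodule.subset_span ⟨i, rfl⟩))
    · refine hle (Submodule.mem_sup_right fun g hg => Pi.single_eq_of_ne ?_ _)
      rintro rfl
      exact hg hf
  obtain ⟨a, ha, b, hb, hab⟩ := Submodule.mem_sup.1 hy
  obtain ⟨c, hc⟩ := (Submodule.mem_span_range_iff_exists_fun K).1 ha
  refine ⟨c, fun f hf => ?_⟩
  have h1 := congrFun hab f
  rw [Pi.add_apply, hb f hf, add_zero, ← hc] at h1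
  rw [← h1]; simp

namespace ColexGraph

variable {V : Type*} {G : ColexGraph V}

theorem sum_faceValue [Fintype G.Face] (τ : G.Face → ZMod 2) (v : V) [∀ f : G.Face, Decidable (v ∈ G.verts f)] :
    ∑ s ∈ Finset.powersetCard 2 Finset.univ, G.faceValue τ s v =
      ∑ f, τ f * (if v ∈ G.verts f then 1 else 0) := by
  classical
  simp only [mul_ite, mul_one, mul_zero]
  rw [← Finset.sum_filter, ← Finset.sum_fiberwise_of_maps_to (t := Finset.powersetCard 2 Finset.univ)
    (g := fun f : G.Face => f.1.1.1) (fun f _ => by simp [f.2])]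
  refine Finset.sum_congr rfl fun s hs => ?_
  have hs2 : s.card = 2 := (Finset.mem_powersetCard.1 hs).2
  by_cases h : G.out ∈ G.component s v
  · rw [faceValue_eq_zero τ h, Finset.sum_eq_zero]
    intro f hf
    simp only [Finset.mem_filter, Finset.mem_univ, true_and] at hf
    obtain ⟨hf, rfl⟩ := hf
    have : v ∈ f.1.1.2 := hf
    exact absurd (f.1.eq_component this ▸ h) f.1.2.2.2
  · rw [Finset.sum_eq_single ⟨G.elem s v (by omega) h, hs2⟩, faceValue, dif_pos ⟨hs2, h⟩]
    · intro f hf hne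
      simp only [Finset.mem_filter, Finset.mem_univ, true_and] at hf
      refine absurd (Subtype.ext ?_) hne
      exact Elem.ext_of_mem (v := v) hf.2 hf.1 (G.mem_component_self s v)
    · intro hn
      refine absurd ?_ hn
      simp only [Finset.mem_filter, Finset.mem_univ, true_and]
      exact ⟨G.mem_component_self s v, rfl⟩

/-- `τ` is the coboundary of the potential `α`. -/
structure IsCoboundary (G : ColexGraph V) (α : Fin 4 → V → Fin 4 → ZMod 2) (τ : G.Face → ZMod 2) :
    Prop extends G.IsPotential α where
  faceValue_eq : ∀ κ l, κ ≠ l → ∀ v, G.faceValue τ {κ, l}ᶜ v = α κ v l + α l v κ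

end ColexGraph

namespace TetrahedralColex

variable {V : Type*} (T : TetrahedralColex V)

theorem exists_isCoboundary (τ : T.Face → ZMod 2) (hτ : ∀ v, v ≠ T.out →
    ∑ s ∈ Finset.powersetCard 2 Finset.univ, T.toColexGraph.faceValue τ s v = 0) :
    ∃ α, T.toColexGraph.IsCoboundary α τ := by
  have := T.finite
  obtain ⟨α, hα, h⟩ := ColexGraph.exists_potential
    (fun c => orderAcyclic_of_homeomorph_sphere (T.cell_boundary c) _)
    (orderAcyclic_of_homeomorph_ball T.ball _) τ hτ
  exact ⟨α, hα, h⟩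

/-- A set of faces can be completed to a syndrome inside `M` if it is orthogonal to the
coboundaries that vanish on `M`. -/
theorem exists_symmDiff_mem_syndromes (M : Set T.Face) (φ : Finset T.Face)
    (H : ∀ α τ, T.toColexGraph.IsCoboundary α τ → (∀ f ∈ M, τ f = 0) → ∑ f ∈ φ, τ f = 0) :
    ∃ φ' ⊆ M, (φ : Set T.Face) ∆ φ' ∈ T.syndromes := by
  classical
  have := T.finite
  have := Fintype.ofFinite V
  have := Fintype.ofFinite T.Face
  obtain ⟨c, hc⟩ := exists_eq_sum_mul_of_forall_dual (K := ZMod 2)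
    (fun (v : V) (f : T.Face) => if v ≠ T.out ∧ v ∈ T.verts f then 1 else 0) M
    (fun f => if f ∈ φ then 1 else 0) fun τ h1 h2 => by
      obtain ⟨α, hα⟩ := T.exists_isCoboundary τ fun v hv => by
        rw [ColexGraph.sum_faceValue]
        simpa [hv] using h1 v
      simpa using H α τ hα h2
  let Q : Finset V := Finset.univ.filter fun v => v ≠ T.out ∧ c v ≠ 0
  have hQ : ∀ f : T.Face, ∑ v : V, c v * (if v ≠ T.out ∧ v ∈ T.verts f then 1 else 0) =
      ((T.verts f ∩ Q).ncard : ZMod 2) := by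
    intro f
    have h1 : T.verts f ∩ Q = ((Q.filter fun v => v ∈ T.verts f : Finset V) : Set V) := by
      ext v; simp [and_comm]
    rw [h1, Set.ncard_coe_finset, Finset.card_eq_sum_ones, Nat.cast_sum, Nat.cast_one,
      Finset.filter_filter, Finset.sum_filter]
    refine Finset.sum_congr rfl fun v _ => ?_
    have h01 : c v = 0 ∨ c v = 1 := by generalize c v = a; revert a; decide
    rcases h01 with h | h <;> simp [h]
  -- The completion is the discrepancy between `φ` and the syndrome of `Q`; outside `M` there is
  -- none.
  refine ⟨{f | f ∈ M ∧ ((T.verts f ∩ Q).ncard : ZMod 2) ≠ if f ∈ φ then 1 else 0},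
    fun f hf => hf.1, (Q : Set V), by simp [Q], ?_⟩
  ext f
  have h2 : f ∉ M → (if f ∈ φ then 1 else 0) = ((T.verts f ∩ Q).ncard : ZMod 2) := fun hf => by
    rw [← hQ f]; exact hc f hf
  rw [Set.mem_ofPred_eq, ← ZMod.natCast_eq_one_iff_odd, Set.mem_symmDiff]
  simp only [Set.mem_ofPred_eq, Finset.mem_coe]
  generalize ((T.verts f ∩ Q).ncard : ZMod 2) = a at *
  by_cases hφ : f ∈ φ <;> by_cases hM : f ∈ M <;> simp only [hφ, hM, if_true, if_false] at * <;>
    revert a <;> decide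

end TetrahedralColex

/-! ### Mod 2 duality on the boundary of a cell. -/

namespace ColexGraph

variable {V : Type*} {G : ColexGraph V}

theorem sum_nbr [Fintype V] {A : Type*} [AddCommMonoid A] (κ : Fin 4) (F : V → A) :
    ∑ v, F (G.nbr κ v) = ∑ v, F v :=
  Equiv.sum_comp (Function.Involutive.toPerm (G.nbr κ) (G.nbr_nbr κ)) F

/-- A function on the edges of a face with an even sum is the coboundary of a function on its
vertices. The value at an edge is given as the sum of two contributions, one for each end. -/
theorem exists_primitive_on_face [Fintype V] {s : Finset (Fin 4)} (hs : s.card = 2) (v₀ : V)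
    [DecidablePred (· ∈ G.component s v₀)] (τ : V × Fin 4 → ZMod 2)
    (hτ : ∑ p : V × Fin 4, τ p * (if p.1 ∈ G.component s v₀ ∧ p.2 ∈ s then 1 else 0) = 0) :
    ∃ p : V → ZMod 2, ∀ v ∈ G.component s v₀, ∀ a ∈ s,
      p v + p (G.nbr a v) = τ (v, a) + τ (G.nbr a v, a) := by
  classical
  obtain ⟨c, hc⟩ := exists_eq_sum_mul_of_forall_dual (K := ZMod 2)
    (fun (q : V) (p : V × Fin 4) => (if q = p.1 then 1 else 0) + (if q = G.nbr p.2 p.1 then 1 else 0))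
    {p | ¬ (p.1 ∈ G.component s v₀ ∧ p.2 ∈ s)}
    (fun p => τ p + τ (G.nbr p.2 p.1, p.2)) fun ω h1 h2 => by
      have hmem : ∀ a ∈ s, ∀ v, G.nbr a v ∈ G.component s v₀ ↔ v ∈ G.component s v₀ := by
        intro a ha v
        rw [G.mem_component_comm, G.component_nbr ha, ← G.mem_component_comm]
      -- The weight that `ω` gives to an edge, summed over its two ends. If `ω` kills all vertex
      -- coboundaries, the two edges of the face at each vertex have equal weight, so `W` is
      -- constant around the polygon and pairs to zero with an even function.
      let W : V → Fin 4 → ZMod 2 := fun v a => ω (v, a) + ω (G.nbr a v, a)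
      have hW0 : ∀ v a, ¬ (v ∈ G.component s v₀ ∧ a ∈ s) → W v a = 0 := by
        intro v a hva
        have e1 : ω (v, a) = 0 := h2 _ hva
        have e2 : ω (G.nbr a v, a) = 0 := h2 _ fun h => hva ⟨(hmem a h.2 v).1 h.1, h.2⟩
        simp [W, e1, e2]
      have hWsum : ∀ q, ∑ a, W q a = 0 := by
        intro q
        rw [← h1 q, Fintype.sum_prod_type_right, ← Finset.sum_congr rfl]
        intro a _
        simp only [mul_add, Finset.sum_add_distrib, mul_ite, mul_one, mul_zero, W]
        congr 1
        · simp
        · rw [← sum_nbr (G := G) a]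
          simp [G.nbr_nbr]
      obtain ⟨a, b, hab, rfl⟩ := Finset.card_eq_two.1 hs
      have hWab : ∀ v, W v a = W v b := by
        intro v
        have h3 := hWsum v
        rw [← Finset.sum_subset (Finset.subset_univ {a, b}) (fun c _ hc => hW0 v c fun h => hc h.2),
          Finset.sum_pair hab] at h3
        exact ZMod.eq_of_add_eq_zero_two h3
      have hWn : ∀ v c, W (G.nbr c v) c = W v c := fun v c => by
        simp only [W, G.nbr_nbr]; ring
      have hK : ∀ v ∈ G.component {a, b} v₀, W v a = W v₀ a := fun v hv =>
        G.eq_of_mem_component (F := fun v => W v a) (fun c hc v => by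
          rcases Finset.mem_insert.1 hc with rfl | hc
          · exact hWn v c
          · obtain rfl := Finset.mem_singleton.1 hc
            rw [hWab, hWab v, hWn]) hv
      have h4 : ∀ p : V × Fin 4, W p.1 p.2 * τ p =
          W v₀ a * (τ p * (if p.1 ∈ G.component {a, b} v₀ ∧ p.2 ∈ ({a, b} : Finset (Fin 4)) then 1 else 0)) := by
        rintro ⟨v, c⟩
        by_cases h : v ∈ G.component {a, b} v₀ ∧ c ∈ ({a, b} : Finset (Fin 4))
        · rw [if_pos h, mul_one]
          congr 1
          rcases Finset.mem_insert.1 h.2 with h5 | h5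
          · change W v c = _
            rw [h5, hK v h.1]
          · change W v c = _
            rw [Finset.mem_singleton.1 h5, ← hWab, hK v h.1]
        · rw [if_neg h, hW0 v c h]; simp
      have h5 : ∑ p : V × Fin 4, ω p * τ (G.nbr p.2 p.1, p.2) =
          ∑ p : V × Fin 4, ω (G.nbr p.2 p.1, p.2) * τ p := by
        rw [Fintype.sum_prod_type_right, Fintype.sum_prod_type_right]
        refine Finset.sum_congr rfl fun c _ => ?_
        rw [← sum_nbr (G := G) c]
        simp [G.nbr_nbr]
      simp only [mul_add, Finset.sum_add_distrib]
      rw [h5, ← Finset.sum_add_distrib, ← mul_zero (W v₀ a), ← hτ, Finset.mul_sum]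
      refine Finset.sum_congr rfl fun p _ => ?_
      rw [← h4]
      simp only [W]
      ring
  refine ⟨c, fun v hv a ha => ?_⟩
  have h3 := hc (v, a) (by simp [hv, ha])
  rw [h3]
  simp [mul_add, Finset.sum_add_distrib]

theorem Elem.eq_of_mem_of_nbr {X : Type*} (x : G.Elem) {F : V → X}
    (hF : ∀ v ∈ x.1.2, ∀ a ∈ x.1.1, F (G.nbr a v) = F v) {v w : V} (hv : v ∈ x.1.2)
    (hw : w ∈ x.1.2) : F w = F v := by
  rw [x.eq_component hv] at hw
  have : w ∈ x.1.2 ∧ F w = F v := by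
    induction hw with
    | refl => exact ⟨hv, rfl⟩
    | tail _ h ih =>
      obtain ⟨κ, hκ, rfl⟩ := h
      refine ⟨?_, by rw [hF _ ih.1 κ hκ, ih.2]⟩
      rw [x.eq_component ih.1]
      exact G.nbr_mem_component hκ _
  exact this.2

theorem Elem.nbr_mem (x : G.Elem) {v : V} (hv : v ∈ x.1.2) {a : Fin 4} (ha : a ∈ x.1.1) :
    G.nbr a v ∈ x.1.2 := by
  rw [x.eq_component hv]; exact G.nbr_mem_component ha v

/-- If the set `S` of elements is acyclic, then a function on its edges with an even sum at every
face is the coboundary of a function on its vertices. -/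
theorem exists_primitive_on_acyclic [Fintype V] {S : Set G.Elem} (hS : OrderAcyclic S (ZMod 2))
    (hcard : ∀ x ∈ S, x.1.1.card ≤ 2) (hlow : ∀ x ∈ S, ∀ y, y ≤ x → y ∈ S)
    [∀ f : G.Face, DecidablePred (· ∈ G.verts f)] (τ : V × Fin 4 → ZMod 2)
    (hτ : ∀ f : G.Face, f.1 ∈ S →
      ∑ p : V × Fin 4, τ p * (if p.1 ∈ G.verts f ∧ p.2 ∈ f.1.1.1 then 1 else 0) = 0) :
    ∃ γ : V → ZMod 2, ∀ e ∈ S, ∀ a, e.1.1 = {a} → ∀ v ∈ e.1.2,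
      γ v + γ (G.nbr a v) = τ (v, a) + τ (G.nbr a v, a) := by
  classical
  choose r hr using fun x : G.Elem => x.nonempty
  have hp : ∀ x : G.Elem, ∃ p : V → ZMod 2, x ∈ S → ∀ v ∈ x.1.2, ∀ a ∈ x.1.1,
      p v + p (G.nbr a v) = τ (v, a) + τ (G.nbr a v, a) := by
    intro x
    by_cases hx : x ∈ S
    · have h2 := hcard x hx
      rcases (by omega : x.1.1.card = 0 ∨ x.1.1.card = 1 ∨ x.1.1.card = 2) with h | h | h
      · refine ⟨0, fun _ v _ a ha => ?_⟩
        rw [Finset.card_eq_zero.1 h] at ha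
        simp at ha
      · obtain ⟨b, hb⟩ := Finset.card_eq_one.1 h
        refine ⟨fun v => τ (v, b), fun _ v _ a ha => ?_⟩
        rw [hb, Finset.mem_singleton] at ha
        rw [ha]
      · have h3 := x.eq_component (hr x)
        have h4 := hτ ⟨x, h⟩ hx
        obtain ⟨p, hp⟩ := exists_primitive_on_face (G := G) h (r x) τ
          ((Finset.sum_congr rfl fun p _ => by simp only [verts, h3]).trans h4)
        exact ⟨p, fun _ v hv a ha => hp v (h3 ▸ hv) a ha⟩
    · exact ⟨0, fun h => absurd h hx⟩
  choose p hp using hp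
  have hconst : ∀ x ∈ S, ∀ y ∈ S, x ≤ y → ∀ v ∈ x.1.2, ∀ w ∈ x.1.2,
      p x v + p y v = p x w + p y w := by
    intro x hx y hy hxy v hv w hw
    refine x.eq_of_mem_of_nbr (F := fun v => p x v + p y v) (fun u hu a ha => ?_) hw hv
    have h1 := hp x hx u hu a ha
    have h2 := hp y hy u (hxy.2 hu) a (hxy.1 ha)
    grind
  -- On incident elements the local primitives differ by a constant. These constants form an order
  -- cocycle, and its primitive `g` adjusts the local primitives to a single one.
  obtain ⟨g, hg⟩ := hS (fun x y => p x (r x) + p y (r x)) fun x hx y hy w hw hxy hyw => by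
    have := hconst y hy w hw hyw (r x) (hxy.2 (hr x)) (r y) (hr y)
    grind
  -- For `v = out` there is no such element and an arbitrary one is used; no edge of `S` contains
  -- `out`.
  let vx : V → G.Elem := fun v => if hv : G.out ∉ G.component ∅ v then G.elem ∅ v (by simp) hv else
    ⟨(∅, G.component ∅ (G.nbr 0 G.out)), by simp, ⟨_, rfl⟩, by
      rw [component_empty]; exact fun h => G.nbr_ne 0 _ h.symm⟩
  refine ⟨fun v => g (vx v) + p (vx v) v, fun e he a hea v hv => ?_⟩
  have key : ∀ w ∈ e.1.2, p e w = g e + (g (vx w) + p (vx w) w) := by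
    intro w hw
    have hwo : G.out ∉ G.component ∅ w := by
      rw [component_empty]; rintro rfl; exact e.2.2.2 hw
    have hvx : vx w = G.elem ∅ w (by simp) hwo := by simp only [vx, dif_pos hwo]
    have hwv : w ∈ (vx w).1.2 := by rw [hvx]; exact G.mem_component_self ∅ w
    have hle : vx w ≤ e := (Elem.le_iff_of_mem hwv hw).2 (by rw [hvx]; simp [elem])
    have hS' := hlow e he _ hle
    have h1 := hg _ hS' e he hle
    have h2 := hconst _ hS' e he hle w hwv _ (hr _)
    grind
  have h1 := hp e he v hv a (by simp [hea])
  rw [key v hv, key _ (e.nbr_mem hv (by simp [hea]))] at h1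
  rw [← h1]
  grind

end ColexGraph

namespace ColexGraph

variable {V : Type*} {G : ColexGraph V}

theorem exists_face_of_mem_cell (c : G.Cell) {v : V} (hv : v ∈ c.1.1.2) {s : Finset (Fin 4)}
    (hs : s.card = 2) (hsc : s ⊆ c.1.1.1) :
    ∃ f : G.Face, f.1.1.1 = s ∧ v ∈ G.verts f ∧ G.IsFaceOf f c := by
  have h1 : G.component s v ⊆ c.1.1.2 := by
    rw [c.1.eq_component hv]; exact G.component_mono hsc v
  exact ⟨⟨G.elem s v (by omega) fun h => c.1.2.2.2 (h1 h), hs⟩, rfl, G.mem_component_self s v,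
    hsc, h1⟩

theorem exists_eq_triple {s : Finset (Fin 4)} (hs : s.card = 3) {a : Fin 4} (ha : a ∈ s) :
    ∃ b b', a ≠ b ∧ a ≠ b' ∧ b ≠ b' ∧ b ∈ s ∧ b' ∈ s ∧
      ∀ t ⊆ s, t.card = 2 → a ∈ t → t = {a, b} ∨ t = {a, b'} := by
  revert s a; decide

theorem inter_nonempty_of_card {s t c : Finset (Fin 4)} (hs : s.card = 2) (ht : t.card = 2)
    (hc : c.card = 3) (hsc : s ⊆ c) (htc : t ⊆ c) : ∃ a, a ∈ s ∧ a ∈ t := by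
  by_contra h
  push Not at h
  have h1 := Finset.card_union_of_disjoint (Finset.disjoint_left.2 h)
  have h2 := Finset.card_le_card (Finset.union_subset hsc htc)
  omega

/-- The two faces of a cell on the sides of an edge. -/
theorem exists_two_faces (c : G.Cell) {v : V} (hv : v ∈ c.1.1.2) {a : Fin 4} (ha : a ∈ c.1.1.1) :
    ∃ f f' : G.Face, f ≠ f' ∧ (G.IsFaceOf f c ∧ v ∈ G.verts f ∧ a ∈ f.1.1.1) ∧
      (G.IsFaceOf f' c ∧ v ∈ G.verts f' ∧ a ∈ f'.1.1.1) ∧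
      ∀ g, G.IsFaceOf g c → v ∈ G.verts g → a ∈ g.1.1.1 → g = f ∨ g = f' := by
  obtain ⟨b, b', h1, h2, h3, hb, hb', h4⟩ := exists_eq_triple c.2 ha
  obtain ⟨f, hf, hvf, hfc⟩ := exists_face_of_mem_cell c hv (Finset.card_pair h1)
    (Finset.insert_subset ha (Finset.singleton_subset_iff.2 hb))
  obtain ⟨f', hf', hvf', hfc'⟩ := exists_face_of_mem_cell c hv (Finset.card_pair h2)
    (Finset.insert_subset ha (Finset.singleton_subset_iff.2 hb'))
  refine ⟨f, f', ?_, ⟨hfc, hvf, by simp [hf]⟩, ⟨hfc', hvf', by simp [hf']⟩, fun g hg hvg hag => ?_⟩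
  · rintro rfl
    have : b ∈ ({a, b'} : Finset (Fin 4)) := by rw [← hf', hf]; simp
    simp only [Finset.mem_insert, Finset.mem_singleton] at this
    exact this.elim (fun e => h1 e.symm) h3
  · rcases h4 _ hg.1 g.2 hag with h | h
    · exact Or.inl (Subtype.ext (Elem.ext_of_mem (h.trans hf.symm) hvg hvf))
    · exact Or.inr (Subtype.ext (Elem.ext_of_mem (h.trans hf'.symm) hvg hvf'))

/-- If the part `S` of the boundary of a cell is acyclic, then the faces of the cell that are not
in `S` are connected through shared vertices. -/
theorem eq_empty_or_forall_mem_of_acyclic [Finite V] (c : G.Cell) {S : Set G.Elem}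
    (hS : OrderAcyclic S (ZMod 2)) (hSc : ∀ x ∈ S, x < c.1) (hlow : ∀ x ∈ S, ∀ y, y ≤ x → y ∈ S)
    {U : Set G.Face} (hU : ∀ f ∈ U, G.IsFaceOf f c ∧ f.1 ∉ S)
    (hcl : ∀ f ∈ U, ∀ f', G.IsFaceOf f' c → f'.1 ∉ S → (G.verts f ∩ G.verts f').Nonempty → f' ∈ U) :
    U = ∅ ∨ ∀ f, G.IsFaceOf f c → f.1 ∉ S → f ∈ U := by
  classical
  have := Fintype.ofFinite V
  have := Fintype.ofFinite G.Face
  have hcard : ∀ x ∈ S, x.1.1.card ≤ 2 := fun x hx => by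
    have := Elem.card_lt_of_lt (hSc x hx)
    have := c.2
    omega
  let u : G.Face → ZMod 2 := fun f => if f ∈ U then 1 else 0
  let onS : V → Fin 4 → Prop := fun v a => ∃ e ∈ S, e.1.1 = {a} ∧ v ∈ e.1.2
  have honS : ∀ v a, onS v a → onS (G.nbr a v) a := fun v a ⟨e, he, hea, hv⟩ =>
    ⟨e, he, hea, e.nbr_mem hv (by simp [hea])⟩
  have hedge : ∀ (g : G.Face) v a, g.1 ∈ S → v ∈ G.verts g → a ∈ g.1.1.1 → onS v a := by
    intro g v a hg hv ha
    have h1 : G.component {a} v ⊆ g.1.1.2 := by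
      rw [g.1.eq_component hv]; exact G.component_mono (by simpa using ha) v
    exact ⟨G.elem {a} v (by simp) fun h => g.1.2.2.2 (h1 h), hlow g.1 hg _ ⟨by simpa [elem] using ha, h1⟩,
      rfl, G.mem_component_self _ v⟩
  have hu0 : ∀ f, ¬ G.IsFaceOf f c → u f = 0 := fun f hf => if_neg fun h => hf (hU f h).1
  have huedge : ∀ f f' v a, ¬ onS v a → G.IsFaceOf f c → G.IsFaceOf f' c → v ∈ G.verts f →
      v ∈ G.verts f' → a ∈ f.1.1.1 → a ∈ f'.1.1.1 → u f = u f' := by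
    intro f f' v a hon hf hf' hv hv' ha ha'
    have h1 : f ∈ U ↔ f' ∈ U :=
      ⟨fun h => hcl f h f' hf' (fun h => hon (hedge f' v a h hv' ha')) ⟨v, hv, hv'⟩,
        fun h => hcl f' h f hf (fun h => hon (hedge f v a h hv ha)) ⟨v, hv', hv⟩⟩
    simp only [u, h1]
  have hsum2 : ∀ q : G.Face → ZMod 2, (∀ f, ¬ G.IsFaceOf f c → q f = 0) → ∀ v a (g g' : G.Face),
      g ≠ g' → (G.IsFaceOf g c ∧ v ∈ G.verts g ∧ a ∈ g.1.1.1) →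
      (G.IsFaceOf g' c ∧ v ∈ G.verts g' ∧ a ∈ g'.1.1.1) →
      (∀ f, G.IsFaceOf f c → v ∈ G.verts f → a ∈ f.1.1.1 → f = g ∨ f = g') →
      ∑ f, q f * (if v ∈ G.verts f ∧ a ∈ f.1.1.1 then 1 else 0) = q g + q g' := by
    intro q hq v a g g' hne hg hg' hall
    rw [← Finset.sum_subset (Finset.subset_univ {g, g'}) fun f _ hf => ?_, Finset.sum_pair hne,
      if_pos hg.2, if_pos hg'.2, mul_one, mul_one]
    by_cases h : G.IsFaceOf f c ∧ v ∈ G.verts f ∧ a ∈ f.1.1.1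
    · exact absurd (by simpa using hall f h.1 h.2.1 h.2.2) hf
    · by_cases h1 : G.IsFaceOf f c
      · rw [if_neg fun h2 => h ⟨h1, h2⟩, mul_zero]
      · rw [hq f h1, zero_mul]
  -- The boundary of the 2-chain `U`. It is a 1-cycle and is supported on edges of `S`, since at any
  -- other edge of the cell the two faces lie both in `U` or both outside it.
  let y : V × Fin 4 → ZMod 2 := fun p => ∑ f, u f * (if p.1 ∈ G.verts f ∧ p.2 ∈ f.1.1.1 then 1 else 0)
  have hynbr : ∀ v a, y (G.nbr a v, a) = y (v, a) := by
    intro v a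
    refine Finset.sum_congr rfl fun f _ => ?_
    by_cases ha : a ∈ f.1.1.1
    · have : G.nbr a v ∈ G.verts f ↔ v ∈ G.verts f :=
        ⟨fun h => by
          have := f.1.nbr_mem h ha
          rwa [G.nbr_nbr] at this, fun h => f.1.nbr_mem h ha⟩
      simp [this]
    · simp [ha]
  have hysum : ∀ v, ∑ a, y (v, a) = 0 := by
    intro v
    simp only [y]
    rw [Finset.sum_comm]
    refine Finset.sum_eq_zero fun f _ => ?_
    rw [← Finset.mul_sum]
    by_cases hv : v ∈ G.verts f
    · have : ∑ a : Fin 4, (if v ∈ G.verts f ∧ a ∈ f.1.1.1 then (1 : ZMod 2) else 0) = (f.1.1.1.card : ZMod 2) := by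
        simp [hv]
      rw [this, f.2]
      exact mul_zero _
    · simp [hv]
  have hy0 : ∀ v a, ¬ onS v a → y (v, a) = 0 := by
    intro v a hon
    by_cases h : v ∈ c.1.1.2 ∧ a ∈ c.1.1.1
    · obtain ⟨g, g', hgg, hg, hg', hall⟩ := exists_two_faces c h.1 h.2
      refine (hsum2 u hu0 v a g g' hgg hg hg' hall).trans ?_
      rw [huedge g g' v a hon hg.1 hg'.1 hg.2.1 hg'.2.1 hg.2.2 hg'.2.2]
      exact CharTwo.add_self_eq_zero _
    · refine Finset.sum_eq_zero fun f _ => ?_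
      by_cases hf : G.IsFaceOf f c
      · rw [if_neg fun h2 => h ⟨hf.2 h2.1, hf.1 h2.2⟩, mul_zero]
      · rw [hu0 f hf, zero_mul]
  -- Acyclicity of `S`, dualized: the cycle `y` bounds a chain `w` of faces in `S`.
  obtain ⟨w, hw⟩ := exists_eq_sum_mul_of_forall_dual (K := ZMod 2)
    (fun (f : G.Face) (p : V × Fin 4) => if f.1 ∈ S ∧ p.1 ∈ G.verts f ∧ p.2 ∈ f.1.1.1 then 1 else 0)
    {p | ¬ onS p.1 p.2} (fun p => y p) fun τ h1 h2 => by
      obtain ⟨γ, hγ⟩ := exists_primitive_on_acyclic hS hcard hlow τ fun f hf => by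
        simpa [hf] using h1 f
      have h3 : ∀ a, ∑ v, τ (v, a) * y (v, a) = ∑ v, (if onS v a then γ v * y (v, a) else 0) := by
        intro a
        rw [← sub_eq_zero, ← Finset.sum_sub_distrib]
        refine Finset.sum_involution (fun v _ => G.nbr a v) (fun v _ => ?_)
          (fun v _ _ => G.nbr_ne a v) (fun _ _ => Finset.mem_univ _) (fun v _ => G.nbr_nbr a v)
        by_cases hv : onS v a
        · rw [if_pos hv, if_pos (honS v a hv), hynbr]
          obtain ⟨e, he, hea, hve⟩ := hv
          have := hγ e he a hea v hve
          grind
        · have hv' : ¬ onS (G.nbr a v) a := fun h => hv (by simpa [G.nbr_nbr] using honS _ a h)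
          have e1 : τ (v, a) = 0 := h2 _ hv
          have e2 : τ (G.nbr a v, a) = 0 := h2 _ hv'
          simp [hv, hv', e1, e2]
      rw [Fintype.sum_prod_type_right, Finset.sum_congr rfl fun a _ => h3 a, Finset.sum_comm]
      refine Finset.sum_eq_zero fun v _ => ?_
      refine (Finset.sum_congr rfl (g := fun a => γ v * y (v, a)) fun a _ => ?_).trans
        (by rw [← Finset.mul_sum, hysum, mul_zero])
      by_cases h : onS v a
      · rw [if_pos h]
      · rw [if_neg h, hy0 v a h, mul_zero]
  rcases U.eq_empty_or_nonempty with h0 | ⟨f₀, hf₀⟩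
  · exact Or.inl h0
  right
  -- Now `u + w` is a 2-cycle on the boundary of `c`, hence constant on its faces. On the faces
  -- outside `S` it is the indicator function of `U`.
  let m : G.Face → ZMod 2 := fun f => u f + if f.1 ∈ S then w f else 0
  have hm0 : ∀ f, ¬ G.IsFaceOf f c → m f = 0 := fun f hf => by
    simp only [m, hu0 f hf, if_neg fun h => hf (hSc f.1 h).le, add_zero]
  have hmedge : ∀ f f' v a, G.IsFaceOf f c → G.IsFaceOf f' c → v ∈ G.verts f → v ∈ G.verts f' →
      a ∈ f.1.1.1 → a ∈ f'.1.1.1 → m f = m f' := by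
    intro f f' v a hf hf' hv hv' ha ha'
    rcases eq_or_ne f f' with rfl | hne
    · rfl
    by_cases hon : onS v a
    · obtain ⟨g, g', hgg, hg, hg', hall⟩ := exists_two_faces c (hf.2 hv) (hf.1 ha)
      have h1 : ∑ f, m f * (if v ∈ G.verts f ∧ a ∈ f.1.1.1 then 1 else 0) = 0 := by
        have h2 := hw (v, a) (by simpa using hon)
        have h3 : ∀ f : G.Face, m f * (if v ∈ G.verts f ∧ a ∈ f.1.1.1 then 1 else 0) =
            u f * (if v ∈ G.verts f ∧ a ∈ f.1.1.1 then 1 else 0) +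
            w f * (if f.1 ∈ S ∧ v ∈ G.verts f ∧ a ∈ f.1.1.1 then 1 else 0) := by
          intro f
          by_cases h : f.1 ∈ S <;> simp [m, h] <;> split_ifs <;> simp
        rw [Finset.sum_congr rfl fun f _ => h3 f, Finset.sum_add_distrib, ← h2]
        exact CharTwo.add_self_eq_zero _
      rw [hsum2 m hm0 v a g g' hgg hg hg' hall] at h1
      have h4 := ZMod.eq_of_add_eq_zero_two h1
      rcases hall f hf hv ha with rfl | rfl <;> rcases hall f' hf' hv' ha' with rfl | rfl
      · rfl
      · exact h4
      · exact h4.symm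
      · rfl
    · have hS1 : ∀ g : G.Face, v ∈ G.verts g → a ∈ g.1.1.1 → g.1 ∉ S := fun g hvg hag hg =>
        hon (hedge g v a hg hvg hag)
      simp only [m, if_neg (hS1 f hv ha), if_neg (hS1 f' hv' ha'), add_zero]
      exact huedge f f' v a hon hf hf' hv hv' ha ha'
  have hmv : ∀ f f' v, G.IsFaceOf f c → G.IsFaceOf f' c → v ∈ G.verts f → v ∈ G.verts f' →
      m f = m f' := fun f f' v hf hf' hv hv' => by
    obtain ⟨a, ha, ha'⟩ := inter_nonempty_of_card f.2 f'.2 c.2 hf.1 hf'.1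
    exact hmedge f f' v a hf hf' hv hv' ha ha'
  have hconst : ∀ f f', G.IsFaceOf f c → G.IsFaceOf f' c → m f = m f' := by
    intro f f' hf hf'
    have hex : ∀ v, ∃ g : G.Face, v ∈ c.1.1.2 → G.IsFaceOf g c ∧ v ∈ G.verts g := by
      intro v
      by_cases hv : v ∈ c.1.1.2
      · obtain ⟨a, ha⟩ := Finset.card_pos.1 (by rw [c.2]; norm_num)
        obtain ⟨g, -, -, hg, -⟩ := exists_two_faces c hv ha
        exact ⟨g, fun _ => ⟨hg.1, hg.2.1⟩⟩
      · exact ⟨f, fun h => absurd h hv⟩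
    choose g hg using hex
    obtain ⟨v, hv⟩ := f.1.nonempty
    obtain ⟨v', hv'⟩ := f'.1.nonempty
    have h1 := c.1.eq_of_mem_of_nbr (F := fun v => m (g v)) (fun v hv a ha => by
      obtain ⟨f₁, -, -, h₁, -⟩ := exists_two_faces c hv ha
      have h2 := c.1.nbr_mem hv ha
      change m (g (G.nbr a v)) = m (g v)
      rw [hmv (g v) f₁ v (hg v hv).1 h₁.1 (hg v hv).2 h₁.2.1,
        hmv (g _) f₁ _ (hg _ h2).1 h₁.1 (hg _ h2).2 (f₁.1.nbr_mem h₁.2.1 h₁.2.2)])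
      (hf.2 hv) (hf'.2 hv')
    rw [hmv f (g v) v hf (hg v (hf.2 hv)).1 hv (hg v (hf.2 hv)).2,
      hmv f' (g v') v' hf' (hg v' (hf'.2 hv')).1 hv' (hg v' (hf'.2 hv')).2]
    exact h1.symm
  intro f hf hfS
  have h1 := hconst f f₀ hf (hU f₀ hf₀).1
  simp only [m, if_neg hfS, if_neg (hU f₀ hf₀).2, add_zero, u, if_pos hf₀] at h1
  by_contra h
  rw [if_neg h] at h1
  exact zero_ne_one h1

end ColexGraph

/-! ### Propagation of a potential through the open faces of a cell. -/

namespace ColexGraph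

variable {V : Type*} {G : ColexGraph V}

theorem IsPotential.eq_of_mem_component {α : Fin 4 → V → Fin 4 → ZMod 2} (hα : G.IsPotential α)
    {s : Finset (Fin 4)} {κ : Fin 4} (hκ : κ ∉ s) {v w : V} (h : w ∈ G.component s v) :
    α κ w = α κ v :=
  G.eq_of_mem_component (F := α κ) (fun l hl v => hα.nbr κ l v fun e => hκ (e ▸ hl)) h

theorem IsPotential.eq_of_mem {α : Fin 4 → V → Fin 4 → ZMod 2} (hα : G.IsPotential α)
    (x : G.Elem) {κ : Fin 4} (hκ : κ ∉ x.1.1) {v w : V} (hv : v ∈ x.1.2) (hw : w ∈ x.1.2) :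
    α κ w = α κ v :=
  hα.eq_of_mem_component hκ (x.eq_component hv ▸ hw)

/-- On both sides of the face `f` the potential `α` is given by `z`. -/
def AgreesOnFace (G : ColexGraph V) (α : Fin 4 → V → Fin 4 → ZMod 2) (z : Fin 4 → Fin 4 → ZMod 2)
    (f : G.Face) : Prop :=
  ∀ v ∈ G.verts f, ∀ κ ∉ f.1.1.1, α κ v = z κ

/-- In the cell `c` the potential `α` is given by `z`. -/
def AgreesOnCell (G : ColexGraph V) (α : Fin 4 → V → Fin 4 → ZMod 2) (z : Fin 4 → Fin 4 → ZMod 2)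
    (c : G.Cell) : Prop :=
  ∀ v ∈ c.1.1.2, ∀ κ ∉ c.1.1.1, α κ v = z κ

theorem AgreesOnFace.agreesOnCell {α : Fin 4 → V → Fin 4 → ZMod 2} (hα : G.IsPotential α)
    {z : Fin 4 → Fin 4 → ZMod 2} {f : G.Face} (h : G.AgreesOnFace α z f) {c : G.Cell}
    (hfc : G.IsFaceOf f c) : G.AgreesOnCell α z c := fun v hv κ hκ => by
  obtain ⟨w, hw⟩ := f.1.nonempty
  rw [← h w hw κ fun hf => hκ (hfc.1 hf)]
  exact hα.eq_of_mem c.1 hκ (hfc.2 hw) hv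

theorem exists_colors {f f' c : Finset (Fin 4)} (hf : f.card = 2) (hf' : f'.card = 2) (hc : c.card = 3)
    (hfc : f ⊆ c) (hfc' : f' ⊆ c) (hne : f ≠ f') :
    ∃ κ l m, κ ≠ l ∧ κ ≠ m ∧ l ≠ m ∧ f = {κ, l}ᶜ ∧ f' = {κ, m}ᶜ ∧ c = {κ}ᶜ := by
  revert f f' c; decide

theorem exists_eq_compl_pair {s : Finset (Fin 4)} (hs : s.card = 2) :
    ∃ κ l, κ ≠ l ∧ s = {κ, l}ᶜ := by
  revert s; decide

theorem exists_eq_compl_singleton {s : Finset (Fin 4)} (hs : s.card = 3) :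
    ∃ κ, s = {κ}ᶜ := by
  revert s; decide

theorem subset_of_compl_pair_subset {κ l m : Fin 4} {c : Finset (Fin 4)} (hc : c.card = 3)
    (h : ({l, m}ᶜ : Finset (Fin 4)) ⊆ c) : ({κ, l}ᶜ : Finset (Fin 4)) ⊆ c ∨ ({κ, m}ᶜ : Finset (Fin 4)) ⊆ c := by
  revert κ l m c; decide

/-- The potential propagates from a face of a cell to an adjacent face. -/
theorem exists_agreesOnFace_of_adjacent {C : Set G.Cell} {c : G.Cell} {f f' : G.Face}
    (hf : G.IsFaceOf f c) (hf' : G.IsFaceOf f' c) (hfC : ∀ c' ∈ C, ¬ G.IsFaceOf f c')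
    (hfC' : ∀ c' ∈ C, ¬ G.IsFaceOf f' c') (hne : f ≠ f') (hv : (G.verts f ∩ G.verts f').Nonempty) :
    ∃ M : Finset G.Face, M.card ≤ 2 ∧ (∀ g ∈ M, ∀ c' ∈ C, ¬ G.IsFaceOf g c') ∧
      ∀ α τ z, G.IsCoboundary α τ → z ∈ cycleSpace → (∀ g ∈ M, τ g = 0) →
        G.AgreesOnFace α z f → G.AgreesOnFace α z f' := by
  classical
  obtain ⟨v, hv, hv'⟩ := hv
  obtain ⟨κ, l, m, h₁, h₂, h₃, hfκ, hfκ', hc⟩ := exists_colors f.2 f'.2 c.2 hf.1 hf'.1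
    fun h => hne (Subtype.ext (Elem.ext_of_mem h hv hv'))
  -- Where `f` and `f'` meet, the rows of colours `κ` and `l` are known. Zeros of `τ` on `f'` and on
  -- the face between colours `l` and `m` fix two entries of the row of colour `m`, and evenness
  -- fixes the third.
  have key : ∀ α τ z, G.IsCoboundary α τ → z ∈ cycleSpace → τ f' = 0 → G.faceValue τ {l, m}ᶜ v = 0 →
      G.AgreesOnFace α z f → G.AgreesOnFace α z f' := by
    intro α τ z hα hz h4 h5 h6
    have e1 : α κ v = z κ := h6 v hv κ (by simp [hfκ])
    have e2 : α l v = z l := h6 v hv l (by simp [hfκ])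
    have e3 : α m v = z m := by
      refine (row_eq_of_row_eq hz h₁ h₂ h₃ (hα.isRow m v) ?_ ?_).symm
      · rw [← faceValue_of_mem τ f' hv', hfκ', hα.faceValue_eq κ m h₂] at h4
        rw [← ZMod.eq_of_add_eq_zero_two h4, e1]
      · rw [hα.faceValue_eq l m h₃] at h5
        rw [← ZMod.eq_of_add_eq_zero_two h5, e2]
    intro w hw i hi
    rw [hα.toIsPotential.eq_of_mem f'.1 hi hv' hw]
    rw [hfκ'] at hi
    simp only [Finset.mem_compl, Finset.mem_insert, Finset.mem_singleton, not_not] at hi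
    rcases hi with rfl | rfl
    · exact e1
    · exact e3
  by_cases hout : G.out ∈ G.component {l, m}ᶜ v
  · refine ⟨{f'}, by simp, by simpa using hfC', fun α τ z hα hz hM h => ?_⟩
    exact key α τ z hα hz (hM f' (by simp)) (faceValue_eq_zero τ hout) h
  · let g : G.Face := ⟨G.elem {l, m}ᶜ v (by rw [card_compl_pair h₃]; norm_num) hout, card_compl_pair h₃⟩
    have hvg : v ∈ G.verts g := G.mem_component_self _ v
    refine ⟨{f', g}, Finset.card_le_two, ?_, fun α τ z hα hz hM h => ?_⟩
    · intro g' hg' c' hc' hgc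
      rcases Finset.mem_insert.1 hg' with rfl | hg'
      · exact hfC' c' hc' hgc
      · rw [Finset.mem_singleton.1 hg'] at hgc
        -- A cell of `C` that contained `g` would also contain `f` or `f'`, so `g` is open as well.
        rcases subset_of_compl_pair_subset (κ := κ) c'.2 hgc.1 with h | h
        · exact hfC c' hc' ((Elem.le_iff_of_mem hv (hgc.2 hvg)).2 (hfκ ▸ h))
        · exact hfC' c' hc' ((Elem.le_iff_of_mem hv' (hgc.2 hvg)).2 (hfκ' ▸ h))
    · exact key α τ z hα hz (hM f' (by simp)) ((faceValue_of_mem τ g hvg).trans (hM g (by simp))) h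

/-- The faces of `c` that belong to no cell of `C`, adjacent when they share a vertex. -/
def openFaceGraph (C : Set G.Cell) (c : G.Cell) : SimpleGraph G.Face where
  Adj f f' := f ≠ f' ∧ (G.IsFaceOf f c ∧ ∀ c' ∈ C, ¬ G.IsFaceOf f c') ∧
    (G.IsFaceOf f' c ∧ ∀ c' ∈ C, ¬ G.IsFaceOf f' c') ∧ (G.verts f ∩ G.verts f').Nonempty
  symm := ⟨fun _ _ h => ⟨h.1.symm, h.2.2.1, h.2.1, by rw [Set.inter_comm]; exact h.2.2.2⟩⟩
  loopless := ⟨fun _ h => h.1 rfl⟩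

theorem exists_agreesOnFace_of_walk {C : Set G.Cell} {c : G.Cell} {f f' : G.Face}
    (p : (openFaceGraph C c).Walk f f') :
    ∃ M : Finset G.Face, M.card ≤ 2 * p.length ∧ (∀ g ∈ M, ∀ c' ∈ C, ¬ G.IsFaceOf g c') ∧
      ∀ α τ z, G.IsCoboundary α τ → z ∈ cycleSpace → (∀ g ∈ M, τ g = 0) →
        G.AgreesOnFace α z f → G.AgreesOnFace α z f' := by
  classical
  induction p with
  | nil => exact ⟨∅, by simp, by simp, fun _ _ _ _ _ _ h => h⟩
  | cons h p ih =>
    obtain ⟨M₁, h1, h2, h3⟩ := ih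
    obtain ⟨M₂, h4, h5, h6⟩ :=
      exists_agreesOnFace_of_adjacent h.2.1.1 h.2.2.1.1 h.2.1.2 h.2.2.1.2 h.1 h.2.2.2
    refine ⟨M₁ ∪ M₂, ?_, fun g hg => ?_, fun α τ z hα hz hM hf => ?_⟩
    · refine (Finset.card_union_le _ _).trans ?_
      rw [SimpleGraph.Walk.length_cons]
      omega
    · rcases Finset.mem_union.1 hg with hg | hg
      · exact h2 g hg
      · exact h5 g hg
    · exact h3 α τ z hα hz (fun g hg => hM g (Finset.mem_union_left _ hg))
        (h6 α τ z hα hz (fun g hg => hM g (Finset.mem_union_right _ hg)) hf)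

theorem isOpen_of_mem_support {C : Set G.Cell} {c : G.Cell} {f f' : G.Face}
    (p : (openFaceGraph C c).Walk f f') (hf : G.IsFaceOf f c) : ∀ g ∈ p.support, G.IsFaceOf g c := by
  induction p with
  | nil => simpa using hf
  | cons h p ih =>
    intro g hg
    rw [SimpleGraph.Walk.support_cons, List.mem_cons] at hg
    rcases hg with rfl | hg
    · exact hf
    · exact ih h.2.2.1.1 g hg

end ColexGraph

namespace TetrahedralColex

variable {V : Type*} (T : TetrahedralColex V)

/-- The support of a point is a chain, so it lies below a single cell of `C` as soon as its largest
element does. -/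
theorem points_inter_eq (C : Set T.Cell) (c : T.Cell) :
    T.points c ∩ (⋃ c' ∈ C, T.points c') =
      realization {e : T.toColexGraph.Elem | e ≤ c.1 ∧ ∃ c' ∈ C, e ≤ c'.1} := by
  have := T.finite
  ext w
  constructor
  · rintro ⟨h1, h2⟩
    obtain ⟨c', hc', h3⟩ := Set.mem_iUnion₂.1 h2
    exact ⟨h1.1, h1.2.1, fun e he => ⟨h1.2.2.1 he, c', hc', h3.2.2.1 he⟩, h1.2.2.2⟩
  · intro h
    refine ⟨⟨h.1, h.2.1, fun e he => (h.2.2.1 he).1, h.2.2.2⟩, ?_⟩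
    have hne : (Function.support w).Nonempty := by
      rw [Set.nonempty_iff_ne_empty]
      intro h0
      rw [Function.support_eq_empty_iff] at h0
      have := h.2.1
      simp [h0] at this
    obtain ⟨m, hm⟩ := (Set.toFinite (Function.support w)).exists_maximal hne
    obtain ⟨c', hc', hmc⟩ := (h.2.2.1 hm.1).2
    refine Set.mem_iUnion₂.2 ⟨c', hc', h.1, h.2.1, fun e he => ?_, h.2.2.2⟩
    rcases h.2.2.2.total he hm.1 with h1 | h1
    · exact h1.trans hmc
    · exact (hm.2 he h1).trans hmc

theorem openFaceGraph_reachable {C : Set T.Cell} {c : T.Cell} (hc : c ∉ C)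
    (hsimple : T.points c ∩ (⋃ c' ∈ C, T.points c') = ∅ ∨
      IsSimplyConnected (T.points c ∩ (⋃ c' ∈ C, T.points c'))) {f f' : T.Face}
    (hf : T.IsFaceOf f c) (hf' : T.IsFaceOf f' c) (hfC : ∀ c' ∈ C, ¬ T.IsFaceOf f c')
    (hfC' : ∀ c' ∈ C, ¬ T.IsFaceOf f' c') :
    (ColexGraph.openFaceGraph C c).Reachable f f' := by
  classical
  have := T.finite
  rw [points_inter_eq] at hsimple
  have hS : OrderAcyclic {e : T.toColexGraph.Elem | e ≤ c.1 ∧ ∃ c' ∈ C, e ≤ c'.1} (ZMod 2) := by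
    rcases hsimple with h | h
    · intro _ _
      refine ⟨0, fun x hx => ?_⟩
      have := single_mem_realization hx
      rw [h] at this
      exact this.elim
    · exact orderAcyclic_of_simplyConnected h _
  have hmem : ∀ g : T.Face, T.IsFaceOf g c →
      (g.1 ∉ {e : T.toColexGraph.Elem | e ≤ c.1 ∧ ∃ c' ∈ C, e ≤ c'.1} ↔ ∀ c' ∈ C, ¬ T.IsFaceOf g c') := by
    intro g hg
    constructor
    · intro h c' hc' hgc
      exact h ⟨hg, c', hc', hgc⟩
    · rintro h ⟨-, c', hc', hgc⟩
      exact h c' hc' hgc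
  have hlt : ∀ x ∈ {e : T.toColexGraph.Elem | e ≤ c.1 ∧ ∃ c' ∈ C, e ≤ c'.1}, x < c.1 := by
    rintro x ⟨hx, c', hc', h⟩
    refine lt_of_le_of_ne hx ?_
    rintro rfl
    have : c = c' := Subtype.ext (ColexGraph.Elem.eq_of_le_of_card h (by rw [c.2, c'.2]))
    exact hc (this ▸ hc')
  have hcl : ∀ g g' : T.Face, T.IsFaceOf g c → (∀ c' ∈ C, ¬ T.IsFaceOf g c') → T.IsFaceOf g' c →
      (∀ c' ∈ C, ¬ T.IsFaceOf g' c') → (T.verts g ∩ T.verts g').Nonempty →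
      (ColexGraph.openFaceGraph C c).Reachable g g' := by
    intro g g' hg hgC hg' hgC' hv
    by_cases hne : g = g'
    · exact hne ▸ SimpleGraph.Reachable.refl g
    · exact SimpleGraph.Adj.reachable ⟨hne, ⟨hg, hgC⟩, ⟨hg', hgC'⟩, hv⟩
  rcases ColexGraph.eq_empty_or_forall_mem_of_acyclic c hS hlt
    (fun x hx y hy => ⟨hy.trans hx.1, hx.2.imp fun c' h => ⟨h.1, hy.trans h.2⟩⟩)
    (U := {g | T.IsFaceOf g c ∧ (∀ c' ∈ C, ¬ T.IsFaceOf g c') ∧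
      (ColexGraph.openFaceGraph C c).Reachable f g})
    (fun g hg => ⟨hg.1, (hmem g hg.1).2 hg.2.1⟩)
    (fun g hg g' hg' hgS hv => ⟨hg', (hmem g' hg').1 hgS,
      hg.2.2.trans (hcl g g' hg.1 hg.2.1 hg' ((hmem g' hg').1 hgS) hv)⟩) with h | h
  · have : f ∈ (∅ : Set T.Face) := h ▸ ⟨hf, hfC, SimpleGraph.Reachable.refl f⟩
    exact this.elim
  · exact (h f' hf' ((hmem f' hf').2 hfC')).2.2

end TetrahedralColex

/-! ### Trees of dual edges outside the layer. -/

namespace TetrahedralColex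

variable {V : Type*} (T : TetrahedralColex V)

/-- For every cell outside `C`, the part of its boundary in `C` is empty or simply connected. -/
def MeetsSimply (C : Set T.Cell) : Prop :=
  ∀ c ∉ C, T.points c ∩ (⋃ c' ∈ C, T.points c') = ∅ ∨
    IsSimplyConnected (T.points c ∩ (⋃ c' ∈ C, T.points c'))

variable {T}

theorem notMem_facesOf {C : Set T.Cell} {f : T.Face} :
    f ∉ T.facesOf C ↔ ∀ c ∈ C, ¬ T.IsFaceOf f c := by
  simp [facesOf]

theorem two_le_of_faces_le {kface : ℕ}
    (hface : ∀ c : T.Cell, {f : T.Face | T.IsFaceOf f c}.ncard ≤ kface) (c : T.Cell) : 2 ≤ kface := by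
  have := T.finite
  obtain ⟨v, hv⟩ := c.1.nonempty
  obtain ⟨a, ha⟩ := Finset.card_pos.1 (by rw [c.2]; norm_num)
  obtain ⟨f, f', hne, hf, hf', -⟩ := ColexGraph.exists_two_faces c hv ha
  refine le_trans ?_ (hface c)
  rw [← Set.ncard_pair hne]
  exact Set.ncard_le_ncard (by rintro g (rfl | rfl); exacts [hf.1, hf'.1]) (Set.toFinite _)

/-- The potential propagates between any two open faces of a cell. -/
theorem exists_agreesOnFace {C : Set T.Cell} {kface : ℕ}
    (hface : ∀ c : T.Cell, {f : T.Face | T.IsFaceOf f c}.ncard ≤ kface) (hsimple : T.MeetsSimply C)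
    {c : T.Cell} {f f' : T.Face} (hf : T.IsFaceOf f c) (hf' : T.IsFaceOf f' c)
    (hfC : f ∉ T.facesOf C) (hfC' : f' ∉ T.facesOf C) :
    ∃ M : Finset T.Face, M.card ≤ 2 * (kface - 1) ∧ (∀ g ∈ M, g ∉ T.facesOf C) ∧
      ∀ α τ z, T.IsCoboundary α τ → z ∈ cycleSpace → (∀ g ∈ M, τ g = 0) →
        T.AgreesOnFace α z f → T.AgreesOnFace α z f' := by
  classical
  have := T.finite
  simp only [notMem_facesOf] at *
  have hc : c ∉ C := fun hc => hfC c hc hf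
  obtain ⟨p⟩ := T.openFaceGraph_reachable hc (hsimple c hc) hf hf' hfC hfC'
  -- A path visits each face of `c` at most once, so it has at most `kface - 1` steps, each costing
  -- two faces.
  obtain ⟨M, h1, h2, h3⟩ := ColexGraph.exists_agreesOnFace_of_walk p.bypass
  refine ⟨M, h1.trans ?_, h2, h3⟩
  have h4 : p.bypass.support.toFinset.card = p.bypass.length + 1 := by
    rw [List.toFinset_card_of_nodup p.bypass_isPath.support_nodup, SimpleGraph.Walk.length_support]
  have h5 : p.bypass.support.toFinset.card ≤ kface := by
    refine le_trans ?_ (hface c)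
    rw [← Set.ncard_coe_finset]
    exact Set.ncard_le_ncard (fun g hg => ColexGraph.isOpen_of_mem_support p.bypass hf g (by simpa using hg))
      (Set.toFinite _)
  omega

/-- `OpenTree C n B F`: the cells `B` are joined through the `n` faces `F`, none of which
belongs to a cell of `C`. -/
inductive OpenTree (C : Set T.Cell) : ℕ → Set T.Cell → Set T.Face → Prop
  | single (c : T.Cell) : OpenTree C 0 {c} ∅
  | step {n : ℕ} {B : Set T.Cell} {F : Set T.Face} {c : T.Cell} {f : T.Face} :
      OpenTree C n B F → c ∈ B → f ∉ T.facesOf C → T.IsFaceOf f c →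
      OpenTree C (n + 1) (B ∪ {c' | T.IsFaceOf f c'}) (insert f F)

namespace OpenTree

variable {C : Set T.Cell} {n : ℕ} {B : Set T.Cell} {F : Set T.Face}

theorem zero_or_forall_exists (h : OpenTree C n B F) :
    (n = 0 ∧ (∃ c, B = {c}) ∧ F = ∅) ∨ (∀ c ∈ B, ∃ f ∈ F, T.IsFaceOf f c) := by
  induction h with
  | single c => exact Or.inl ⟨rfl, ⟨c, rfl⟩, rfl⟩
  | @step n B F c f _ hc hf hfc ih =>
    right
    rintro c' (hc' | hc')
    · rcases ih with ⟨-, ⟨c₀, rfl⟩, -⟩ | ih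
      · obtain rfl : c = c₀ := hc
        obtain rfl : c' = c := hc'
        exact ⟨f, Set.mem_insert _ _, hfc⟩
      · obtain ⟨g, hg, hgc⟩ := ih c' hc'
        exact ⟨g, Set.mem_insert_of_mem _ hg, hgc⟩
    · exact ⟨f, Set.mem_insert _ _, hc'⟩

theorem faces_notMem (h : OpenTree C n B F) : ∀ f ∈ F, f ∉ T.facesOf C := by
  induction h with
  | single c => simp
  | step _ _ hf _ ih =>
    rintro g (rfl | hg)
    exacts [hf, ih g hg]

/-- Coboundaries that vanish on a suitable set of faces near an open tree have potentials
that are constant on the tree. -/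
theorem exists_agrees {kface : ℕ}
    (hface : ∀ c : T.Cell, {f : T.Face | T.IsFaceOf f c}.ncard ≤ kface) (hsimple : T.MeetsSimply C)
    (h : OpenTree C n B F) :
    ∃ M : Finset T.Face, M.card ≤ n * (2 * (kface - 1)) ∧ (∀ g ∈ M, g ∉ T.facesOf C) ∧
      ∀ α τ, T.IsCoboundary α τ → (∀ g ∈ M, τ g = 0) →
        ∃ z ∈ cycleSpace, (∀ c ∈ B, T.AgreesOnCell α z c) ∧ ∀ f ∈ F, T.AgreesOnFace α z f := by
  classical
  induction h with
  | single c =>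
    refine ⟨∅, by simp, by simp, fun α τ hα _ => ?_⟩
    obtain ⟨v, hv⟩ := c.1.nonempty
    obtain ⟨κ, hκ⟩ := ColexGraph.exists_eq_compl_singleton c.2
    obtain ⟨z, hz, hzκ⟩ := exists_mem_cycleSpace_of_row (hα.isRow κ v)
    refine ⟨z, hz, ?_, by simp⟩
    rintro c' rfl w hw l hl
    obtain rfl : l = κ := by simpa [hκ] using hl
    rw [hzκ]
    exact hα.toIsPotential.eq_of_mem c'.1 hl hv hw
  | @step n B F c f htree hc hf hfc ih =>
    obtain ⟨M, hM, hMC, ih⟩ := ih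
    -- A lone cell determines only one row of `z`. The first face is therefore treated apart: its
    -- two rows are completed to a new `z`, at the cost of that face alone.
    rcases htree.zero_or_forall_exists with ⟨rfl, ⟨c₀, rfl⟩, rfl⟩ | hex
    · obtain rfl : c = c₀ := hc
      refine ⟨{f}, ?_, by simpa using hf, fun α τ hα hτ => ?_⟩
      · have := two_le_of_faces_le hface c
        simp only [Finset.card_singleton]
        omega
      · obtain ⟨v, hv⟩ := f.1.nonempty
        obtain ⟨κ, l, hne, hfκ⟩ := ColexGraph.exists_eq_compl_pair f.2
        have h1 : τ f = 0 := hτ f (by simp)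
        rw [← ColexGraph.faceValue_of_mem τ f hv, hfκ, hα.faceValue_eq κ l hne] at h1
        obtain ⟨z, hz, hzκ, hzl⟩ := exists_mem_cycleSpace_of_rows hne (hα.isRow κ v) (hα.isRow l v)
          (ZMod.eq_of_add_eq_zero_two h1)
        have hag : T.AgreesOnFace α z f := by
          intro w hw i hi
          rw [hα.toIsPotential.eq_of_mem f.1 hi hv hw]
          rw [hfκ] at hi
          simp only [Finset.mem_compl, Finset.mem_insert, Finset.mem_singleton, not_not] at hi
          rcases hi with rfl | rfl
          exacts [hzκ.symm, hzl.symm]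
        refine ⟨z, hz, ?_, by simpa using hag⟩
        rintro c' (rfl | hc')
        · exact hag.agreesOnCell hα.toIsPotential hfc
        · exact hag.agreesOnCell hα.toIsPotential hc'
    -- The cell `c` already has a face of the tree, from which `z` is carried to `f` within `c`.
    · obtain ⟨f₀, hf₀, hfc₀⟩ := hex c hc
      obtain ⟨M', hM', hMC', hag⟩ := exists_agreesOnFace hface hsimple hfc₀ hfc
        (htree.faces_notMem f₀ hf₀) hf
      refine ⟨M ∪ M', ?_, ?_, fun α τ hα hτ => ?_⟩
      · refine (Finset.card_union_le _ _).trans ?_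
        rw [add_mul, one_mul]
        exact add_le_add hM hM'
      · intro g hg
        rcases Finset.mem_union.1 hg with hg | hg
        exacts [hMC g hg, hMC' g hg]
      · obtain ⟨z, hz, hB, hF⟩ := ih α τ hα fun g hg => hτ g (Finset.mem_union_left _ hg)
        have h1 := hag α τ z hα hz (fun g hg => hτ g (Finset.mem_union_right _ hg)) (hF f₀ hf₀)
        refine ⟨z, hz, ?_, ?_⟩
        · rintro c' (hc' | hc')
          · exact hB c' hc'
          · exact h1.agreesOnCell hα.toIsPotential hc'
        · rintro g (rfl | hg)
          exacts [h1, hF g hg]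

theorem exists_of_walk (h : OpenTree C n B F) {v v' : T.Cell} (p : (T.dualGraph (T.facesOf C)ᶜ).Walk v v')
    (hv : v ∈ B) : ∃ B' F', OpenTree C (n + p.length) B' F' ∧ B ⊆ B' ∧ F ⊆ F' ∧ v' ∈ B' := by
  induction p generalizing n B F with
  | nil => exact ⟨B, F, h, subset_rfl, subset_rfl, hv⟩
  | cons hadj p ih =>
    obtain ⟨-, f, hf, hf1, hf2⟩ := hadj
    obtain ⟨B', F', h', hB, hF, hv'⟩ := ih (h.step hv hf hf1) (Or.inr hf2)
    refine ⟨B', F', ?_, Set.subset_union_left.trans hB, (Set.subset_insert _ _).trans hF, hv'⟩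
    have : n + (p.length + 1) = n + 1 + p.length := by omega
    exact this ▸ h'

theorem exists_of_dist (h : OpenTree C n B F) {v v' : T.Cell} {d : ℕ}
    (hd : T.dist (T.facesOf C)ᶜ v v' ≤ d) (hv : v ∈ B) :
    ∃ n' ≤ n + d, ∃ B' F', OpenTree C n' B' F' ∧ B ⊆ B' ∧ F ⊆ F' ∧ v' ∈ B' := by
  have hne : SimpleGraph.edist (T.dualGraph (T.facesOf C)ᶜ) v v' ≠ ⊤ :=
    ne_top_of_le_ne_top (ENat.natCast_ne_top d) hd
  obtain ⟨p, hp⟩ := SimpleGraph.exists_walk_of_edist_ne_top hne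
  have hle : p.length ≤ d := by
    have := hp.trans_le hd
    exact_mod_cast this
  exact ⟨n + p.length, by omega, h.exists_of_walk p hv⟩

theorem exists_of_facetDist (h : OpenTree C n B F) {v : T.Cell} {κ : Fin 4} {d : ℕ}
    (hd : T.facetDist (T.facesOf C)ᶜ κ v ≤ d) (hv : v ∈ B) :
    ∃ n' ≤ n + d, ∃ B' F', OpenTree C n' B' F' ∧ B ⊆ B' ∧ F ⊆ F' ∧ ∃ f ∈ F', T.OnFacet κ f := by
  have hlt : T.facetDist (T.facesOf C)ᶜ κ v < (d + 1 : ℕ) :=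
    hd.trans_lt (by exact_mod_cast Nat.lt_succ_self d)
  obtain ⟨u, hu⟩ := iInf_lt_iff.1 hlt
  obtain ⟨⟨f, hf, hfu, hfκ⟩, hu⟩ := iInf_lt_iff.1 hu
  obtain ⟨m, hm⟩ : ∃ m : ℕ, T.dist (T.facesOf C)ᶜ v u = m := by
    refine (ENat.ne_top_iff_exists.1 fun h => ?_).imp fun _ => Eq.symm
    rw [h] at hu
    simp at hu
  rw [hm] at hu
  have hmd : m + 1 < d + 1 := by exact_mod_cast hu
  obtain ⟨n', hn', B', F', h', hB, hF, hu'⟩ := h.exists_of_dist hm.le hv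
  exact ⟨n' + 1, by omega, _, _, h'.step hu' hf hfu, hB.trans Set.subset_union_left,
    hF.trans (Set.subset_insert _ _), f, Set.mem_insert _ _, hfκ⟩

end OpenTree

/-- One side of `f` is the removed `κ`-cell, where the potential vanishes. -/
theorem row_eq_zero_of_onFacet {α : Fin 4 → V → Fin 4 → ZMod 2} (hα : T.IsPotential α)
    {z : Fin 4 → Fin 4 → ZMod 2} {f : T.Face} (h : T.AgreesOnFace α z f) {κ : Fin 4}
    (hf : T.OnFacet κ f) : z κ = 0 := by
  obtain ⟨v, hv⟩ := f.1.nonempty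
  rw [← h v hv κ (fun hκ => by simpa using hf.1 hκ), ← hα.out κ]
  exact hα.eq_of_mem_component (by simp) (hf.2 hv)

end TetrahedralColex

/-! ### Replacing walks inside the layer by trees outside it. -/

namespace TetrahedralColex

variable {V : Type*} {T : TetrahedralColex V}

/-- The cells that have both faces in cells of `C` and other faces. -/
def boundaryCells (T : TetrahedralColex V) (C : Set T.Cell) : Set T.Cell :=
  T.dualVertices (T.facesOf C) ∩ T.dualVertices (T.facesOf C)ᶜ

/-- The comparison of distances inside and outside the layer of `C`. -/
structure DistBound (T : TetrahedralColex V) (C : Set T.Cell) (k : ℝ≥0) : Prop where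
  dist : ∀ v ∈ T.boundaryCells C, ∀ v' ∈ T.boundaryCells C,
    (T.dist (T.facesOf C)ᶜ v v' : ℝ≥0∞) ≤ k * (T.dist (T.facesOf C) v v' : ℝ≥0∞)
  facet : ∀ κ : Fin 4, ∀ v ∈ T.boundaryCells C,
    (min (T.facetDist (T.facesOf C)ᶜ κ v) (T.twoFacetDist (T.facesOf C)ᶜ v) : ℝ≥0∞) ≤
      k * (T.facetDist (T.facesOf C) κ v : ℝ≥0∞)

theorem exists_nat_of_toENNReal_le {x : ℕ∞} {k : ℝ≥0} {r : ℕ} (h : (x : ℝ≥0∞) ≤ k * (r : ℝ≥0∞)) :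
    ∃ d : ℕ, x = d ∧ (d : ℝ) ≤ k * r := by
  have hr : (k * (r : ℝ≥0∞)) = ((k * r : ℝ≥0) : ℝ≥0∞) := by push_cast; rfl
  rw [hr] at h
  obtain ⟨d, hd⟩ : ∃ d : ℕ, x = d := by
    refine (ENat.ne_top_iff_exists.1 fun hx => ?_).imp fun _ => Eq.symm
    rw [hx, ENat.toENNReal_top] at h
    exact absurd h (not_le.2 ENNReal.coe_lt_top)
  refine ⟨d, hd, ?_⟩
  rw [hd] at h
  have h2 : (d : ℝ≥0) ≤ k * r := by
    rw [← ENNReal.coe_le_coe]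
    simpa using h
  exact_mod_cast h2

/-- The faces in `F` lie on the facet `κ` or on two facets. -/
def Reaches (F : Set T.Face) (κ : Fin 4) : Prop :=
  (∃ f ∈ F, T.OnFacet κ f) ∨
    ∃ a b, a ≠ b ∧ (∃ f ∈ F, T.OnFacet a f) ∧ ∃ f ∈ F, T.OnFacet b f

theorem Reaches.mono {F F' : Set T.Face} (h : F ⊆ F') {κ : Fin 4} (hF : Reaches F κ) :
    Reaches F' κ := by
  rcases hF with ⟨f, hf, h1⟩ | ⟨a, b, hab, ⟨f, hf, h1⟩, g, hg, h2⟩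
  · exact Or.inl ⟨f, h hf, h1⟩
  · exact Or.inr ⟨a, b, hab, ⟨f, h hf, h1⟩, g, h hg, h2⟩

theorem Reaches.row_eq_zero {F : Set T.Face} {κ : Fin 4} (hF : Reaches F κ)
    {α : Fin 4 → V → Fin 4 → ZMod 2} (hα : T.IsPotential α) {z : Fin 4 → Fin 4 → ZMod 2}
    (hz : z ∈ cycleSpace) (h : ∀ f ∈ F, T.AgreesOnFace α z f) : z κ = 0 := by
  rcases hF with ⟨f, hf, h1⟩ | ⟨a, b, hab, ⟨f, hf, h1⟩, g, hg, h2⟩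
  · exact row_eq_zero_of_onFacet hα (h f hf) h1
  · rw [cycleSpace_eq_zero hz hab (row_eq_zero_of_onFacet hα (h f hf) h1)
      (row_eq_zero_of_onFacet hα (h g hg) h2)]
    rfl

variable {C : Set T.Cell} {k : ℝ≥0} {n : ℕ} {B : Set T.Cell} {F : Set T.Face}

theorem OpenTree.exists_of_boundary_walk (hk : T.DistBound C k) (h : OpenTree C n B F) {v v' : T.Cell}
    (hv : v ∈ T.boundaryCells C) (hv' : v' ∈ T.boundaryCells C) (hvB : v ∈ B)
    (p : (T.dualGraph (T.facesOf C)).Walk v v') :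
    ∃ n' : ℕ, (n' : ℝ) ≤ n + k * p.length ∧ ∃ B' F', OpenTree C n' B' F' ∧ B ⊆ B' ∧ F ⊆ F' ∧
      v' ∈ B' := by
  have h1 : T.dist (T.facesOf C) v v' ≤ p.length := SimpleGraph.edist_le p
  have h2 := hk.dist v hv v' hv'
  obtain ⟨d, hd, hdr⟩ := exists_nat_of_toENNReal_le (r := p.length) (h2.trans (by
    gcongr
    exact_mod_cast ENat.toENNReal_le.2 h1))
  obtain ⟨n', hn', h3⟩ := h.exists_of_dist hd.le hvB
  have : (n' : ℝ) ≤ n + d := by exact_mod_cast hn'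
  exact ⟨n', by linarith, h3⟩

/-- The two cases of the minimum either reach the wanted facet or grow the tree to two facets, one
after the other. Both force row `κ` of `z` to vanish. -/
theorem OpenTree.exists_of_facet_walk (hk : T.DistBound C k) (h : OpenTree C n B F) {v u : T.Cell}
    (hv : v ∈ T.boundaryCells C) (hvB : v ∈ B) (p : (T.dualGraph (T.facesOf C)).Walk v u)
    {κ : Fin 4} {f : T.Face} (hf : f ∈ T.facesOf C) (hfu : T.IsFaceOf f u) (hfκ : T.OnFacet κ f) :
    ∃ n' : ℕ, (n' : ℝ) ≤ n + k * (p.length + 1) ∧ ∃ B' F', OpenTree C n' B' F' ∧ B ⊆ B' ∧ F ⊆ F' ∧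
      Reaches F' κ := by
  have h1 : T.facetDist (T.facesOf C) κ v ≤ (p.length + 1 : ℕ) := by
    refine iInf₂_le_of_le u ⟨f, hf, hfu, hfκ⟩ ?_
    push_cast
    exact add_le_add_left (SimpleGraph.edist_le p) 1
  have h2 := (hk.facet κ v hv).trans (show _ ≤ (k : ℝ≥0∞) * ((p.length + 1 : ℕ) : ℝ≥0∞) by
    gcongr
    exact_mod_cast ENat.toENNReal_le.2 h1)
  rcases min_le_iff.1 h2 with h2 | h2
  · obtain ⟨d, hd, hdr⟩ := exists_nat_of_toENNReal_le h2
    obtain ⟨n', hn', B', F', h', hB, hF, hκ⟩ := h.exists_of_facetDist hd.le hvB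
    have : (n' : ℝ) ≤ n + d := by exact_mod_cast hn'
    push_cast at hdr
    exact ⟨n', by linarith, B', F', h', hB, hF, Or.inl hκ⟩
  · obtain ⟨d, hd, hdr⟩ := exists_nat_of_toENNReal_le h2
    have hlt : T.twoFacetDist (T.facesOf C)ᶜ v < (d + 1 : ℕ) := by
      rw [hd]; exact_mod_cast Nat.lt_succ_self d
    obtain ⟨a, ha⟩ := iInf_lt_iff.1 hlt
    obtain ⟨b, hb⟩ := iInf_lt_iff.1 ha
    obtain ⟨hab, hb⟩ := iInf_lt_iff.1 hb
    have hfin := ne_top_of_lt hb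
    obtain ⟨da, hda⟩ := ENat.ne_top_iff_exists.1
      (show T.facetDist (T.facesOf C)ᶜ a v ≠ ⊤ from fun h => hfin (by rw [h, top_add]))
    obtain ⟨db, hdb⟩ := ENat.ne_top_iff_exists.1
      (show T.facetDist (T.facesOf C)ᶜ b v ≠ ⊤ from fun h => hfin (by rw [h, add_top]))
    rw [← hda, ← hdb] at hb
    have hsum : da + db < d + 1 := by exact_mod_cast hb
    obtain ⟨n₁, hn₁, B₁, F₁, h₁, hB₁, hF₁, f₁, hf₁, hfa⟩ := h.exists_of_facetDist hda.ge hvB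
    obtain ⟨n₂, hn₂, B₂, F₂, h₂, hB₂, hF₂, hfb⟩ := h₁.exists_of_facetDist hdb.ge (hB₁ hvB)
    have : n₂ ≤ n + d := by omega
    have : (n₂ : ℝ) ≤ n + d := by exact_mod_cast this
    push_cast at hdr
    exact ⟨n₂, by linarith, B₂, F₂, h₂, hB₁.trans hB₂, hF₁.trans hF₂,
      Or.inr ⟨a, b, hab, ⟨f₁, hF₂ hf₁, hfa⟩, hfb⟩⟩

/-- The boundary cells on a walk inside the layer are joined by an open tree. -/
theorem exists_openTree_of_walk (hk : T.DistBound C k) {a b : T.Cell}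
    (p : (T.dualGraph (T.facesOf C)).Walk a b) :
    (∀ c ∈ p.support, c ∉ T.boundaryCells C) ∨
      ∃ (n : ℕ) (B : Set T.Cell) (F : Set T.Face) (v v' : T.Cell)
        (p₁ : (T.dualGraph (T.facesOf C)).Walk a v) (p₂ : (T.dualGraph (T.facesOf C)).Walk v' b),
        OpenTree C n B F ∧ (v ∈ B ∧ v ∈ T.boundaryCells C) ∧ (v' ∈ B ∧ v' ∈ T.boundaryCells C) ∧
        (∀ c ∈ p.support, c ∈ T.boundaryCells C → c ∈ B) ∧
        (n : ℝ) + k * p₁.length + k * p₂.length ≤ k * p.length := by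
  induction p with
  | @nil u =>
    by_cases hu : u ∈ T.boundaryCells C
    · exact Or.inr ⟨0, {u}, ∅, u, u, .nil, .nil, .single u, ⟨rfl, hu⟩, ⟨rfl, hu⟩,
        by simp, by simp⟩
    · exact Or.inl (by simpa using hu)
  | @cons u w b hadj p ih =>
    have hlen : ((SimpleGraph.Walk.cons hadj p).length : ℝ) = p.length + 1 := by
      rw [SimpleGraph.Walk.length_cons]; push_cast; rfl
    by_cases hu : u ∈ T.boundaryCells C
    · right
      rcases ih with ih | ⟨n, B, F, v, v', p₁, p₂, h, hv, hv', hB, hn⟩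
      -- Here `u` is the only boundary cell so far, and the rest of the walk is kept as the unused
      -- end `p₂`.
      · refine ⟨0, {u}, ∅, u, u, .nil, .cons hadj p, .single u, ⟨rfl, hu⟩, ⟨rfl, hu⟩, ?_, by simp⟩
        intro c hc hcb
        rw [SimpleGraph.Walk.support_cons, List.mem_cons] at hc
        exact hc.resolve_right fun hc => ih c hc hcb
      -- The gap between `u` and the next boundary cell `v` is paid for with the unused start `p₁`
      -- and the new edge.
      · obtain ⟨n', hn', B', F', h', hBB, -, hu'⟩ :=
          h.exists_of_boundary_walk hk hv.2 hu hv.1 (SimpleGraph.Walk.cons hadj p₁).reverse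
        refine ⟨n', B', F', u, v', .nil, p₂, h', ⟨hu', hu⟩, ⟨hBB hv'.1, hv'.2⟩, ?_, ?_⟩
        · intro c hc hcb
          rw [SimpleGraph.Walk.support_cons, List.mem_cons] at hc
          rcases hc with rfl | hc
          exacts [hu', hBB (hB c hc hcb)]
        · rw [SimpleGraph.Walk.length_reverse, SimpleGraph.Walk.length_cons] at hn'
          push_cast at hn'
          rw [hlen, SimpleGraph.Walk.length_nil]
          push_cast
          nlinarith
    · rcases ih with ih | ⟨n, B, F, v, v', p₁, p₂, h, hv, hv', hB, hn⟩
      · left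
        intro c hc
        rw [SimpleGraph.Walk.support_cons, List.mem_cons] at hc
        rcases hc with rfl | hc
        exacts [hu, ih c hc]
      · refine Or.inr ⟨n, B, F, v, v', .cons hadj p₁, p₂, h, hv, hv', ?_, ?_⟩
        · intro c hc hcb
          rw [SimpleGraph.Walk.support_cons, List.mem_cons] at hc
          rcases hc with rfl | hc
          exacts [absurd hcb hu, hB c hc hcb]
        · rw [hlen, SimpleGraph.Walk.length_cons]
          push_cast
          nlinarith

end TetrahedralColex

/-! ### Cells and facets at a face, and closed tours of a component. -/

namespace TetrahedralColex

variable {V : Type*} {T : TetrahedralColex V}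

theorem cell_eq_of_colors_eq {f : T.Face} {c c' : T.Cell} (h : T.IsFaceOf f c) (h' : T.IsFaceOf f c')
    (hc : c.1.1.1 = c'.1.1.1) : c = c' := by
  obtain ⟨v, hv⟩ := f.1.nonempty
  exact Subtype.ext (ColexGraph.Elem.ext_of_mem hc (h.2 hv) (h'.2 hv))

theorem _root_.Finset.eq_compl_singleton_of_compl_pair_subset {i j : Fin 4} {c : Finset (Fin 4)}
    (hc : c.card = 3) (h : ({i, j}ᶜ : Finset (Fin 4)) ⊆ c) : c = {i}ᶜ ∨ c = {j}ᶜ := by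
  revert i j c; decide

/-- A face is part of at most two cells. -/
theorem cell_eq_or_eq {f : T.Face} {c c' : T.Cell} (hne : c ≠ c') (h : T.IsFaceOf f c)
    (h' : T.IsFaceOf f c') {d : T.Cell} (hd : T.IsFaceOf f d) : d = c ∨ d = c' := by
  obtain ⟨i, j, -, hij⟩ := ColexGraph.exists_eq_compl_pair f.2
  have hcol : ∀ d : T.Cell, T.IsFaceOf f d → d.1.1.1 = {i}ᶜ ∨ d.1.1.1 = {j}ᶜ := fun d hd =>
    Finset.eq_compl_singleton_of_compl_pair_subset d.2 (hij ▸ hd.1)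
  have hne' : c.1.1.1 ≠ c'.1.1.1 := fun e => hne (cell_eq_of_colors_eq h h' e)
  have key : d.1.1.1 = c.1.1.1 ∨ d.1.1.1 = c'.1.1.1 := by
    rcases hcol c h with e | e <;> rcases hcol c' h' with e' | e' <;> rcases hcol d hd with e'' | e'' <;>
      simp_all
  exact key.imp (cell_eq_of_colors_eq hd h) (cell_eq_of_colors_eq hd h')

theorem colors_ne_of_onFacet {f : T.Face} {κ : Fin 4} (h : T.OnFacet κ f) {c : T.Cell}
    (hc : T.IsFaceOf f c) : c.1.1.1 ≠ {κ}ᶜ := by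
  intro e
  obtain ⟨v, hv⟩ := f.1.nonempty
  have h1 := c.1.eq_component (hc.2 hv)
  rw [e] at h1
  refine c.1.2.2.2 ?_
  rw [h1]
  exact (T.mem_component_comm).1 (h.2 hv)

/-- A face has room for two cells, one for each of its missing colours. If it lies on a facet, one
of the two is the removed cell. -/
theorem not_onFacet_of_cells {f : T.Face} {c c' : T.Cell} (hne : c ≠ c') (h : T.IsFaceOf f c)
    (h' : T.IsFaceOf f c') (κ : Fin 4) : ¬ T.OnFacet κ f := by
  intro hκ
  obtain ⟨i, j, -, hij⟩ := ColexGraph.exists_eq_compl_pair f.2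
  have h1 := Finset.eq_compl_singleton_of_compl_pair_subset c.2 (hij ▸ h.1)
  have h2 := Finset.eq_compl_singleton_of_compl_pair_subset c'.2 (hij ▸ h'.1)
  have h3 := colors_ne_of_onFacet hκ h
  have h4 := colors_ne_of_onFacet hκ h'
  have h5 : κ = i ∨ κ = j := by
    have := hκ.1
    rw [hij, Finset.compl_subset_compl] at this
    simpa using this
  have h6 : c.1.1.1 ≠ c'.1.1.1 := fun e => hne (cell_eq_of_colors_eq h h' e)
  rcases h5 with rfl | rfl <;> rcases h1 with h1 | h1 <;> rcases h2 with h2 | h2 <;> simp_all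

theorem facet_unique {f : T.Face} {c : T.Cell} (hc : T.IsFaceOf f c) {κ κ' : Fin 4}
    (h : T.OnFacet κ f) (h' : T.OnFacet κ' f) : κ = κ' := by
  obtain ⟨i, j, -, hij⟩ := ColexGraph.exists_eq_compl_pair f.2
  have h1 := Finset.eq_compl_singleton_of_compl_pair_subset c.2 (hij ▸ hc.1)
  have h3 := colors_ne_of_onFacet h hc
  have h4 := colors_ne_of_onFacet h' hc
  have h5 : ∀ κ, T.OnFacet κ f → κ = i ∨ κ = j := by
    intro κ hκ
    have := hκ.1
    rw [hij, Finset.compl_subset_compl] at this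
    simpa using this
  rcases h5 κ h with e | e <;> rcases h5 κ' h' with e' | e' <;> rcases h1 with h1 | h1 <;> simp_all

theorem _root_.SimpleGraph.Walk.exists_detour {W : Type*} {H : SimpleGraph W} {u w x y : W} (p : H.Walk u w)
    (hx : x ∈ p.support) (hxy : H.Adj x y) :
    ∃ p' : H.Walk u w, p'.length = p.length + 2 ∧ (∀ c ∈ p.support, c ∈ p'.support) ∧ y ∈ p'.support := by
  classical
  have hspec := p.take_spec hx
  refine ⟨((p.takeUntil x hx).append (.cons hxy (.cons hxy.symm .nil))).append (p.dropUntil x hx),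
    ?_, fun c hc => ?_, ?_⟩
  · have h := congrArg SimpleGraph.Walk.length hspec
    rw [SimpleGraph.Walk.length_append] at h
    simp only [SimpleGraph.Walk.length_append, SimpleGraph.Walk.length_cons, SimpleGraph.Walk.length_nil]
    omega
  · rw [← hspec, SimpleGraph.Walk.mem_support_append_iff] at hc
    simp only [SimpleGraph.Walk.mem_support_append_iff]
    exact hc.imp Or.inl id
  · simp [SimpleGraph.Walk.mem_support_append_iff]

/-- A connected component of the dual graph of `φ` has a closed walk through all its cells that
is at most twice as long as the number of faces it crosses. -/
theorem exists_tour (φ : Finset T.Face) (u : T.Cell) :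
    ∃ (ψ : Finset T.Face) (p : (T.dualGraph (φ : Set T.Face)).Walk u u), ψ ⊆ φ ∧
      p.length ≤ 2 * ψ.card ∧
      (∀ f ∈ ψ, ∃ c ∈ p.support, ∃ c' ∈ p.support, c ≠ c' ∧ T.IsFaceOf f c ∧ T.IsFaceOf f c') ∧
      ∀ c, (T.dualGraph (φ : Set T.Face)).Reachable u c → c ∈ p.support := by
  classical
  let P : ℕ → Prop := fun m => ∃ (ψ : Finset T.Face) (p : (T.dualGraph (φ : Set T.Face)).Walk u u),
    ψ.card = m ∧ ψ ⊆ φ ∧ p.length ≤ 2 * ψ.card ∧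
    (∀ f ∈ ψ, ∃ c ∈ p.support, ∃ c' ∈ p.support, c ≠ c' ∧ T.IsFaceOf f c ∧ T.IsFaceOf f c') ∧
    ∀ f ∈ ψ, ∀ c, T.IsFaceOf f c → c ∈ p.support
  have hP0 : P 0 := ⟨∅, .nil, by simp, by simp, by simp, by simp, by simp⟩
  have hPle : ∀ m, P m → m ≤ φ.card := by
    rintro m ⟨ψ, p, rfl, h, -⟩
    exact Finset.card_le_card h
  -- A tour with the most crossed faces is chosen. Were some reachable cell missed, an edge leaving
  -- the tour could be added as a detour there and back, for one new face and two more steps.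
  obtain ⟨ψ, p, hm, h1, h2, h3, h4⟩ := Nat.findGreatest_spec (P := P) (Nat.zero_le φ.card) hP0
  refine ⟨ψ, p, h1, h2, h3, fun c hc => ?_⟩
  by_contra hcp
  obtain ⟨q⟩ := hc
  obtain ⟨d, -, hd1, hd2⟩ := q.exists_boundary_dart {c | c ∈ p.support} p.start_mem_support hcp
  obtain ⟨hne, f, hf, hf1, hf2⟩ := d.adj
  have hfψ : f ∉ ψ := fun h => hd2 (h4 f h _ hf2)
  obtain ⟨p', hp1, hp2, hp3⟩ := p.exists_detour hd1 d.adj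
  have hcard : (insert f ψ).card = ψ.card + 1 := Finset.card_insert_of_notMem hfψ
  have hnew : P (ψ.card + 1) := by
    refine ⟨insert f ψ, p', hcard, Finset.insert_subset hf h1, by omega, fun g hg => ?_, fun g hg c hc => ?_⟩
    · rcases Finset.mem_insert.1 hg with rfl | hg
      · exact ⟨d.fst, hp2 _ hd1, d.snd, hp3, hne, hf1, hf2⟩
      · obtain ⟨c, hc, c', hc', h⟩ := h3 g hg
        exact ⟨c, hp2 _ hc, c', hp2 _ hc', h⟩
    · rcases Finset.mem_insert.1 hg with rfl | hg
      · rcases cell_eq_or_eq hne hf1 hf2 hc with rfl | rfl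
        exacts [hp2 _ hd1, hp3]
      · exact hp2 _ (h4 g hg c hc)
  have := Nat.le_findGreatest (hPle _ hnew) hnew
  omega

end TetrahedralColex

/-! ### The cost of one connected component. -/

namespace TetrahedralColex

variable {V : Type*} {T : TetrahedralColex V} {C : Set T.Cell} {k : ℝ≥0} {kface : ℕ}

theorem card_le_of_tree {n N : ℕ} {x : ℝ} {M : Finset T.Face} (hM : M.card ≤ n * N)
    (hn : (n : ℝ) ≤ x) : (M.card : ℝ) ≤ x * N := by
  have h1 : (M.card : ℝ) ≤ n * N := by exact_mod_cast hM
  exact h1.trans (mul_le_mul_of_nonneg_right hn (Nat.cast_nonneg _))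

theorem exists_agrees_of_walk (hface : ∀ c : T.Cell, {f : T.Face | T.IsFaceOf f c}.ncard ≤ kface)
    (hsimple : T.MeetsSimply C) (hk : T.DistBound C k) {a b : T.Cell}
    (p : (T.dualGraph (T.facesOf C)).Walk a b) :
    ∃ M : Finset T.Face, (M.card : ℝ) ≤ k * p.length * (2 * (kface - 1) : ℕ) ∧
      (∀ g ∈ M, g ∉ T.facesOf C) ∧ ∀ α τ, T.IsCoboundary α τ → (∀ g ∈ M, τ g = 0) →
        ∃ z ∈ cycleSpace, ∀ c ∈ p.support, c ∈ T.boundaryCells C → T.AgreesOnCell α z c := by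
  rcases exists_openTree_of_walk hk p with h | ⟨n, B, F, v, v', p₁, p₂, h, hv, hv', hB, hn⟩
  · exact ⟨∅, by simp; positivity, by simp, fun _ _ _ _ => ⟨0, cycleSpace.zero_mem, fun c hc hcb => absurd hcb (h c hc)⟩⟩
  · obtain ⟨M, hM, hMC, hag⟩ := h.exists_agrees hface hsimple
    refine ⟨M, card_le_of_tree hM ?_, hMC, fun α τ hα hτ => ?_⟩
    · have : (0 : ℝ) ≤ k * p₁.length := by positivity
      have : (0 : ℝ) ≤ k * p₂.length := by positivity
      linarith
    · obtain ⟨z, hz, hzB, -⟩ := hag α τ hα hτ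
      exact ⟨z, hz, fun c hc hcb => hzB c (hB c hc hcb)⟩

/-- The unused start of the walk, together with the edge to the facet, pays for joining the tree to
the facet. -/
theorem exists_agrees_of_facet_walk
    (hface : ∀ c : T.Cell, {f : T.Face | T.IsFaceOf f c}.ncard ≤ kface)
    (hsimple : T.MeetsSimply C) (hk : T.DistBound C k) {a b : T.Cell}
    (p : (T.dualGraph (T.facesOf C)).Walk a b) {f : T.Face} (hf : f ∈ T.facesOf C)
    (hfa : T.IsFaceOf f a) {κ : Fin 4} (hfκ : T.OnFacet κ f) :
    ∃ M : Finset T.Face, (M.card : ℝ) ≤ k * (p.length + 1) * (2 * (kface - 1) : ℕ) ∧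
      (∀ g ∈ M, g ∉ T.facesOf C) ∧ ∀ α τ, T.IsCoboundary α τ → (∀ g ∈ M, τ g = 0) →
        ∃ z ∈ cycleSpace, z κ = 0 ∧
          ∀ c ∈ p.support, c ∈ T.boundaryCells C → T.AgreesOnCell α z c := by
  rcases exists_openTree_of_walk hk p with h | ⟨n, B, F, v, v', p₁, p₂, h, hv, hv', hB, hn⟩
  · exact ⟨∅, by simp; positivity, by simp, fun _ _ _ _ =>
      ⟨0, cycleSpace.zero_mem, rfl, fun c hc hcb => absurd hcb (h c hc)⟩⟩
  · obtain ⟨n', hn', B', F', h', hBB, -, hκ⟩ :=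
      h.exists_of_facet_walk hk hv.2 hv.1 p₁.reverse hf hfa hfκ
    obtain ⟨M, hM, hMC, hag⟩ := h'.exists_agrees hface hsimple
    refine ⟨M, card_le_of_tree hM ?_, hMC, fun α τ hα hτ => ?_⟩
    · have : (0 : ℝ) ≤ k * p₂.length := by positivity
      rw [SimpleGraph.Walk.length_reverse] at hn'
      linarith
    · obtain ⟨z, hz, hzB, hzF⟩ := hag α τ hα hτ
      exact ⟨z, hz, hκ.row_eq_zero hα.toIsPotential hz hzF, fun c hc hcb => hzB c (hBB (hB c hc hcb))⟩

/-- Both unused ends are spent, one for each facet. Two vanishing rows leave only `z = 0`. -/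
theorem exists_agrees_of_two_facet_walk
    (hface : ∀ c : T.Cell, {f : T.Face | T.IsFaceOf f c}.ncard ≤ kface)
    (hsimple : T.MeetsSimply C) (hk : T.DistBound C k) {a b : T.Cell}
    (p : (T.dualGraph (T.facesOf C)).Walk a b) {f f' : T.Face} (hf : f ∈ T.facesOf C)
    (hf' : f' ∈ T.facesOf C) (hfa : T.IsFaceOf f a) (hfb : T.IsFaceOf f' b) {κ κ' : Fin 4}
    (hfκ : T.OnFacet κ f) (hfκ' : T.OnFacet κ' f') (hne : κ ≠ κ') :
    ∃ M : Finset T.Face, (M.card : ℝ) ≤ k * (p.length + 2) * (2 * (kface - 1) : ℕ) ∧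
      (∀ g ∈ M, g ∉ T.facesOf C) ∧ ∀ α τ, T.IsCoboundary α τ → (∀ g ∈ M, τ g = 0) →
        ∀ c ∈ p.support, c ∈ T.boundaryCells C → T.AgreesOnCell α 0 c := by
  rcases exists_openTree_of_walk hk p with h | ⟨n, B, F, v, v', p₁, p₂, h, hv, hv', hB, hn⟩
  · exact ⟨∅, by simp; positivity, by simp, fun _ _ _ _ c hc hcb => absurd hcb (h c hc)⟩
  · obtain ⟨n₁, hn₁, B₁, F₁, h₁, hBB, -, hκ⟩ :=
      h.exists_of_facet_walk hk hv.2 hv.1 p₁.reverse hf hfa hfκ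
    obtain ⟨n₂, hn₂, B₂, F₂, h₂, hBB₂, hFF₂, hκ'⟩ :=
      h₁.exists_of_facet_walk hk hv'.2 (hBB hv'.1) p₂ hf' hfb hfκ'
    obtain ⟨M, hM, hMC, hag⟩ := h₂.exists_agrees hface hsimple
    refine ⟨M, card_le_of_tree hM ?_, hMC, fun α τ hα hτ => ?_⟩
    · rw [SimpleGraph.Walk.length_reverse] at hn₁
      linarith
    · obtain ⟨z, hz, hzB, hzF⟩ := hag α τ hα hτ
      have hz0 := cycleSpace_eq_zero hz hne ((hκ.mono hFF₂).row_eq_zero hα.toIsPotential hz hzF)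
        (hκ'.row_eq_zero hα.toIsPotential hz hzF)
      exact fun c hc hcb => hz0 ▸ hzB c (hBB₂ (hBB (hB c hc hcb)))

/-- The faces of `φ` that belong to the connected component of the cell `u` in the dual graph. -/
noncomputable def componentFaces (φ : Finset T.Face) (u : T.Cell) : Finset T.Face := by
  classical
  exact φ.filter fun f => ∃ c, (T.dualGraph (φ : Set T.Face)).Reachable u c ∧ T.IsFaceOf f c

theorem mem_componentFaces {φ : Finset T.Face} {u : T.Cell} {f : T.Face} :
    f ∈ componentFaces φ u ↔
      f ∈ φ ∧ ∃ c, (T.dualGraph (φ : Set T.Face)).Reachable u c ∧ T.IsFaceOf f c := by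
  simp [componentFaces]

theorem reachable_of_mem_componentFaces {φ : Finset T.Face} {u : T.Cell} {f : T.Face}
    (hf : f ∈ componentFaces φ u) {c : T.Cell} (hc : T.IsFaceOf f c) :
    (T.dualGraph (φ : Set T.Face)).Reachable u c := by
  obtain ⟨hφ, c', hc', hfc'⟩ := mem_componentFaces.1 hf
  by_cases h : c' = c
  · exact h ▸ hc'
  · exact hc'.trans (SimpleGraph.Adj.reachable ⟨h, f, hφ, hfc', hc⟩)

theorem dualGraph_mono {Φ Φ' : Set T.Face} (h : Φ ⊆ Φ') : T.dualGraph Φ ≤ T.dualGraph Φ' :=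
  fun _ _ hadj => ⟨hadj.1, hadj.2.imp fun _ hf => ⟨h hf.1, hf.2⟩⟩

/-- The tour uses two steps per crossed face, and those faces lie on no facet. A face on a facet
thus contributes a further budget of two, enough for its one or two uses as an end of a walk. -/
theorem exists_agrees_on_component
    (hface : ∀ c : T.Cell, {f : T.Face | T.IsFaceOf f c}.ncard ≤ kface)
    (hsimple : T.MeetsSimply C) (hk : T.DistBound C k) {φ : Finset T.Face}
    (hφ : (φ : Set T.Face) ⊆ T.facesOf C) (u : T.Cell) :
    ∃ M : Finset T.Face,
      (M.card : ℝ) ≤ k * (2 * (componentFaces φ u).card) * (2 * (kface - 1) : ℕ) ∧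
      (∀ g ∈ M, g ∉ T.facesOf C) ∧ ∀ α τ, T.IsCoboundary α τ → (∀ g ∈ M, τ g = 0) →
        ∃ z ∈ cycleSpace,
          (∀ c, (T.dualGraph (φ : Set T.Face)).Reachable u c → c ∈ T.boundaryCells C →
            T.AgreesOnCell α z c) ∧
          ∀ κ, ∀ f ∈ componentFaces φ u, T.OnFacet κ f → z κ = 0 := by
  classical
  have hle := dualGraph_mono hφ
  have hKpos : (0 : ℝ) ≤ ((2 * (kface - 1) : ℕ) : ℝ) := Nat.cast_nonneg _
  have hkpos : (0 : ℝ) ≤ k := k.2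
  -- a tour from any cell of the component
  have htour : ∀ u', (T.dualGraph (φ : Set T.Face)).Reachable u u' →
      ∃ (ψ : Finset T.Face) (p : (T.dualGraph (T.facesOf C)).Walk u' u'), p.length ≤ 2 * ψ.card ∧
        ψ ⊆ componentFaces φ u ∧ (∀ f ∈ ψ, ∀ κ, ¬ T.OnFacet κ f) ∧
        ∀ c, (T.dualGraph (φ : Set T.Face)).Reachable u c → c ∈ p.support := by
    intro u' hu'
    obtain ⟨ψ, p, h1, h2, h3, h4⟩ := exists_tour φ u'
    refine ⟨ψ, p.mapLe hle, by simpa using h2, fun f hf => ?_, fun f hf κ => ?_, fun c hc => ?_⟩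
    · obtain ⟨c, hc, -, -, -, hfc, -⟩ := h3 f hf
      exact mem_componentFaces.2 ⟨h1 hf, c, hu'.trans ⟨p.takeUntil c hc⟩, hfc⟩
    · obtain ⟨c, -, c', -, hne, hfc, hfc'⟩ := h3 f hf
      exact not_onFacet_of_cells hne hfc hfc' κ
    · simpa using h4 c (hu'.symm.trans hc)
  by_cases hA : ∃ f ∈ componentFaces φ u, ∃ κ, T.OnFacet κ f
  · obtain ⟨f, hf, κ, hfκ⟩ := hA
    obtain ⟨hfφ, a, hua, hfa⟩ := mem_componentFaces.1 hf
    obtain ⟨ψ, p, hp, hψ, hψκ, hsupp⟩ := htour a hua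
    have hfψ : f ∉ ψ := fun h => hψκ f h κ hfκ
    -- With two facets the tour is cut at `b` into two walks, each running from one facet to the
    -- other. The trees need not be joined, because both impose `z = 0`; the four extra edges are
    -- paid for by `f` and `f'`.
    by_cases hB : ∃ f' ∈ componentFaces φ u, ∃ κ', κ ≠ κ' ∧ T.OnFacet κ' f'
    · obtain ⟨f', hf', κ', hne, hfκ'⟩ := hB
      obtain ⟨hfφ', b, hub, hfb⟩ := mem_componentFaces.1 hf'
      have hb := hsupp b hub
      obtain ⟨M₁, hM₁, hMC₁, hag₁⟩ := exists_agrees_of_two_facet_walk hface hsimple hk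
        (p.takeUntil b hb) (hφ hfφ) (hφ hfφ') hfa hfb hfκ hfκ' hne
      obtain ⟨M₂, hM₂, hMC₂, hag₂⟩ := exists_agrees_of_two_facet_walk hface hsimple hk
        (p.dropUntil b hb) (hφ hfφ') (hφ hfφ) hfb hfa hfκ' hfκ hne.symm
      refine ⟨M₁ ∪ M₂, ?_, fun g hg => ?_, fun α τ hα hτ => ⟨0, cycleSpace.zero_mem, fun c hc hcb => ?_,
        fun _ _ _ _ => rfl⟩⟩
      · have hlen := congrArg SimpleGraph.Walk.length (p.take_spec hb)
        rw [SimpleGraph.Walk.length_append] at hlen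
        have hff : f ≠ f' := by
          rintro rfl
          exact hne (facet_unique hfa hfκ hfκ')
        have hfψ' : f' ∉ ψ := fun h => hψκ f' h κ' hfκ'
        have hcard : (insert f (insert f' ψ)).card ≤ (componentFaces φ u).card :=
          Finset.card_le_card (Finset.insert_subset hf (Finset.insert_subset hf' hψ))
        rw [Finset.card_insert_of_notMem (by simp [hff, hfψ]), Finset.card_insert_of_notMem hfψ'] at hcard
        have h1 : (p.takeUntil b hb).length + 2 + ((p.dropUntil b hb).length + 2) ≤
            2 * (componentFaces φ u).card := by omega
        have h2 : ((p.takeUntil b hb).length + 2 + ((p.dropUntil b hb).length + 2) : ℝ) ≤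
            2 * (componentFaces φ u).card := by exact_mod_cast h1
        have h3 : ((M₁ ∪ M₂).card : ℝ) ≤ M₁.card + M₂.card := by
          exact_mod_cast Finset.card_union_le _ _
        have h4 := mul_le_mul_of_nonneg_right (mul_le_mul_of_nonneg_left h2 hkpos) hKpos
        nlinarith
      · rcases Finset.mem_union.1 hg with hg | hg
        exacts [hMC₁ g hg, hMC₂ g hg]
      · have hc' := hsupp c hc
        rw [← p.take_spec hb, SimpleGraph.Walk.mem_support_append_iff] at hc'
        rcases hc' with hc' | hc'
        · exact hag₁ α τ hα (fun g hg => hτ g (Finset.mem_union_left _ hg)) c hc' hcb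
        · exact hag₂ α τ hα (fun g hg => hτ g (Finset.mem_union_right _ hg)) c hc' hcb
    · push Not at hB
      obtain ⟨M, hM, hMC, hag⟩ := exists_agrees_of_facet_walk hface hsimple hk p (hφ hfφ) hfa hfκ
      refine ⟨M, hM.trans ?_, hMC, fun α τ hα hτ => ?_⟩
      · have hcard : (insert f ψ).card ≤ (componentFaces φ u).card :=
          Finset.card_le_card (Finset.insert_subset hf hψ)
        rw [Finset.card_insert_of_notMem hfψ] at hcard
        have h1 : p.length + 1 ≤ 2 * (componentFaces φ u).card := by omega
        have h2 : (p.length + 1 : ℝ) ≤ 2 * (componentFaces φ u).card := by exact_mod_cast h1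
        exact mul_le_mul_of_nonneg_right (mul_le_mul_of_nonneg_left h2 hkpos) hKpos
      · obtain ⟨z, hz, hzκ, hzc⟩ := hag α τ hα hτ
        refine ⟨z, hz, fun c hc hcb => hzc c (hsupp c hc) hcb, fun κ' f' hf' hfκ' => ?_⟩
        by_cases hne : κ = κ'
        · exact hne ▸ hzκ
        · exact absurd hfκ' (hB f' hf' κ' hne)
  · push Not at hA
    obtain ⟨ψ, p, hp, hψ, -, hsupp⟩ := htour u (SimpleGraph.Reachable.refl u)
    obtain ⟨M, hM, hMC, hag⟩ := exists_agrees_of_walk hface hsimple hk p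
    refine ⟨M, hM.trans ?_, hMC, fun α τ hα hτ => ?_⟩
    · have hcard := Finset.card_le_card hψ
      have h1 : p.length ≤ 2 * (componentFaces φ u).card := by omega
      have h2 : (p.length : ℝ) ≤ 2 * (componentFaces φ u).card := by exact_mod_cast h1
      exact mul_le_mul_of_nonneg_right (mul_le_mul_of_nonneg_left h2 hkpos) hKpos
    · obtain ⟨z, hz, hzc⟩ := hag α τ hα hτ
      exact ⟨z, hz, fun c hc hcb => hzc c (hsupp c hc) hcb, fun κ f hf hfκ => absurd hfκ (hA f hf κ)⟩

end TetrahedralColex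

/-! ### Pairing a coboundary with a component cell by cell, and conclusion. -/

namespace TetrahedralColex

variable {V : Type*} {T : TetrahedralColex V} {C : Set T.Cell} {k : ℝ≥0} {kface : ℕ}

open Classical in
theorem faceValue_ite (c : T.Cell) (a : Fin 4 → ZMod 2) {s : Finset (Fin 4)} (hs : s.card = 2)
    (v : V) :
    T.toColexGraph.faceValue (fun f => if T.IsFaceOf f c then ∑ l ∈ f.1.1.1ᶜ, a l else 0) s v =
      if v ∈ c.1.1.2 ∧ s ⊆ c.1.1.1 then ∑ l ∈ sᶜ, a l else 0 := by
  by_cases h : T.out ∈ T.component s v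
  · rw [ColexGraph.faceValue_eq_zero _ h, if_neg]
    rintro ⟨h1, h2⟩
    refine c.1.2.2.2 ?_
    rw [c.1.eq_component h1]
    exact T.component_mono h2 v h
  · rw [ColexGraph.faceValue, dif_pos ⟨hs, h⟩]
    have h1 : T.IsFaceOf ⟨T.toColexGraph.elem s v (by omega) h, hs⟩ c ↔
        v ∈ c.1.1.2 ∧ s ⊆ c.1.1.1 := by
      have hv : v ∈ (T.toColexGraph.elem s v (by omega) h).1.2 := T.mem_component_self s v
      refine ⟨fun hc => ⟨hc.2 hv, hc.1⟩, fun hc => ?_⟩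
      exact (ColexGraph.Elem.le_iff_of_mem hv hc.1).2 hc.2
    simp only [h1]
    rfl

/-- The three faces at a vertex of a `κ`-cell get the three entries of the row, whose sum is even.
So a row on a single cell is orthogonal to all syndromes. -/
theorem sum_faces_at_vertex {κ : Fin 4} {a : Fin 4 → ZMod 2} (ha : IsRow κ a) :
    ∑ s ∈ Finset.powersetCard 2 Finset.univ,
      (if s ⊆ ({κ}ᶜ : Finset (Fin 4)) then ∑ l ∈ sᶜ, a l else 0) = 0 := by
  obtain ⟨h0, h⟩ := ha
  rw [Fin.sum_univ_four] at h
  rw [ColexGraph.sum_powersetCard_two]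
  fin_cases κ <;> simp at * <;> grind

/-- The sum over the faces of `φ` in the cell `c` vanishes for every row: the restriction of `φ` to
`c` is a syndrome. -/
def Chargeless (φ : Finset T.Face) (c : T.Cell) : Prop :=
  ∀ κ a, c.1.1.1 = {κ}ᶜ → IsRow κ a →
    ∑ f ∈ φ, (open Classical in if T.IsFaceOf f c then ∑ l ∈ f.1.1.1ᶜ, a l else 0) = 0

theorem chargeless_of_symmDiff_mem {φ : Finset T.Face} {φ' : Set T.Face} {c : T.Cell}
    (h : (φ : Set T.Face) ∆ φ' ∈ T.syndromes) (hc : ∀ f ∈ φ', ¬ T.IsFaceOf f c) :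
    Chargeless φ c := by
  classical
  intro κ a hκ ha
  have := T.finite
  have := Fintype.ofFinite V
  have := Fintype.ofFinite T.Face
  obtain ⟨Q, -, hQ⟩ := h
  set w : T.Face → ZMod 2 := fun f => if T.IsFaceOf f c then ∑ l ∈ f.1.1.1ᶜ, a l else 0 with hw
  have h1 : ∀ f, (if f ∈ φ then w f else 0) =
      ∑ v ∈ Q.toFinset, w f * (if v ∈ T.verts f then 1 else 0) := by
    intro f
    rw [← Finset.mul_sum, Finset.sum_boole]
    have h2 : ((Q.toFinset.filter fun v => v ∈ T.verts f).card : ZMod 2) =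
        ((T.verts f ∩ Q).ncard : ZMod 2) := by
      rw [← Set.ncard_coe_finset]
      congr 2
      ext v; simp [and_comm]
    rw [h2]
    by_cases hf : T.IsFaceOf f c
    · have h3 : f ∈ φ ↔ Odd (T.verts f ∩ Q).ncard := by
        have h4 : f ∉ φ' := fun h => hc f h hf
        have := Set.ext_iff.1 hQ f
        simpa [Set.mem_symmDiff, h4] using this
      by_cases hφ : f ∈ φ
      · rw [if_pos hφ, ZMod.natCast_eq_one_iff_odd.2 (h3.1 hφ), mul_one]
      · rw [if_neg hφ, ZMod.natCast_eq_zero_iff_even.2 (Nat.not_odd_iff_even.1 fun h => hφ (h3.2 h)),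
          mul_zero]
    · simp [hw, hf]
  have h2 : ∑ f ∈ φ, w f = ∑ f, if f ∈ φ then w f else 0 := by simp
  rw [h2, Finset.sum_congr rfl fun f _ => h1 f, Finset.sum_comm]
  refine Finset.sum_eq_zero fun v _ => ?_
  rw [← ColexGraph.sum_faceValue]
  by_cases hv : v ∈ c.1.1.2
  · rw [← sum_faces_at_vertex ha]
    refine Finset.sum_congr rfl fun s hs => ?_
    rw [hw, faceValue_ite c a (Finset.mem_powersetCard.1 hs).2, hκ]
    simp [hv]
  · refine Finset.sum_eq_zero fun s hs => ?_
    rw [hw, faceValue_ite c a (Finset.mem_powersetCard.1 hs).2, if_neg fun h => hv h.1]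

/-- The cells at `f` correspond to the colours missing in `f`, except those whose cell was removed;
`hK` makes these contribute nothing. -/
theorem sum_cells {f : T.Face} {v : V} (hv : v ∈ T.verts f) {A : Type*} [AddCommMonoid A]
    [Fintype T.Cell] [DecidablePred (T.IsFaceOf f)] {F : T.Cell → A} {K : Fin 4 → A}
    (hF : ∀ c κ, T.IsFaceOf f c → c.1.1.1 = {κ}ᶜ → F c = K κ)
    (hK : ∀ κ ∉ f.1.1.1, T.out ∈ T.component {κ}ᶜ v → K κ = 0) :
    ∑ c with T.IsFaceOf f c, F c = ∑ κ ∈ f.1.1.1ᶜ, K κ := by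
  classical
  have h0 : ∀ κ ∉ f.1.1.1, f.1.1.1 ⊆ {κ}ᶜ := fun κ h => by
    rwa [Finset.subset_compl_comm, Finset.singleton_subset_iff, Finset.mem_compl]
  rw [← Finset.sum_filter_of_ne (p := fun κ => T.out ∉ T.component {κ}ᶜ v) fun κ hκ hne h =>
    hne (hK κ (Finset.mem_compl.1 hκ) h)]
  symm
  have hcard : ∀ κ : Fin 4, ({κ}ᶜ : Finset (Fin 4)).card = 3 := by decide
  have hface : ∀ κ (h : T.out ∉ T.component {κ}ᶜ v), κ ∉ f.1.1.1 →
      T.IsFaceOf f ⟨T.toColexGraph.elem {κ}ᶜ v (hcard κ).le h, hcard κ⟩ := fun κ h hκ =>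
    (ColexGraph.Elem.le_iff_of_mem hv (T.mem_component_self {κ}ᶜ v)).2 (h0 κ hκ)
  refine Finset.sum_bij (fun κ hκ => ⟨T.toColexGraph.elem {κ}ᶜ v (hcard κ).le
    (Finset.mem_filter.1 hκ).2, hcard κ⟩) (fun κ hκ => ?_) (fun κ hκ l hl h => ?_) (fun c hc => ?_)
    fun κ hκ => ?_
  · obtain ⟨h1, h2⟩ := Finset.mem_filter.1 hκ
    simpa using hface κ h2 (Finset.mem_compl.1 h1)
  · have := congrArg (fun c : T.Cell => c.1.1.1) h
    simpa [ColexGraph.elem] using this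
  · have hfc : T.IsFaceOf f c := (Finset.mem_filter.1 hc).2
    obtain ⟨κ, hκ⟩ := ColexGraph.exists_eq_compl_singleton c.2
    have h1 : κ ∉ f.1.1.1 := fun h => by
      have := hfc.1 h
      simp [hκ] at this
    have hvc : v ∈ c.1.1.2 := hfc.2 hv
    have h2 : T.out ∉ T.component {κ}ᶜ v := by
      rw [← hκ, ← c.1.eq_component hvc]; exact c.1.2.2.2
    refine ⟨κ, by simp [h1, h2], Subtype.ext (ColexGraph.Elem.ext_of_mem hκ.symm
      (T.mem_component_self {κ}ᶜ v) hvc)⟩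
  · obtain ⟨h1, h2⟩ := Finset.mem_filter.1 hκ
    exact (hF _ κ (hface κ h2 (Finset.mem_compl.1 h1)) rfl).symm

/-- Adding a symmetric `z` to the potential contributes twice the same entry to a face with two
cells. On a facet one of the two cells is missing, hence the condition on `z`. -/
theorem eq_sum_cells [Fintype T.Cell] {α : Fin 4 → V → Fin 4 → ZMod 2} {τ : T.Face → ZMod 2}
    (hα : T.IsCoboundary α τ) {z : Fin 4 → Fin 4 → ZMod 2} (hz : z ∈ cycleSpace)
    {x : T.Cell → Fin 4 → ZMod 2}
    (hx : ∀ c κ, c.1.1.1 = {κ}ᶜ → ∀ v ∈ c.1.1.2, x c = α κ v + z κ) {f : T.Face}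
    [DecidablePred (T.IsFaceOf f)]
    (hf : ∀ κ, T.OnFacet κ f → z κ = 0) :
    τ f = ∑ c with T.IsFaceOf f c, ∑ l ∈ f.1.1.1ᶜ, x c l := by
  obtain ⟨v, hv⟩ : (T.verts f).Nonempty := f.1.nonempty
  rw [sum_cells (K := fun κ => ∑ l ∈ f.1.1.1ᶜ, (α κ v + z κ) l) hv
    (fun c κ hc hκ => by rw [hx c κ hκ v (hc.2 hv)]) fun κ hκ h => ?_]
  · obtain ⟨i, j, hij, h⟩ := ColexGraph.exists_eq_compl_pair f.2
    have h1 := hα.faceValue_eq i j hij v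
    rw [← h, ColexGraph.faceValue_of_mem τ f hv] at h1
    rw [h1, h, compl_compl, Finset.sum_pair hij, Finset.sum_pair hij, Finset.sum_pair hij]
    simp only [Pi.add_apply, (hα.isRow i v).1, (hα.isRow j v).1, (hz.2 i).1, (hz.2 j).1, hz.1 j i]
    have := CharTwo.add_self_eq_zero (z i j)
    linear_combination -this
  · have h1 : α κ v = 0 := by
      rw [hα.toIsPotential.eq_of_mem_component (by simp) (T.mem_component_comm.1 h), hα.out]
    have h3 : f.1.1.1 ⊆ {κ}ᶜ := by
      rwa [Finset.subset_compl_comm, Finset.singleton_subset_iff, Finset.mem_compl]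
    have h2 : z κ = 0 := hf κ ⟨h3, fun w hw => by
      rw [ColexGraph.verts, f.1.eq_component hv] at hw
      rw [← T.component_eq (T.mem_component_comm.1 h)]
      exact T.component_mono h3 v hw⟩
    simp [h1, h2]

theorem exists_cell_rows {α : Fin 4 → V → Fin 4 → ZMod 2} (hα : T.IsPotential α)
    (z : Fin 4 → Fin 4 → ZMod 2) : ∃ x : T.Cell → Fin 4 → ZMod 2,
      ∀ c κ, c.1.1.1 = {κ}ᶜ → ∀ v ∈ c.1.1.2, x c = α κ v + z κ := by
  refine ⟨fun c => ∑ κ ∈ c.1.1.1ᶜ, (α κ c.1.nonempty.some + z κ), fun c κ hκ v hv => ?_⟩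
  simp only [hκ, compl_compl, Finset.sum_singleton]
  rw [hα.eq_of_mem c.1 (by simp [hκ]) hv c.1.nonempty.some_mem]

/-- After exchanging the sums, each cell contributes zero: a boundary cell since its shifted row
vanishes, any other cell that meets the component since `φ` is chargeless there. -/
theorem sum_componentFaces_eq_zero {φ : Finset T.Face} (hφ : (φ : Set T.Face) ⊆ T.facesOf C)
    (hch : ∀ c, c ∉ T.dualVertices (T.facesOf C)ᶜ → Chargeless φ c) {u : T.Cell}
    {α : Fin 4 → V → Fin 4 → ZMod 2} {τ : T.Face → ZMod 2} (hα : T.IsCoboundary α τ)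
    {z : Fin 4 → Fin 4 → ZMod 2} (hz : z ∈ cycleSpace)
    (hag : ∀ c, (T.dualGraph (φ : Set T.Face)).Reachable u c → c ∈ T.boundaryCells C →
      T.AgreesOnCell α z c)
    (hfacet : ∀ κ, ∀ f ∈ componentFaces φ u, T.OnFacet κ f → z κ = 0) :
    ∑ f ∈ componentFaces φ u, τ f = 0 := by
  classical
  have := T.finite
  have := Fintype.ofFinite T.Cell
  obtain ⟨x, hx⟩ := exists_cell_rows hα.toIsPotential z
  rw [Finset.sum_congr rfl fun f hf => eq_sum_cells hα hz hx fun κ => hfacet κ f hf]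
  simp only [Finset.sum_filter]
  rw [Finset.sum_comm]
  refine Finset.sum_eq_zero fun c _ => ?_
  by_cases hc : ∃ f ∈ componentFaces φ u, T.IsFaceOf f c
  swap
  · push Not at hc
    exact Finset.sum_eq_zero fun f hf => if_neg (hc f hf)
  obtain ⟨f, hf, hfc⟩ := hc
  have hr := reachable_of_mem_componentFaces hf hfc
  obtain ⟨κ, hκ⟩ := ColexGraph.exists_eq_compl_singleton c.2
  obtain ⟨v, hv⟩ := c.1.nonempty
  by_cases hb : c ∈ T.boundaryCells C
  · have h0 : x c = 0 := by
      rw [hx c κ hκ v hv, hag c hr hb v hv κ (by simp [hκ])]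
      funext i
      exact CharTwo.add_self_eq_zero _
    simp [h0]
  · have h1 := hch c (fun h => hb ⟨⟨f, hφ (mem_componentFaces.1 hf).1, hfc⟩, h⟩) κ (x c) hκ
      (by rw [hx c κ hκ v hv]; exact (hα.isRow κ v).add (hz.2 κ))
    -- All faces of `φ` in a cell of the component belong to the component.
    refine .trans (Finset.sum_subset (s₂ := φ) (fun g hg => (mem_componentFaces.1 hg).1) ?_) h1
    exact fun g hg hn => if_neg fun h => hn (mem_componentFaces.2 ⟨hg, c, hr, h⟩)

theorem chargeless_sdiff_componentFaces [DecidableEq T.Face] {φ : Finset T.Face} {c : T.Cell}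
    (h : Chargeless φ c) (u : T.Cell) : Chargeless (φ \ componentFaces φ u) c := by
  classical
  intro κ a hκ ha
  by_cases hr : (T.dualGraph (φ : Set T.Face)).Reachable u c
  · refine Finset.sum_eq_zero fun f hf => if_neg fun hfc => ?_
    rw [Finset.mem_sdiff] at hf
    exact hf.2 (mem_componentFaces.2 ⟨hf.1, c, hr, hfc⟩)
  · refine .trans (Finset.sum_subset (s₂ := φ) Finset.sdiff_subset ?_) (h κ a hκ ha)
    refine fun f hf hn => if_neg fun hfc => ?_
    rw [Finset.mem_sdiff, not_and_not_right] at hn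
    exact hr (reachable_of_mem_componentFaces (hn hf) hfc)

/-- The components are split off one at a time; the remaining faces stay chargeless because a cell
has faces of `φ` in at most one component. -/
theorem exists_forall_sum_eq_zero
    (hface : ∀ c : T.Cell, {f : T.Face | T.IsFaceOf f c}.ncard ≤ kface)
    (hsimple : T.MeetsSimply C) (hk : T.DistBound C k) {φ : Finset T.Face}
    (hφ : (φ : Set T.Face) ⊆ T.facesOf C)
    (hch : ∀ c, c ∉ T.dualVertices (T.facesOf C)ᶜ → Chargeless φ c) :
    ∃ M : Finset T.Face, (M.card : ℝ) ≤ k * (2 * φ.card) * (2 * (kface - 1) : ℕ) ∧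
      (∀ g ∈ M, g ∉ T.facesOf C) ∧
      ∀ α τ, T.IsCoboundary α τ → (∀ g ∈ M, τ g = 0) → ∑ f ∈ φ, τ f = 0 := by
  classical
  induction φ using Finset.strongInduction with
  | H φ ih =>
    rcases φ.eq_empty_or_nonempty with rfl | ⟨f, hf⟩
    · exact ⟨∅, by simp, by simp, by simp⟩
    obtain ⟨u, -, hfu⟩ := hφ hf
    have hsub : componentFaces φ u ⊆ φ := fun g hg => (mem_componentFaces.1 hg).1
    have hfm : f ∈ componentFaces φ u := mem_componentFaces.2 ⟨hf, u, .rfl, hfu⟩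
    obtain ⟨M₁, hM₁, hMC₁, h₁⟩ := exists_agrees_on_component hface hsimple hk hφ u
    obtain ⟨M₂, hM₂, hMC₂, h₂⟩ := ih (φ \ componentFaces φ u)
      (Finset.sdiff_ssubset hsub ⟨f, hfm⟩)
      (fun g hg => hφ (Finset.sdiff_subset hg))
      fun c hc => chargeless_sdiff_componentFaces (hch c hc) u
    refine ⟨M₁ ∪ M₂, ?_, fun g hg => (Finset.mem_union.1 hg).elim (hMC₁ g) (hMC₂ g),
      fun α τ hα hτ => ?_⟩
    · have h3 : ((M₁ ∪ M₂).card : ℝ) ≤ M₁.card + M₂.card := by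
        exact_mod_cast Finset.card_union_le M₁ M₂
      have h4 : ((φ \ componentFaces φ u).card : ℝ) + (componentFaces φ u).card = φ.card := by
        exact_mod_cast Finset.card_sdiff_add_card_eq_card hsub
      refine (h3.trans (add_le_add hM₁ hM₂)).trans_eq ?_
      rw [← h4]; ring
    · rw [← Finset.sum_sdiff hsub, h₂ α τ hα fun g hg => hτ g (Finset.mem_union_right _ hg), zero_add]
      obtain ⟨z, hz, hag, hfacet⟩ := h₁ α τ hα fun g hg => hτ g (Finset.mem_union_left _ hg)
      exact sum_componentFaces_eq_zero hφ hch hα hz hag hfacet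

theorem closureCondition_of_distBound
    (hface : ∀ c : T.Cell, {f : T.Face | T.IsFaceOf f c}.ncard ≤ kface)
    (hsimple : T.MeetsSimply C) (hk : T.DistBound C k) :
    T.ClosureCondition C (4 * k * ((kface : ℝ) - 1)) := by
  have := T.finite
  rintro φ ⟨hφ, φ'', hφ'', hsyn⟩
  -- The empty case is separate because the real number `kface - 1` may be negative when there are
  -- no cells. A face in `φ` provides a cell, hence `2 ≤ kface`.
  rcases φ.eq_empty_or_nonempty with rfl | ⟨f, hf⟩
  · exact ⟨∅, by simp, by simp, ∅, by simp, by ext; simp⟩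
  obtain ⟨u, -, -⟩ := hφ hf
  have h2 := two_le_of_faces_le hface u
  obtain ⟨φ, rfl⟩ := φ.toFinite.exists_finset_coe
  obtain ⟨M, hM, hMC, h⟩ := exists_forall_sum_eq_zero hface hsimple hk hφ fun c hc =>
    chargeless_of_symmDiff_mem hsyn fun f hf hfc => hc ⟨f, hφ'' hf, hfc⟩
  obtain ⟨φ', hφ', hs⟩ := T.exists_symmDiff_mem_syndromes M φ h
  refine ⟨φ', fun f hf => hMC f (hφ' hf), ?_, hs⟩
  have h3 : (φ'.ncard : ℝ) ≤ M.card := by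
    rw [← Set.ncard_coe_finset]
    exact_mod_cast Set.ncard_le_ncard hφ'
  refine (h3.trans hM).trans_eq ?_
  rw [Set.ncard_coe_finset]
  push_cast [show 1 ≤ kface by omega]
  ring

end TetrahedralColex

theorem mainTheorem3 {V : Type*} (T : TetrahedralColex V) (C : Set T.Cell) (kface : ℕ) (k : ℝ≥0)
    (hface : ∀ c : T.Cell, {f : T.Face | T.IsFaceOf f c}.ncard ≤ kface)
    (hsimple : ∀ c ∉ C, T.points c ∩ (⋃ c' ∈ C, T.points c') = ∅ ∨
      IsSimplyConnected (T.points c ∩ (⋃ c' ∈ C, T.points c')))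
    (hdist : ∀ v ∈ T.dualVertices (T.facesOf C) ∩ T.dualVertices (T.facesOf C)ᶜ,
      ∀ v' ∈ T.dualVertices (T.facesOf C) ∩ T.dualVertices (T.facesOf C)ᶜ,
        (T.dist (T.facesOf C)ᶜ v v' : ℝ≥0∞) ≤ k * (T.dist (T.facesOf C) v v' : ℝ≥0∞))
    (hfacet : ∀ (κ : Fin 4), ∀ v ∈ T.dualVertices (T.facesOf C) ∩ T.dualVertices (T.facesOf C)ᶜ,
      (min (T.facetDist (T.facesOf C)ᶜ κ v) (T.twoFacetDist (T.facesOf C)ᶜ v) : ℝ≥0∞) ≤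
        k * (T.facetDist (T.facesOf C) κ v : ℝ≥0∞)) :
    T.ClosureCondition C (4 * k * ((kface : ℝ) - 1)) :=
  T.closureCondition_of_distBound hface hsimple ⟨hdist, hfacet⟩
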